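/- Let $G$ be a connected complex Lie group with finite-dimensional Lie algebra $\mathfrak g$, let $U\subset G$ be a closed connected complex Lie subgroup with Lie algebra $\mathfrak u\subset\mathfrak g$, and let $p:G\to G/U$ be the natural projection onto the complex manifold $G/U$. Identify exterior powers with spaces of skew-symmetric tensors. For $r\in\mathfrak g\otimes\mathfrak g$ put $$\mathrm{CYB}(r)=[r^{12},r^{13}]+[r^{12},r^{23}]+[r^{13},r^{23}]\in\mathfrak g^{\otimes 3}.$$ Assume that $\mathfrak u$ has an $\mathfrak u$-invariant complement $\mathfrak m$ in $\mathfrak g$, and let $\rho\in\mathfrak g\otimes\mathfrak g$ satisfy $\mathrm{CYB}(\rho)=0$, be $\mathfrak u$-invariant, and have $\mathfrak g$-invariant symmetric part, i.e. $\Omega=\rho+\rho^{21}\in(S^2\mathfrak g)^{\mathfrak g}$. Let $\pi_\rho=\overrightarrow{\rho}-\overleftarrow{\rho}$ be the difference of the left invariant and the right invariant tensor field on $G$ with value $\rho$ at the identity. Let $b\in(\wedge^2(\mathfrak g/\mathfrak u))^{\mathfrak u}$, identified both with an element of $(\wedge^2\mathfrak m)^{\mathfrak u}$ by means of $\mathfrak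 g/\mathfrak u\cong\mathfrak m$ and with a bivector at the base point of $G/U$ by means of $T_{p(e)}(G/U)\cong\mathfrak g/\mathfrak u$, and let $L_g:G/U\to G/U$ denote the action of $g\in G$. Then $$\pi(p(g))=(L_g)_*b+p_*\pi_\rho(g)\qquad(g\in G)$$ is a well-defined holomorphic bivector field on $G/U$, and $\pi$ is Poisson (that is, the bracket $\{f_1,f_2\}=\langle df_1\otimes df_2,\pi\rangle$ of local holomorphic functions satisfies the Jacobi identity) if and only if $\mathrm{CYB}(\rho+b)=0$ in $\wedge^3(\mathfrak g/\mathfrak u)$, i.e. the image of $\mathrm{CYB}(\rho+b)$ under $\mathfrak g^{\otimes 3}\to(\mathfrak g/\mathfrak u)^{\otimes 3}$ is zero. -/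

import Mathlib

open scoped TensorProduct Manifold ContDiff Topology

/-! ### Tensors over a Lie algebra

In characteristic zero the exterior powers `∧²V` and `∧³V` are identified, as usual, with the spaces
of skew-symmetric tensors in `V ⊗ V` and `V ⊗ (V ⊗ V)`. -/

section Algebra

variable {L : Type*} [LieRing L] [LieAlgebra ℂ L]

/-- `a ⊗ b ↦ [a¹², b¹³]`, i.e. `(x ⊗ x') ⊗ (y ⊗ y') ↦ [x, y] ⊗ (x' ⊗ y')`. -/
noncomputable def bracket12_13 :
    (L ⊗[ℂ] L) ⊗[ℂ] (L ⊗[ℂ] L) →ₗ[ℂ] L ⊗[ℂ] (L ⊗[ℂ] L) :=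
  TensorProduct.map (LieModule.toModuleHom ℂ L L : L ⊗[ℂ] L →ₗ[ℂ] L) LinearMap.id ∘ₗ
    (TensorProduct.tensorTensorTensorComm ℂ L L L L).toLinearMap

/-- `a ⊗ b ↦ [a¹², b²³]`, i.e. `(x ⊗ x') ⊗ (y ⊗ y') ↦ x ⊗ ([x', y] ⊗ y')`. -/
noncomputable def bracket12_23 :
    (L ⊗[ℂ] L) ⊗[ℂ] (L ⊗[ℂ] L) →ₗ[ℂ] L ⊗[ℂ] (L ⊗[ℂ] L) :=
  TensorProduct.map LinearMap.id
      (TensorProduct.map (LieModule.toModuleHom ℂ L L : L ⊗[ℂ] L →ₗ[ℂ] L) LinearMap.id ∘ₗ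
        (TensorProduct.assoc ℂ L L L).symm.toLinearMap) ∘ₗ
    (TensorProduct.assoc ℂ L L (L ⊗[ℂ] L)).toLinearMap

/-- `a ⊗ b ↦ [a¹³, b²³]`, i.e. `(x ⊗ x') ⊗ (y ⊗ y') ↦ x ⊗ (y ⊗ [x', y'])`. -/
noncomputable def bracket13_23 :
    (L ⊗[ℂ] L) ⊗[ℂ] (L ⊗[ℂ] L) →ₗ[ℂ] L ⊗[ℂ] (L ⊗[ℂ] L) :=
  (TensorProduct.assoc ℂ L L L).toLinearMap ∘ₗ
    TensorProduct.map LinearMap.id (LieModule.toModuleHom ℂ L L : L ⊗[ℂ] L →ₗ[ℂ] L) ∘ₗ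
    (TensorProduct.tensorTensorTensorComm ℂ L L L L).toLinearMap

theorem bracket12_13_tmul (x x' y y' : L) :
    bracket12_13 ((x ⊗ₜ[ℂ] x') ⊗ₜ[ℂ] (y ⊗ₜ[ℂ] y')) = ⁅x, y⁆ ⊗ₜ[ℂ] (x' ⊗ₜ[ℂ] y') := by
  simp [bracket12_13]

theorem bracket12_23_tmul (x x' y y' : L) :
    bracket12_23 ((x ⊗ₜ[ℂ] x') ⊗ₜ[ℂ] (y ⊗ₜ[ℂ] y')) = x ⊗ₜ[ℂ] (⁅x', y⁆ ⊗ₜ[ℂ] y') := by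
  simp [bracket12_23]

theorem bracket13_23_tmul (x x' y y' : L) :
    bracket13_23 ((x ⊗ₜ[ℂ] x') ⊗ₜ[ℂ] (y ⊗ₜ[ℂ] y')) = x ⊗ₜ[ℂ] (y ⊗ₜ[ℂ] ⁅x', y'⁆) := by
  simp [bracket13_23]

/-- The classical Yang–Baxter operator
`CYB(r) = [r¹², r¹³] + [r¹², r²³] + [r¹³, r²³] ∈ L ⊗ L ⊗ L`. -/
noncomputable def CYB (r : L ⊗[ℂ] L) : L ⊗[ℂ] (L ⊗[ℂ] L) :=
  bracket12_13 (r ⊗ₜ[ℂ] r) + bracket12_23 (r ⊗ₜ[ℂ] r) + bracket13_23 (r ⊗ₜ[ℂ] r)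

/-- The map `V ⊗ V → V ⊗ V` exchanging the factors, `r ↦ r²¹`. -/
noncomputable def flip21 {V : Type*} [AddCommGroup V] [Module ℂ V] (r : V ⊗[ℂ] V) : V ⊗[ℂ] V :=
  TensorProduct.comm ℂ V V r

/-- `r` is a bivector, i.e. lies in `∧²V ⊆ V ⊗ V`. -/
def IsSkew {V : Type*} [AddCommGroup V] [Module ℂ V] (r : V ⊗[ℂ] V) : Prop :=
  flip21 r = -r

/-- The quotient `𝔤/𝔲`, as a module over `𝔲`. -/
abbrev LieQuot (u : LieSubalgebra ℂ L) : Type _ := L ⧸ u.toLieSubmodule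

/-- The map `𝔤 ⊗ 𝔤 ⊗ 𝔤 → 𝔤/𝔲 ⊗ 𝔤/𝔲 ⊗ 𝔤/𝔲` induced by the projection. -/
noncomputable def toQuot3 (u : LieSubalgebra ℂ L) :
    L ⊗[ℂ] (L ⊗[ℂ] L) →ₗ[ℂ] LieQuot u ⊗[ℂ] (LieQuot u ⊗[ℂ] LieQuot u) :=
  let q : L →ₗ[ℂ] LieQuot u := u.toSubmodule.mkQ
  TensorProduct.map q (TensorProduct.map q q)

/-- The linear section `𝔤/𝔲 ≃ 𝔪 ⊆ 𝔤` of the projection, given by a complement `𝔪` of `𝔲`. -/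
noncomputable def complSection (u : LieSubalgebra ℂ L) (m : LieSubmodule ℂ u L)
    (hm : IsCompl u.toSubmodule m.toSubmodule) : LieQuot u →ₗ[ℂ] L :=
  m.toSubmodule.subtype ∘ₗ
    (Submodule.quotientEquivOfIsCompl u.toSubmodule m.toSubmodule hm).toLinearMap

/-- The identification of `𝔤/𝔲 ⊗ 𝔤/𝔲` with `𝔪 ⊗ 𝔪 ⊆ 𝔤 ⊗ 𝔤`. -/
noncomputable def complLift (u : LieSubalgebra ℂ L) (m : LieSubmodule ℂ u L)
    (hm : IsCompl u.toSubmodule m.toSubmodule) :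
    LieQuot u ⊗[ℂ] LieQuot u →ₗ[ℂ] L ⊗[ℂ] L :=
  TensorProduct.map (complSection u m hm) (complSection u m hm)

end Algebra

/-! ### Bivector fields on complex manifolds -/

section Bivector

variable {E : Type*} [NormedAddCommGroup E] [NormedSpace ℂ E]
  {M : Type*} [TopologicalSpace M] [ChartedSpace E M]

/-- `T_x M ⊗ T_x M`, which contains `∧²(T_x M)` as the skew-symmetric tensors. -/
abbrev TangentSq (E : Type*) [NormedAddCommGroup E] [NormedSpace ℂ E]
    {M : Type*} [TopologicalSpace M] [ChartedSpace E M] (x : M) : Type _ :=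
  TangentSpace 𝓘(ℂ, E) x ⊗[ℂ] TangentSpace 𝓘(ℂ, E) x

/-- The differential `d_x f : T_x M → ℂ` of a complex function. -/
noncomputable def differentialAt (E : Type*) [NormedAddCommGroup E] [NormedSpace ℂ E]
    {M : Type*} [TopologicalSpace M] [ChartedSpace E M] (f : M → ℂ) (x : M) :
    TangentSpace 𝓘(ℂ, E) x →ₗ[ℂ] ℂ :=
  (mfderiv 𝓘(ℂ, E) 𝓘(ℂ, ℂ) f x).toLinearMap

/-- The bracket `{f, g}(x) = ⟨d_x f ⊗ d_x g, π(x)⟩` of functions defined by a bivector field. -/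
noncomputable def bivectorBracket (π : (x : M) → TangentSq E x) (f g : M → ℂ) (x : M) : ℂ :=
  LinearMap.mul' ℂ ℂ (TensorProduct.map (differentialAt E f x) (differentialAt E g x) (π x))

/-- `π` is a (holomorphic) bivector field: it is skew-symmetric at every point, and its contraction
with the differentials of two local holomorphic functions is holomorphic. -/
def IsBivectorField (π : (x : M) → TangentSq E x) : Prop :=
  (∀ x, IsSkew (π x)) ∧
  ∀ V : Set M, IsOpen V → ∀ f g : M → ℂ,
    ContMDiffOn 𝓘(ℂ, E) 𝓘(ℂ, ℂ) ω f V → ContMDiffOn 𝓘(ℂ, E) 𝓘(ℂ, ℂ) ω g V →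
    ContMDiffOn 𝓘(ℂ, E) 𝓘(ℂ, ℂ) ω (bivectorBracket π f g) V

/-- A bivector field is Poisson if its bracket satisfies the Jacobi identity on local holomorphic
functions. -/
def IsPoisson (π : (x : M) → TangentSq E x) : Prop :=
  ∀ V : Set M, IsOpen V → ∀ f g h : M → ℂ,
    ContMDiffOn 𝓘(ℂ, E) 𝓘(ℂ, ℂ) ω f V → ContMDiffOn 𝓘(ℂ, E) 𝓘(ℂ, ℂ) ω g V →
    ContMDiffOn 𝓘(ℂ, E) 𝓘(ℂ, ℂ) ω h V →
    ∀ x ∈ V, bivectorBracket π f (bivectorBracket π g h) x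
      + bivectorBracket π g (bivectorBracket π h f) x
      + bivectorBracket π h (bivectorBracket π f g) x = 0

end Bivector

/-! ### Lie groups and homogeneous spaces -/

section LieGroups

variable {E : Type*} [NormedAddCommGroup E] [NormedSpace ℂ E]
  {G : Type*} [TopologicalSpace G] [ChartedSpace E G] [Group G]

/-- The tangent vectors at the identity to a closed subgroup `U`: the velocities at `0` of curves in
`G` that run inside `U` and start at the identity. (Curves are differentiated in the preferred chart
at the identity, which is the one that identifies `T_1 G` with the model space.) -/
def subgroupTangent (U : Subgroup G) : Set (GroupLieAlgebra 𝓘(ℂ, E) G) :=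
  {x | ∃ γ : ℝ → G, γ 0 = 1 ∧ (∀ t, γ t ∈ U) ∧ ContinuousAt γ 0 ∧
    HasDerivAt (fun t => extChartAt 𝓘(ℂ, E) (1 : G) (γ t)) (x : E) 0}

/-- The derivative at the identity of the left translation `h ↦ g h`. -/
noncomputable def leftTranslation (g : G) :
    GroupLieAlgebra 𝓘(ℂ, E) G →ₗ[ℂ] TangentSpace 𝓘(ℂ, E) g :=
  (mfderiv 𝓘(ℂ, E) 𝓘(ℂ, E) (fun h : G => g * h) 1).toLinearMap

/-- The derivative at the identity of the right translation `h ↦ h g`. -/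
noncomputable def rightTranslation (g : G) :
    GroupLieAlgebra 𝓘(ℂ, E) G →ₗ[ℂ] TangentSpace 𝓘(ℂ, E) g :=
  (mfderiv 𝓘(ℂ, E) 𝓘(ℂ, E) (fun h : G => h * g) 1).toLinearMap

/-- The left invariant tensor field on `G` with value `a` at the identity. -/
noncomputable def leftInvariantTensor
    (a : GroupLieAlgebra 𝓘(ℂ, E) G ⊗[ℂ] GroupLieAlgebra 𝓘(ℂ, E) G) (g : G) : TangentSq E g :=
  TensorProduct.map (leftTranslation g) (leftTranslation g) a

/-- The right invariant tensor field on `G` with value `a` at the identity. -/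
noncomputable def rightInvariantTensor
    (a : GroupLieAlgebra 𝓘(ℂ, E) G ⊗[ℂ] GroupLieAlgebra 𝓘(ℂ, E) G) (g : G) : TangentSq E g :=
  TensorProduct.map (rightTranslation g) (rightTranslation g) a

/-- The field `π_ρ` on `G`: the left invariant minus the right invariant tensor field of `ρ`. -/
noncomputable def groupBivector
    (ρ : GroupLieAlgebra 𝓘(ℂ, E) G ⊗[ℂ] GroupLieAlgebra 𝓘(ℂ, E) G) (g : G) : TangentSq E g :=
  leftInvariantTensor ρ g - rightInvariantTensor ρ g

variable (E' : Type*) [NormedAddCommGroup E'] [NormedSpace ℂ E']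
  (U : Subgroup G) [ChartedSpace E' (G ⧸ U)]

/-- The differential at `g` of the projection `p : G → G/U`. -/
noncomputable def projDeriv (g : G) :
    TangentSpace 𝓘(ℂ, E) g →ₗ[ℂ] TangentSpace 𝓘(ℂ, E') (g : G ⧸ U) :=
  (mfderiv 𝓘(ℂ, E) 𝓘(ℂ, E') (fun h : G => (h : G ⧸ U)) g).toLinearMap

/-- The differential at the base point of the action `L_g : G/U → G/U`. -/
noncomputable def actionDeriv (g : G) :
    TangentSpace 𝓘(ℂ, E') ((1 : G) : G ⧸ U) →ₗ[ℂ] TangentSpace 𝓘(ℂ, E') (g : G ⧸ U) :=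
  (mfderiv 𝓘(ℂ, E') 𝓘(ℂ, E') (fun q : G ⧸ U => g • q) ((1 : G) : G ⧸ U)).toLinearMap

/-- `(p_* π)(g)` for a tensor `t = π(g)` at `g ∈ G`. -/
noncomputable def projPush (g : G) (t : TangentSq E g) : TangentSq E' (g : G ⧸ U) :=
  TensorProduct.map (projDeriv E' U g) (projDeriv E' U g) t

/-- `(L_g)_* t` for a tensor `t` at the base point of `G/U`. -/
noncomputable def actionPush (g : G) (t : TangentSq E' ((1 : G) : G ⧸ U)) :
    TangentSq E' (g : G ⧸ U) :=
  TensorProduct.map (actionDeriv E' U g) (actionDeriv E' U g) t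

end LieGroups

/-! Local functions on G/U are local right U-invariant functions on G, so the bracket can be
computed on G with the left invariant derivatives L_a (`lder`) and the right invariant derivatives
R_a (`rder`). Write β for the lift of b to 𝔪 ⊗ 𝔪, and ρ = r + s with r skew and s = Ω/2. By
`pair_push`, the bracket of π pulls back to the left invariant bracket of ρ + β minus the right
invariant bracket of ρ. As G is connected, the 𝔤-invariant tensor s is Ad-invariant, so its left and
right invariant fields agree and cancel (`liftedBracket_eq`). What remains is the left bracket of r
+ β minus the right bracket of r, both skew.

The operators L_a, and likewise the operators -R_a, represent the Lie algebra, and the two families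
commute. In the Jacobi sum the purely left terms therefore give CYB(r + β) evaluated on left
derivatives, the purely right terms give CYB(r) evaluated on the derivatives -R_a, and the mixed
terms cancel (`cyclicPair_eq_CYB`, `cyclicPair_mixed`, `sum_bracket_bracket_eq`). An invariant
summand contributes no cross terms to CYB against a skew one (`CYB_add_of_invariant`), so CYB(ρ) = 0
says CYB(r) = -CYB(s), while CYB(ρ + β) = CYB(r + β) + CYB(s). Since CYB(s) is again invariant, it
takes the same value on left and on right derivatives, and the whole Jacobi sum is CYB(ρ + β)
evaluated on left derivatives (`sum_liftedBracket`).

The left derivatives of a function pulled back from G/U vanish on 𝔲, and at the identity every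
functional vanishing on 𝔲 arises in this way (`exists_lder_one_eq`). Hence the Jacobi identity holds
exactly when CYB(ρ + β) dies in the third tensor power of 𝔤/𝔲.

Replacing g by gk with k ∈ U composes left derivatives with Ad k and leaves right ones unchanged.
Because U is connected and ρ + β is 𝔲-invariant, the bivector depends only on the coset
(`pushBivector_mul_right`). Holomorphy descends along local sections of the submersion p. The Lie
theory needed is that the differential of Ad is ad (`integratesLieAction_Ad`) and that the kernel of
dp at the identity is 𝔲 (`projDeriv_one_eq_zero_iff`). -/

/-! ### Functionals on tensor powers and the Jacobi identity in multilinear form -/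

section MultilinearJacobi

variable {V : Type*} [AddCommGroup V] [Module ℂ V]

/-- The functional `α ⊗ β` on `V ⊗ V`. -/
noncomputable def pair (α β : V →ₗ[ℂ] ℂ) : V ⊗[ℂ] V →ₗ[ℂ] ℂ :=
  LinearMap.mul' ℂ ℂ ∘ₗ TensorProduct.map α β

/-- The functional `α ⊗ β ⊗ γ` on `V ⊗ V ⊗ V`. -/
noncomputable def pair3 (α β γ : V →ₗ[ℂ] ℂ) : V ⊗[ℂ] (V ⊗[ℂ] V) →ₗ[ℂ] ℂ :=
  LinearMap.mul' ℂ ℂ ∘ₗ TensorProduct.map α (pair β γ)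

@[simp] theorem pair_tmul (α β : V →ₗ[ℂ] ℂ) (x y : V) : pair α β (x ⊗ₜ y) = α x * β y := by
  simp [pair]

@[simp] theorem pair3_tmul (α β γ : V →ₗ[ℂ] ℂ) (x : V) (t : V ⊗[ℂ] V) :
    pair3 α β γ (x ⊗ₜ t) = α x * pair β γ t := by
  simp [pair3]

theorem pair_add_left (α α' β : V →ₗ[ℂ] ℂ) : pair (α + α') β = pair α β + pair α' β := by
  simp [pair, TensorProduct.map_add_left, LinearMap.comp_add]

theorem pair_add_right (α β β' : V →ₗ[ℂ] ℂ) : pair α (β + β') = pair α β + pair α β' := by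
  simp [pair, TensorProduct.map_add_right, LinearMap.comp_add]

theorem pair_smul_left (c : ℂ) (α β : V →ₗ[ℂ] ℂ) : pair (c • α) β = c • pair α β := by
  simp [pair, TensorProduct.map_smul_left, LinearMap.comp_smul]

theorem pair_smul_right (c : ℂ) (α β : V →ₗ[ℂ] ℂ) : pair α (c • β) = c • pair α β := by
  simp [pair, TensorProduct.map_smul_right, LinearMap.comp_smul]

theorem pair_comp {W : Type*} [AddCommGroup W] [Module ℂ W] (α β : W →ₗ[ℂ] ℂ)
    (f g : V →ₗ[ℂ] W) (t : V ⊗[ℂ] V) :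
    pair (α ∘ₗ f) (β ∘ₗ g) t = pair α β (TensorProduct.map f g t) := by
  simp [pair, TensorProduct.map_comp]

theorem pair3_comp {W : Type*} [AddCommGroup W] [Module ℂ W] (α β γ : W →ₗ[ℂ] ℂ)
    (f g h : V →ₗ[ℂ] W) (t : V ⊗[ℂ] (V ⊗[ℂ] V)) :
    pair3 (α ∘ₗ f) (β ∘ₗ g) (γ ∘ₗ h) t
      = pair3 α β γ (TensorProduct.map f (TensorProduct.map g h) t) := by
  simp [pair3, pair, TensorProduct.map_comp, ← LinearMap.comp_assoc]

theorem pair_flip21 (α β : V →ₗ[ℂ] ℂ) (t : V ⊗[ℂ] V) :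
    pair α β (flip21 t) = pair β α t := by
  induction t with
  | zero => simp [flip21]
  | tmul x y => simp [flip21, mul_comm]
  | add x y hx hy => simp_all [flip21]

theorem flip21_flip21 (t : V ⊗[ℂ] V) : flip21 (flip21 t) = t := by
  simp [flip21]

/-- A bivector is a sum of decomposable bivectors `a ⊗ b - b ⊗ a`. -/
theorem IsSkew.induction {p : V ⊗[ℂ] V → Prop} {s : V ⊗[ℂ] V} (hs : IsSkew s) (zero : p 0)
    (wedge : ∀ a b : V, p (a ⊗ₜ b - b ⊗ₜ a)) (add : ∀ s t, p s → p t → p (s + t)) : p s := by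
  have key : ∀ t : V ⊗[ℂ] V, p (t - flip21 t) := fun t => by
    induction t with
    | zero => simpa [flip21] using zero
    | tmul x y => simpa [flip21] using wedge x y
    | add x y hx hy =>
      convert! add _ _ hx hy using 1
      simp only [flip21, map_add]
      abel
  -- A skew tensor is the antisymmetrization of its own half.
  convert! key ((1 / 2 : ℂ) • s) using 1
  have : flip21 ((1 / 2 : ℂ) • s) = -((1 / 2 : ℂ) • s) := by
    unfold IsSkew flip21 at *
    rw [map_smul, hs, smul_neg]
  rw [this, sub_neg_eq_add, ← add_smul]
  norm_num

/-- `x ↦ Σ Q(x, a) d'(b) + d(a) Q'(x, b)` for `s = Σ a ⊗ b`: the derivative of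
`Σ d(a) d'(b)` when the functionals `d`, `d'` vary with derivatives `Q`, `Q'`. -/
noncomputable def pairDeriv (Q : V →ₗ[ℂ] V →ₗ[ℂ] ℂ) (d' d : V →ₗ[ℂ] ℂ) (Q' : V →ₗ[ℂ] V →ₗ[ℂ] ℂ)
    (s : V ⊗[ℂ] V) : V →ₗ[ℂ] ℂ where
  toFun x := pair (Q x) d' s + pair d (Q' x) s
  map_add' x y := by
    simp only [map_add, pair_add_left, pair_add_right, LinearMap.add_apply]
    ring
  map_smul' c x := by
    simp only [map_smul, pair_smul_left, pair_smul_right, LinearMap.smul_apply, smul_eq_mul,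
      RingHom.id_apply]
    ring

theorem pairDeriv_apply (Q : V →ₗ[ℂ] V →ₗ[ℂ] ℂ) (d' d : V →ₗ[ℂ] ℂ) (Q' : V →ₗ[ℂ] V →ₗ[ℂ] ℂ)
    (s : V ⊗[ℂ] V) (x : V) :
    pairDeriv Q d' d Q' s x = pair (Q x) d' s + pair d (Q' x) s := rfl

@[simp] theorem pairDeriv_zero (Q : V →ₗ[ℂ] V →ₗ[ℂ] ℂ) (d' d : V →ₗ[ℂ] ℂ)
    (Q' : V →ₗ[ℂ] V →ₗ[ℂ] ℂ) : pairDeriv Q d' d Q' 0 = 0 := by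
  ext x; simp [pairDeriv_apply]

theorem pairDeriv_add (Q : V →ₗ[ℂ] V →ₗ[ℂ] ℂ) (d' d : V →ₗ[ℂ] ℂ) (Q' : V →ₗ[ℂ] V →ₗ[ℂ] ℂ)
    (s t : V ⊗[ℂ] V) :
    pairDeriv Q d' d Q' (s + t) = pairDeriv Q d' d Q' s + pairDeriv Q d' d Q' t := by
  ext x; simp only [pairDeriv_apply, map_add, LinearMap.add_apply]; ring

/-- `Σ d₁(a) (∂_b of (Σ d₂(a') d₃(b')))` for `s = Σ a ⊗ b` and `t = Σ a' ⊗ b'`, where `dᵢ` varies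
with derivative `Qᵢ`. -/
noncomputable def iterPair (d₁ : V →ₗ[ℂ] ℂ) (d₂ : V →ₗ[ℂ] ℂ) (Q₂ : V →ₗ[ℂ] V →ₗ[ℂ] ℂ)
    (d₃ : V →ₗ[ℂ] ℂ) (Q₃ : V →ₗ[ℂ] V →ₗ[ℂ] ℂ) (s t : V ⊗[ℂ] V) : ℂ :=
  pair d₁ (pairDeriv Q₂ d₃ d₂ Q₃ t) s

section
variable (d₁ d₂ d₃ : V →ₗ[ℂ] ℂ) (Q₂ Q₃ : V →ₗ[ℂ] V →ₗ[ℂ] ℂ) (s s' t t' : V ⊗[ℂ] V)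

@[simp] theorem iterPair_zero_left : iterPair d₁ d₂ Q₂ d₃ Q₃ 0 t = 0 := by simp [iterPair]

@[simp] theorem iterPair_zero_right : iterPair d₁ d₂ Q₂ d₃ Q₃ s 0 = 0 := by simp [iterPair, pair]

theorem iterPair_add_left : iterPair d₁ d₂ Q₂ d₃ Q₃ (s + s') t
    = iterPair d₁ d₂ Q₂ d₃ Q₃ s t + iterPair d₁ d₂ Q₂ d₃ Q₃ s' t := by
  simp [iterPair]

theorem iterPair_add_right : iterPair d₁ d₂ Q₂ d₃ Q₃ s (t + t')
    = iterPair d₁ d₂ Q₂ d₃ Q₃ s t + iterPair d₁ d₂ Q₂ d₃ Q₃ s t' := by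
  simp [iterPair, pairDeriv_add, pair_add_right]

theorem iterPair_wedge (a b a' b' : V) :
    iterPair d₁ d₂ Q₂ d₃ Q₃ (a ⊗ₜ b - b ⊗ₜ a) (a' ⊗ₜ b' - b' ⊗ₜ a')
      = d₁ a * (Q₂ b a' * d₃ b' - Q₂ b b' * d₃ a' + d₂ a' * Q₃ b b' - d₂ b' * Q₃ b a')
        - d₁ b * (Q₂ a a' * d₃ b' - Q₂ a b' * d₃ a' + d₂ a' * Q₃ a b' - d₂ b' * Q₃ a a') := by
  simp only [iterPair, map_sub, pair_tmul, pairDeriv_apply]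
  ring

end

/-- The cyclic sum of `iterPair`. -/
noncomputable def cyclicPair (d₁ d₂ d₃ e₁ e₂ e₃ : V →ₗ[ℂ] ℂ) (Q₁ Q₂ Q₃ : V →ₗ[ℂ] V →ₗ[ℂ] ℂ)
    (s t : V ⊗[ℂ] V) : ℂ :=
  iterPair d₁ e₂ Q₂ e₃ Q₃ s t + iterPair d₂ e₃ Q₃ e₁ Q₁ s t + iterPair d₃ e₁ Q₁ e₂ Q₂ s t

section
variable (d₁ d₂ d₃ e₁ e₂ e₃ : V →ₗ[ℂ] ℂ) (Q₁ Q₂ Q₃ : V →ₗ[ℂ] V →ₗ[ℂ] ℂ) (s s' t t' : V ⊗[ℂ] V)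

@[simp] theorem cyclicPair_zero_left : cyclicPair d₁ d₂ d₃ e₁ e₂ e₃ Q₁ Q₂ Q₃ 0 t = 0 := by
  simp [cyclicPair]

@[simp] theorem cyclicPair_zero_right : cyclicPair d₁ d₂ d₃ e₁ e₂ e₃ Q₁ Q₂ Q₃ s 0 = 0 := by
  simp [cyclicPair]

theorem cyclicPair_add_left : cyclicPair d₁ d₂ d₃ e₁ e₂ e₃ Q₁ Q₂ Q₃ (s + s') t
    = cyclicPair d₁ d₂ d₃ e₁ e₂ e₃ Q₁ Q₂ Q₃ s t + cyclicPair d₁ d₂ d₃ e₁ e₂ e₃ Q₁ Q₂ Q₃ s' t := by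
  simp only [cyclicPair, iterPair_add_left]
  ring

theorem cyclicPair_add_right : cyclicPair d₁ d₂ d₃ e₁ e₂ e₃ Q₁ Q₂ Q₃ s (t + t')
    = cyclicPair d₁ d₂ d₃ e₁ e₂ e₃ Q₁ Q₂ Q₃ s t + cyclicPair d₁ d₂ d₃ e₁ e₂ e₃ Q₁ Q₂ Q₃ s t' := by
  simp only [cyclicPair, iterPair_add_right]
  ring

end

/-! ### Second derivatives whose antisymmetric part is a Lie bracket -/

section Lie

variable {L : Type*} [LieRing L] [LieAlgebra ℂ L]

/-- The polarization of `CYB`. -/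
noncomputable def CYBpair :
    (L ⊗[ℂ] L) ⊗[ℂ] (L ⊗[ℂ] L) →ₗ[ℂ] L ⊗[ℂ] (L ⊗[ℂ] L) :=
  bracket12_13 + bracket12_23 + bracket13_23

theorem CYB_eq_CYBpair (r : L ⊗[ℂ] L) : CYB r = CYBpair (r ⊗ₜ r) := rfl

theorem CYBpair_tmul (x x' y y' : L) :
    CYBpair ((x ⊗ₜ[ℂ] x') ⊗ₜ[ℂ] (y ⊗ₜ[ℂ] y')) = ⁅x, y⁆ ⊗ₜ[ℂ] (x' ⊗ₜ[ℂ] y')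
      + x ⊗ₜ[ℂ] (⁅x', y⁆ ⊗ₜ[ℂ] y') + x ⊗ₜ[ℂ] (y ⊗ₜ[ℂ] ⁅x', y'⁆) := by
  simp only [CYBpair, LinearMap.add_apply, bracket12_13_tmul, bracket12_23_tmul,
    bracket13_23_tmul]

/-- On decomposable bivectors the cyclic sum contains second derivatives only in the combinations `Q
a b - Q b a`, which the hypotheses turn into brackets. The identity is polarized because an
induction over sums in both arguments needs a bilinear statement. -/
theorem cyclicPair_polarized {d₁ d₂ d₃ : L →ₗ[ℂ] ℂ} {Q₁ Q₂ Q₃ : L →ₗ[ℂ] L →ₗ[ℂ] ℂ}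
    (h₁ : ∀ a b, Q₁ a b - Q₁ b a = d₁ ⁅a, b⁆) (h₂ : ∀ a b, Q₂ a b - Q₂ b a = d₂ ⁅a, b⁆)
    (h₃ : ∀ a b, Q₃ a b - Q₃ b a = d₃ ⁅a, b⁆) {s t : L ⊗[ℂ] L} (hs : IsSkew s) (ht : IsSkew t) :
    cyclicPair d₁ d₂ d₃ d₁ d₂ d₃ Q₁ Q₂ Q₃ s t + cyclicPair d₁ d₂ d₃ d₁ d₂ d₃ Q₁ Q₂ Q₃ t s
      = pair3 d₁ d₂ d₃ (CYBpair (s ⊗ₜ t) + CYBpair (t ⊗ₜ s)) := by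
  refine hs.induction (p := fun s => cyclicPair d₁ d₂ d₃ d₁ d₂ d₃ Q₁ Q₂ Q₃ s t
    + cyclicPair d₁ d₂ d₃ d₁ d₂ d₃ Q₁ Q₂ Q₃ t s
      = pair3 d₁ d₂ d₃ (CYBpair (s ⊗ₜ t) + CYBpair (t ⊗ₜ s)))
    (by simp) (fun a b => ?_) (fun s s' h h' => ?_)
  · refine ht.induction (p := fun t => cyclicPair d₁ d₂ d₃ d₁ d₂ d₃ Q₁ Q₂ Q₃ (a ⊗ₜ b - b ⊗ₜ a) t
      + cyclicPair d₁ d₂ d₃ d₁ d₂ d₃ Q₁ Q₂ Q₃ t (a ⊗ₜ b - b ⊗ₜ a)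
      = pair3 d₁ d₂ d₃ (CYBpair ((a ⊗ₜ b - b ⊗ₜ a) ⊗ₜ t) + CYBpair (t ⊗ₜ (a ⊗ₜ b - b ⊗ₜ a))))
      (by simp) (fun a' b' => ?_) (fun t t' h h' => ?_)
    · simp only [cyclicPair, iterPair_wedge, TensorProduct.tmul_sub, TensorProduct.sub_tmul,
        map_add, map_sub, CYBpair_tmul, pair3_tmul, pair_tmul, ← h₁, ← h₂, ← h₃]
      ring
    · simp only [cyclicPair_add_left, cyclicPair_add_right, TensorProduct.tmul_add,
        TensorProduct.add_tmul, map_add] at h h' ⊢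
      linear_combination h + h'
  · simp only [cyclicPair_add_left, cyclicPair_add_right, TensorProduct.tmul_add,
      TensorProduct.add_tmul, map_add] at h h' ⊢
    linear_combination h + h'

theorem cyclicPair_eq_CYB {d₁ d₂ d₃ : L →ₗ[ℂ] ℂ} {Q₁ Q₂ Q₃ : L →ₗ[ℂ] L →ₗ[ℂ] ℂ}
    (h₁ : ∀ a b, Q₁ a b - Q₁ b a = d₁ ⁅a, b⁆) (h₂ : ∀ a b, Q₂ a b - Q₂ b a = d₂ ⁅a, b⁆)
    (h₃ : ∀ a b, Q₃ a b - Q₃ b a = d₃ ⁅a, b⁆) {s : L ⊗[ℂ] L} (hs : IsSkew s) :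
    cyclicPair d₁ d₂ d₃ d₁ d₂ d₃ Q₁ Q₂ Q₃ s s = pair3 d₁ d₂ d₃ (CYB s) := by
  have h := cyclicPair_polarized h₁ h₂ h₃ hs hs
  rw [map_add, ← CYB_eq_CYBpair] at h
  linear_combination h / 2

end Lie

/-- Two commuting actions contribute no mixed terms to the Jacobi identity. -/
theorem cyclicPair_mixed {d₁ d₂ d₃ e₁ e₂ e₃ : V →ₗ[ℂ] ℂ} {M₁ M₂ M₃ : V →ₗ[ℂ] V →ₗ[ℂ] ℂ}
    {s t : V ⊗[ℂ] V} (hs : IsSkew s) (ht : IsSkew t) :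
    cyclicPair d₁ d₂ d₃ e₁ e₂ e₃ M₁ M₂ M₃ s t
      + cyclicPair e₁ e₂ e₃ d₁ d₂ d₃ M₁.flip M₂.flip M₃.flip t s = 0 := by
  refine hs.induction (p := fun s => cyclicPair d₁ d₂ d₃ e₁ e₂ e₃ M₁ M₂ M₃ s t
      + cyclicPair e₁ e₂ e₃ d₁ d₂ d₃ M₁.flip M₂.flip M₃.flip t s = 0)
    (by simp) (fun a b => ?_) (fun s s' h h' => ?_)
  · refine ht.induction (p := fun t =>
      cyclicPair d₁ d₂ d₃ e₁ e₂ e₃ M₁ M₂ M₃ (a ⊗ₜ b - b ⊗ₜ a) t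
        + cyclicPair e₁ e₂ e₃ d₁ d₂ d₃ M₁.flip M₂.flip M₃.flip t (a ⊗ₜ b - b ⊗ₜ a) = 0)
      (by simp) (fun a' b' => ?_) (fun t t' h h' => ?_)
    -- With transposed second derivatives, every term of one cyclic sum occurs in the other with the
    -- opposite sign, so no bracket is left over.
    · simp only [cyclicPair, iterPair_wedge, LinearMap.flip_apply]
      ring
    · simp only [cyclicPair_add_left, cyclicPair_add_right] at h h' ⊢
      linear_combination h + h'
  · simp only [cyclicPair_add_left, cyclicPair_add_right] at h h' ⊢
    linear_combination h + h'

end MultilinearJacobi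

/-! ### The classical Yang–Baxter operator and invariant tensors -/

section CYBInvariance

variable {L : Type*} [LieRing L] [LieAlgebra ℂ L]

/-- The Jacobi identity makes the Lie bracket a map of modules, and `CYBpair` is assembled from it.
-/
theorem lie_CYBpair (x : L) (T : (L ⊗[ℂ] L) ⊗[ℂ] (L ⊗[ℂ] L)) :
    ⁅x, CYBpair T⁆ = CYBpair ⁅x, T⁆ := by
  induction T with
  | zero => simp
  | add S T hS hT => simp only [map_add, lie_add, hS, hT]
  | tmul s t =>
    induction s with
    | zero => simp
    | add s s' h h' =>
      simp only [TensorProduct.add_tmul, map_add, lie_add, h, h']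
    | tmul a b =>
      induction t with
      | zero => simp
      | add t t' h h' =>
        simp only [TensorProduct.tmul_add, map_add, lie_add, h, h']
      | tmul c d =>
        simp only [CYBpair_tmul, TensorProduct.LieModule.lie_tmul_right, lie_add, map_add,
          TensorProduct.tmul_add, TensorProduct.add_tmul, leibniz_lie x]
        abel

theorem lie_CYB_eq_zero {x : L} {r : L ⊗[ℂ] L} (h : ⁅x, r⁆ = 0) : ⁅x, CYB r⁆ = 0 := by
  rw [CYB_eq_CYBpair, lie_CYBpair, TensorProduct.LieModule.lie_tmul_right, h]
  simp

/-- `x ⊗ y ↦ x ⊗ b ⊗ y`. -/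
noncomputable def insertMiddle (b : L) : L ⊗[ℂ] L →ₗ[ℂ] L ⊗[ℂ] (L ⊗[ℂ] L) :=
  TensorProduct.map LinearMap.id (TensorProduct.mk ℂ L L b)

/-- `x ⊗ y ↦ x ⊗ y ⊗ b`. -/
noncomputable def insertRight (b : L) : L ⊗[ℂ] L →ₗ[ℂ] L ⊗[ℂ] (L ⊗[ℂ] L) :=
  TensorProduct.map LinearMap.id ((TensorProduct.mk ℂ L L).flip b)

/-- The tensor `t` enters the right side only through `⁅a, t⁆` and `⁅b, t⁆`; this is why an
invariant `t` has no cross terms with a bivector. -/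
theorem CYBpair_wedge_add (a b : L) (t : L ⊗[ℂ] L) :
    CYBpair ((a ⊗ₜ b - b ⊗ₜ a) ⊗ₜ t) + CYBpair (t ⊗ₜ (a ⊗ₜ b - b ⊗ₜ a))
      = a ⊗ₜ ⁅b, t⁆ - b ⊗ₜ ⁅a, t⁆ + (insertMiddle b ⁅a, t⁆ - insertMiddle a ⁅b, t⁆)
        + (insertRight a ⁅b, t⁆ - insertRight b ⁅a, t⁆) := by
  induction t with
  | zero => simp
  | add t t' h h' =>
    simp only [TensorProduct.tmul_add, TensorProduct.add_tmul, map_add, lie_add] at h h' ⊢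
    rw [add_add_add_comm, h, h']
    abel
  | tmul c d =>
    simp only [TensorProduct.tmul_sub, TensorProduct.sub_tmul, map_sub, CYBpair_tmul,
      TensorProduct.LieModule.lie_tmul_right, insertMiddle, insertRight, map_add,
      TensorProduct.map_tmul, TensorProduct.mk_apply, LinearMap.flip_apply, LinearMap.id_apply,
      TensorProduct.tmul_add]
    rw [← lie_skew c a, ← lie_skew c b, ← lie_skew d a, ← lie_skew d b]
    simp only [TensorProduct.tmul_neg, TensorProduct.neg_tmul]
    abel

theorem CYBpair_add_eq_zero {s t : L ⊗[ℂ] L} (hs : IsSkew s) (ht : ∀ x : L, ⁅x, t⁆ = 0) :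
    CYBpair (s ⊗ₜ t) + CYBpair (t ⊗ₜ s) = 0 := by
  refine hs.induction (p := fun s => CYBpair (s ⊗ₜ t) + CYBpair (t ⊗ₜ s) = 0) (by simp)
    (fun a b => ?_) (fun s s' h h' => ?_)
  · simp [CYBpair_wedge_add, ht]
  · simp only [TensorProduct.tmul_add, TensorProduct.add_tmul, map_add]
    rw [add_add_add_comm, h, h', add_zero]

/-- `CYB` is quadratic, and its cross terms vanish by the previous lemma. -/
theorem CYB_add_of_invariant {s t : L ⊗[ℂ] L} (hs : IsSkew s) (ht : ∀ x : L, ⁅x, t⁆ = 0) :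
    CYB (s + t) = CYB s + CYB t := by
  have h := CYBpair_add_eq_zero hs ht
  simp only [CYB_eq_CYBpair, TensorProduct.tmul_add, TensorProduct.add_tmul, map_add]
  rw [← add_zero (CYBpair (s ⊗ₜ s) + CYBpair (t ⊗ₜ t)), ← h]
  abel

end CYBInvariance

/-! ### Separation of tensors by functionals -/

section Separation

section

variable {N₁ N₂ : Type*} [AddCommGroup N₁] [Module ℂ N₁] [FiniteDimensional ℂ N₁]
  [AddCommGroup N₂] [Module ℂ N₂] [FiniteDimensional ℂ N₂]

theorem tensor_functional_eq_sum (ℓ : N₁ ⊗[ℂ] N₂ →ₗ[ℂ] ℂ) (x : N₁) (y : N₂) :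
    ℓ (x ⊗ₜ y) = ∑ i, ∑ j, ℓ (Module.finBasis ℂ N₁ i ⊗ₜ Module.finBasis ℂ N₂ j)
      * ((Module.finBasis ℂ N₁).coord i x * (Module.finBasis ℂ N₂).coord j y) := by
  conv_lhs => rw [← (Module.finBasis ℂ N₁).sum_repr x, ← (Module.finBasis ℂ N₂).sum_repr y]
  simp only [TensorProduct.sum_tmul, TensorProduct.tmul_sum, map_sum, ← TensorProduct.smul_tmul',
    TensorProduct.tmul_smul, map_smul, smul_eq_mul, Module.Basis.coord_apply]
  rw [Finset.sum_comm]
  refine Finset.sum_congr rfl fun j _ => ?_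
  rw [Finset.mul_sum]
  refine Finset.sum_congr rfl fun i _ => ?_
  ring

/-- In finite dimension the product functionals span the dual of the tensor product. -/
theorem eq_zero_of_forall_mul'_map {t : N₁ ⊗[ℂ] N₂}
    (h : ∀ (α : N₁ →ₗ[ℂ] ℂ) (β : N₂ →ₗ[ℂ] ℂ),
      LinearMap.mul' ℂ ℂ (TensorProduct.map α β t) = 0) : t = 0 := by
  rw [← Module.forall_dual_apply_eq_zero_iff ℂ]
  intro ℓ
  have : ℓ = ∑ i, ∑ j, ℓ (Module.finBasis ℂ N₁ i ⊗ₜ Module.finBasis ℂ N₂ j) •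
      (LinearMap.mul' ℂ ℂ ∘ₗ TensorProduct.map ((Module.finBasis ℂ N₁).coord i)
        ((Module.finBasis ℂ N₂).coord j)) := by
    refine TensorProduct.ext' fun x y => ?_
    rw [tensor_functional_eq_sum]
    simp only [LinearMap.sum_apply, LinearMap.smul_apply, smul_eq_mul, LinearMap.comp_apply,
      TensorProduct.map_tmul, LinearMap.mul'_apply]
  rw [this]
  simp [h]

end

variable {V : Type*} [AddCommGroup V] [Module ℂ V] [FiniteDimensional ℂ V]

theorem eq_of_forall_pair {s t : V ⊗[ℂ] V} (h : ∀ α β : V →ₗ[ℂ] ℂ, pair α β s = pair α β t) :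
    s = t :=
  sub_eq_zero.1 <| eq_zero_of_forall_mul'_map fun α β => by
    simpa [pair, sub_eq_zero] using h α β

theorem eq_zero_of_forall_pair3 {t : V ⊗[ℂ] (V ⊗[ℂ] V)}
    (h : ∀ α β γ : V →ₗ[ℂ] ℂ, pair3 α β γ t = 0) : t = 0 := by
  refine eq_zero_of_forall_mul'_map fun α ℓ => ?_
  -- Contracting the first factor with `α` leaves a tensor killed by all `β ⊗ γ`, hence zero; an
  -- arbitrary `α ⊗ ℓ` factors through this contraction.
  have key : TensorProduct.lid ℂ _ (TensorProduct.map α LinearMap.id t) = 0 := by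
    refine eq_of_forall_pair fun β γ => ?_
    rw [map_zero, ← h α β γ]
    clear h
    induction t with
    | zero => simp
    | tmul x y => simp
    | add x y hx hy => simp only [map_add, hx, hy]
  have : ∀ s, LinearMap.mul' ℂ ℂ (TensorProduct.map α ℓ s)
      = ℓ (TensorProduct.lid ℂ _ (TensorProduct.map α LinearMap.id s)) := fun s => by
    induction s with
    | zero => simp
    | tmul x y => simp
    | add x y hx hy => simp only [map_add, hx, hy]
  rw [this, key, map_zero]

end Separation

/-! ### Invariant differential operators on a Lie group -/

/-! ### Partial derivatives of analytic functions of two variables -/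

section PartialDerivatives

variable {E₁ E₂ W : Type*} [NormedAddCommGroup E₁] [NormedSpace ℂ E₁] [NormedAddCommGroup E₂]
  [NormedSpace ℂ E₂] [NormedAddCommGroup W] [NormedSpace ℂ W] {Ψ : E₁ × E₂ → W} {x₀ : E₁} {y₀ : E₂}

/-- Stated on a neighbourhood, not only at `x₀`, because the partial derivative is differentiated
again in `x`. -/
theorem eventually_fderiv_right_eq (h : ContDiffAt ℂ ω Ψ (x₀, y₀)) :
    ∀ᶠ x in 𝓝 x₀, ∀ b, fderiv ℂ (fun y => Ψ (x, y)) y₀ b = fderiv ℂ Ψ (x, y₀) (0, b) := by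
  have hc : ContinuousAt (fun x : E₁ => (x, y₀)) x₀ := by fun_prop
  filter_upwards [hc.eventually (h.eventually (by simp))] with x hx b
  have h1 : HasFDerivAt Ψ (fderiv ℂ Ψ (x, y₀)) (x, y₀) :=
    (hx.differentiableAt (by simp)).hasFDerivAt
  have h2 := HasFDerivAt.comp (f := fun y => (x, y)) y₀ h1 (hasFDerivAt_prodMk_right x y₀)
  have h3 : fderiv ℂ (fun y => Ψ (x, y)) y₀ = _ := h2.fderiv
  rw [h3]
  rfl

theorem eventually_fderiv_left_eq (h : ContDiffAt ℂ ω Ψ (x₀, y₀)) :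
    ∀ᶠ y in 𝓝 y₀, ∀ a, fderiv ℂ (fun x => Ψ (x, y)) x₀ a = fderiv ℂ Ψ (x₀, y) (a, 0) := by
  have hc : ContinuousAt (fun y : E₂ => (x₀, y)) y₀ := by fun_prop
  filter_upwards [hc.eventually (h.eventually (by simp))] with y hy a
  have h1 : HasFDerivAt Ψ (fderiv ℂ Ψ (x₀, y)) (x₀, y) :=
    (hy.differentiableAt (by simp)).hasFDerivAt
  have h2 := HasFDerivAt.comp (f := fun x => (x, y)) x₀ h1 (hasFDerivAt_prodMk_left x₀ y)
  have h3 : fderiv ℂ (fun x => Ψ (x, y)) x₀ = _ := h2.fderiv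
  rw [h3]
  rfl

theorem ContDiffAt.fderiv_right_apply (h : ContDiffAt ℂ ω Ψ (x₀, y₀)) (b : E₂) :
    ContDiffAt ℂ ω (fun x => fderiv ℂ (fun y => Ψ (x, y)) y₀ b) x₀ := by
  have h1 : ContDiffAt ℂ ω (fderiv ℂ Ψ) (x₀, y₀) := h.fderiv_right (by simp)
  have h2 : ContDiffAt ℂ ω (fun x : E₁ => fderiv ℂ Ψ (x, y₀)) x₀ :=
    ContDiffAt.comp x₀ h1 (contDiffAt_id.prodMk contDiffAt_const)
  refine (h2.clm_apply (contDiffAt_const (c := ((0, b) : E₁ × E₂)))).congr_of_eventuallyEq ?_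
  filter_upwards [eventually_fderiv_right_eq h] with x hx using hx b

/-- Symmetry of the second derivative of `Ψ`. It is the source of the commutation of left and right
invariant derivatives. -/
theorem fderiv_fderiv_comm (h : ContDiffAt ℂ ω Ψ (x₀, y₀)) (a : E₁) (b : E₂) :
    fderiv ℂ (fun x => fderiv ℂ (fun y => Ψ (x, y)) y₀ b) x₀ a
      = fderiv ℂ (fun y => fderiv ℂ (fun x => Ψ (x, y)) x₀ a) y₀ b := by
  have h1 : ContDiffAt ℂ ω (fderiv ℂ Ψ) (x₀, y₀) := h.fderiv_right (by simp)
  have h2 : HasFDerivAt (fderiv ℂ Ψ) (fderiv ℂ (fderiv ℂ Ψ) (x₀, y₀)) (x₀, y₀) :=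
    (h1.differentiableAt (by simp)).hasFDerivAt
  have e1 : fderiv ℂ (fun x => fderiv ℂ (fun y => Ψ (x, y)) y₀ b) x₀
      = fderiv ℂ (fun x => fderiv ℂ Ψ (x, y₀) (0, b)) x₀ := by
    refine Filter.EventuallyEq.fderiv_eq ?_
    filter_upwards [eventually_fderiv_right_eq h] with x hx using hx b
  have e2 : fderiv ℂ (fun y => fderiv ℂ (fun x => Ψ (x, y)) x₀ a) y₀
      = fderiv ℂ (fun y => fderiv ℂ Ψ (x₀, y) (a, 0)) y₀ := by
    refine Filter.EventuallyEq.fderiv_eq ?_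
    filter_upwards [eventually_fderiv_left_eq h] with x hx using hx a
  have k1 := (HasFDerivAt.comp (f := fun x => (x, y₀)) x₀ h2
    (hasFDerivAt_prodMk_left x₀ y₀)).clm_apply
    (hasFDerivAt_const ((0, b) : E₁ × E₂) x₀)
  have k2 := (HasFDerivAt.comp (f := fun y => (x₀, y)) y₀ h2
    (hasFDerivAt_prodMk_right x₀ y₀)).clm_apply
    (hasFDerivAt_const ((a, 0) : E₁ × E₂) y₀)
  have k1' : fderiv ℂ (fun x => fderiv ℂ Ψ (x, y₀) (0, b)) x₀ = _ := k1.fderiv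
  have k2' : fderiv ℂ (fun y => fderiv ℂ Ψ (x₀, y) (a, 0)) y₀ = _ := k2.fderiv
  rw [e1, e2, k1', k2']
  have hs := h.isSymmSndFDerivAt (by simp)
  simpa using hs (a, 0) (0, b)

end PartialDerivatives

/-! ### Left and right invariant derivatives -/

section InvariantOperators

variable {E : Type*} [NormedAddCommGroup E] [NormedSpace ℂ E]
  {G : Type*} [TopologicalSpace G] [ChartedSpace E G] [Group G]

variable (E G) in
/-- The coordinates of the identity in the preferred chart. -/
noncomputable def idCoord : E := extChartAt 𝓘(ℂ, E) (1 : G) 1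

variable (E G) in
/-- The parametrization of a neighbourhood of the identity by the preferred chart. -/
noncomputable def idParam : E → G := (extChartAt 𝓘(ℂ, E) (1 : G)).symm

/-- The model space as the underlying space of the Lie algebra. -/
noncomputable def lieCoord : GroupLieAlgebra 𝓘(ℂ, E) G ≃ₗ[ℂ] E := LinearEquiv.refl ℂ E

/-- The left invariant derivatives `a ↦ (D_a F)(g)` of a function. -/
noncomputable def lder (F : G → ℂ) (g : G) : GroupLieAlgebra 𝓘(ℂ, E) G →ₗ[ℂ] ℂ :=
  (fderiv ℂ (fun y : E => F (g * idParam E G y)) (idCoord E G)).toLinearMap ∘ₗ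
    lieCoord.toLinearMap

/-- The right invariant derivatives `a ↦ (R_a F)(g)` of a function. -/
noncomputable def rder (F : G → ℂ) (g : G) : GroupLieAlgebra 𝓘(ℂ, E) G →ₗ[ℂ] ℂ :=
  (fderiv ℂ (fun y : E => F (idParam E G y * g)) (idCoord E G)).toLinearMap ∘ₗ
    lieCoord.toLinearMap

theorem lder_apply (F : G → ℂ) (g : G) (a : GroupLieAlgebra 𝓘(ℂ, E) G) :
    lder F g a = fderiv ℂ (fun y : E => F (g * idParam E G y)) (idCoord E G) (lieCoord a) := rfl

theorem rder_apply (F : G → ℂ) (g : G) (a : GroupLieAlgebra 𝓘(ℂ, E) G) :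
    rder F g a = fderiv ℂ (fun y : E => F (idParam E G y * g)) (idCoord E G) (lieCoord a) := rfl

@[simp] theorem idParam_idCoord : idParam E G (idCoord E G) = 1 :=
  extChartAt_to_inv (I := 𝓘(ℂ, E)) (1 : G)

theorem idCoord_mem_target : idCoord E G ∈ (extChartAt 𝓘(ℂ, E) (1 : G)).target :=
  mem_extChartAt_target (I := 𝓘(ℂ, E)) (1 : G)

theorem eventually_mem_target :
    ∀ᶠ y in 𝓝 (idCoord E G), y ∈ (extChartAt 𝓘(ℂ, E) (1 : G)).target :=
  (isOpen_extChartAt_target (I := 𝓘(ℂ, E)) (1 : G)).mem_nhds idCoord_mem_target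

variable [LieGroup 𝓘(ℂ, E) ω G]

theorem contMDiffAt_idParam : ContMDiffAt 𝓘(ℂ, E) 𝓘(ℂ, E) ω (idParam E G) (idCoord E G) :=
  (contMDiffOn_extChartAt_symm (I := 𝓘(ℂ, E)) (1 : G)).contMDiffAt eventually_mem_target

theorem contMDiffAt_mul_idParam (g : G) :
    ContMDiffAt 𝓘(ℂ, E) 𝓘(ℂ, E) ω (fun x => g * idParam E G x) (idCoord E G) :=
  contMDiffAt_const.mul contMDiffAt_idParam

variable {H : Type*} [NormedAddCommGroup H] [NormedSpace ℂ H]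
  {M : Type*} [TopologicalSpace M] [ChartedSpace H M]

/-- Left translates of the one chart at the identity parametrize neighbourhoods of all points, so
analyticity anywhere on the group can be tested at `idCoord`. -/
theorem contMDiffAt_iff_comp_mul_idParam {F : G → M} {g : G} :
    ContMDiffAt 𝓘(ℂ, E) 𝓘(ℂ, H) ω F g ↔
      ContMDiffAt 𝓘(ℂ, E) 𝓘(ℂ, H) ω (fun x => F (g * idParam E G x)) (idCoord E G) := by
  constructor
  · intro h
    have h' : ContMDiffAt 𝓘(ℂ, E) 𝓘(ℂ, H) ω F (g * idParam E G (idCoord E G)) := by simpa using h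
    exact ContMDiffAt.comp (f := fun x => g * idParam E G x) _ h' (contMDiffAt_mul_idParam g)
  · intro h
    -- The local inverse of `x ↦ g * idParam E G x` is `k ↦ g⁻¹ * k` read in the chart at the
    -- identity.
    have e1 : ContMDiffAt 𝓘(ℂ, E) 𝓘(ℂ, E) ω
        (fun k : G => extChartAt 𝓘(ℂ, E) (1 : G) (g⁻¹ * k)) g := by
      have : ContMDiffAt 𝓘(ℂ, E) 𝓘(ℂ, E) ω (extChartAt 𝓘(ℂ, E) (1 : G)) (g⁻¹ * g) := by
        rw [inv_mul_cancel]
        exact contMDiffAt_extChartAt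
      exact this.comp g (contMDiffAt_const.mul contMDiffAt_id)
    have e2 : extChartAt 𝓘(ℂ, E) (1 : G) (g⁻¹ * g) = idCoord E G := by simp [idCoord]
    rw [← e2] at h
    refine (h.comp g e1).congr_of_eventuallyEq ?_
    have : ∀ᶠ k in 𝓝 g, g⁻¹ * k ∈ (extChartAt 𝓘(ℂ, E) (1 : G)).source := by
      have hc : ContinuousAt (fun k => g⁻¹ * k) g :=
        (contMDiffAt_const.mul contMDiffAt_id :
          ContMDiffAt 𝓘(ℂ, E) 𝓘(ℂ, E) ω (fun k => g⁻¹ * k) g).continuousAt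
      refine hc.eventually ((isOpen_extChartAt_source (I := 𝓘(ℂ, E)) (1 : G)).mem_nhds ?_)
      simp
    filter_upwards [this] with k hk
    simp only [idParam, Function.comp_apply]
    rw [(extChartAt 𝓘(ℂ, E) (1 : G)).left_inv hk, mul_inv_cancel_left]

theorem contDiffAt_comp_mul_idParam {F : G → H} {g : G}
    (h : ContMDiffAt 𝓘(ℂ, E) 𝓘(ℂ, H) ω F g) :
    ContDiffAt ℂ ω (fun x => F (g * idParam E G x)) (idCoord E G) :=
  (contMDiffAt_iff_comp_mul_idParam.1 h).contDiffAt

theorem contDiffAt_comp_idParam_mul {F : G → H} {g : G}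
    (h : ContMDiffAt 𝓘(ℂ, E) 𝓘(ℂ, H) ω F g) :
    ContDiffAt ℂ ω (fun x => F (idParam E G x * g)) (idCoord E G) := by
  have h' : ContMDiffAt 𝓘(ℂ, E) 𝓘(ℂ, H) ω F (idParam E G (idCoord E G) * g) := by simpa using h
  have h2 : ContMDiffAt 𝓘(ℂ, E) 𝓘(ℂ, E) ω (fun x => idParam E G x * g) (idCoord E G) :=
    contMDiffAt_idParam.mul contMDiffAt_const
  exact (ContMDiffAt.comp (f := fun x => idParam E G x * g) _ h' h2).contDiffAt

theorem contMDiffAt_idParam_fst :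
    ContMDiffAt 𝓘(ℂ, E × E) 𝓘(ℂ, E) ω (fun q : E × E => idParam E G q.1)
      (idCoord E G, idCoord E G) :=
  ContMDiffAt.comp (I' := 𝓘(ℂ, E)) (idCoord E G, idCoord E G) contMDiffAt_idParam
    contDiffAt_fst.contMDiffAt

theorem contMDiffAt_idParam_snd :
    ContMDiffAt 𝓘(ℂ, E × E) 𝓘(ℂ, E) ω (fun q : E × E => idParam E G q.2)
      (idCoord E G, idCoord E G) :=
  ContMDiffAt.comp (I' := 𝓘(ℂ, E)) (idCoord E G, idCoord E G) contMDiffAt_idParam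
    contDiffAt_snd.contMDiffAt

omit [LieGroup 𝓘(ℂ, E) ω G] in
theorem contDiffAt_comp_of_eq {F : G → H} {g : G} {k : E × E → G}
    (h : ContMDiffAt 𝓘(ℂ, E) 𝓘(ℂ, H) ω F g)
    (hk : ContMDiffAt 𝓘(ℂ, E × E) 𝓘(ℂ, E) ω k (idCoord E G, idCoord E G))
    (e : k (idCoord E G, idCoord E G) = g) :
    ContDiffAt ℂ ω (fun q => F (k q)) (idCoord E G, idCoord E G) := by
  subst e
  exact (h.comp _ hk).contDiffAt

theorem contDiffAt_mul_idParam_mul_idParam {F : G → H} {g : G}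
    (h : ContMDiffAt 𝓘(ℂ, E) 𝓘(ℂ, H) ω F g) :
    ContDiffAt ℂ ω (fun q : E × E => F (g * idParam E G q.1 * idParam E G q.2))
      (idCoord E G, idCoord E G) :=
  contDiffAt_comp_of_eq h ((contMDiffAt_const.mul contMDiffAt_idParam_fst).mul
    contMDiffAt_idParam_snd) (by simp)

theorem contDiffAt_idParam_mul_mul_idParam {F : G → H} {g : G}
    (h : ContMDiffAt 𝓘(ℂ, E) 𝓘(ℂ, H) ω F g) :
    ContDiffAt ℂ ω (fun q : E × E => F (idParam E G q.2 * (g * idParam E G q.1)))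
      (idCoord E G, idCoord E G) :=
  contDiffAt_comp_of_eq h (contMDiffAt_idParam_snd.mul
    (contMDiffAt_const.mul contMDiffAt_idParam_fst)) (by simp)

variable {F K : G → ℂ} {g : G}

/-- In translated coordinates this is a partial derivative of the analytic function (x, y) ↦ F(gxy).
-/
theorem contMDiffAt_lder (h : ContMDiffAt 𝓘(ℂ, E) 𝓘(ℂ, ℂ) ω F g) (a : GroupLieAlgebra 𝓘(ℂ, E) G) :
    ContMDiffAt 𝓘(ℂ, E) 𝓘(ℂ, ℂ) ω (fun k => lder F k a) g := by
  rw [contMDiffAt_iff_comp_mul_idParam]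
  exact ((contDiffAt_mul_idParam_mul_idParam h).fderiv_right_apply (lieCoord a)).contMDiffAt

theorem contMDiffAt_rder (h : ContMDiffAt 𝓘(ℂ, E) 𝓘(ℂ, ℂ) ω F g) (a : GroupLieAlgebra 𝓘(ℂ, E) G) :
    ContMDiffAt 𝓘(ℂ, E) 𝓘(ℂ, ℂ) ω (fun k => rder F k a) g := by
  rw [contMDiffAt_iff_comp_mul_idParam]
  exact ((contDiffAt_idParam_mul_mul_idParam h).fderiv_right_apply (lieCoord a)).contMDiffAt

/-- Left and right translations commute: both sides are mixed partial derivatives of (x, y) ↦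
F(ygx). -/
theorem lder_rder_comm (h : ContMDiffAt 𝓘(ℂ, E) 𝓘(ℂ, ℂ) ω F g) (a b : GroupLieAlgebra 𝓘(ℂ, E) G) :
    lder (fun k => rder F k b) g a = rder (fun k => lder F k a) g b := by
  have := fderiv_fderiv_comm (contDiffAt_idParam_mul_mul_idParam h)
    (lieCoord a) (lieCoord b)
  simpa only [lder_apply, rder_apply, mul_assoc] using this

theorem lder_congr (h : F =ᶠ[𝓝 g] K) : lder (E := E) F g = lder K g := by
  have hc : ContinuousAt (fun x => g * idParam E G x) (idCoord E G) :=
    (contMDiffAt_mul_idParam g).continuousAt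
  have h' : F =ᶠ[𝓝 (g * idParam E G (idCoord E G))] K := by simpa using h
  ext a
  exact congrArg (fun T : E →L[ℂ] ℂ => T (lieCoord a)) (Filter.EventuallyEq.fderiv_eq (hc.eventually h'))

theorem rder_congr (h : F =ᶠ[𝓝 g] K) : rder (E := E) F g = rder K g := by
  have hc : ContinuousAt (fun x => idParam E G x * g) (idCoord E G) :=
    (contMDiffAt_idParam.mul contMDiffAt_const :
      ContMDiffAt 𝓘(ℂ, E) 𝓘(ℂ, E) ω (fun x => idParam E G x * g) (idCoord E G)).continuousAt
  have h' : F =ᶠ[𝓝 (idParam E G (idCoord E G) * g)] K := by simpa using h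
  ext a
  exact congrArg (fun T : E →L[ℂ] ℂ => T (lieCoord a)) (Filter.EventuallyEq.fderiv_eq (hc.eventually h'))

theorem lder_mul (hF : ContMDiffAt 𝓘(ℂ, E) 𝓘(ℂ, ℂ) ω F g)
    (hK : ContMDiffAt 𝓘(ℂ, E) 𝓘(ℂ, ℂ) ω K g) (a : GroupLieAlgebra 𝓘(ℂ, E) G) :
    lder (fun k => F k * K k) g a = lder F g a * K g + F g * lder K g a := by
  simp only [lder_apply]
  rw [fderiv_fun_mul ((contDiffAt_comp_mul_idParam hF).differentiableAt (by simp))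
    ((contDiffAt_comp_mul_idParam hK).differentiableAt (by simp))]
  simp
  ring

theorem rder_mul (hF : ContMDiffAt 𝓘(ℂ, E) 𝓘(ℂ, ℂ) ω F g)
    (hK : ContMDiffAt 𝓘(ℂ, E) 𝓘(ℂ, ℂ) ω K g) (a : GroupLieAlgebra 𝓘(ℂ, E) G) :
    rder (fun k => F k * K k) g a = rder F g a * K g + F g * rder K g a := by
  simp only [rder_apply]
  rw [fderiv_fun_mul ((contDiffAt_comp_idParam_mul hF).differentiableAt (by simp))
    ((contDiffAt_comp_idParam_mul hK).differentiableAt (by simp))]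
  simp
  ring

theorem lder_add (hF : ContMDiffAt 𝓘(ℂ, E) 𝓘(ℂ, ℂ) ω F g)
    (hK : ContMDiffAt 𝓘(ℂ, E) 𝓘(ℂ, ℂ) ω K g) :
    lder (E := E) (fun k => F k + K k) g = lder F g + lder K g := by
  ext a
  simp only [LinearMap.add_apply, lder_apply]
  rw [fderiv_fun_add ((contDiffAt_comp_mul_idParam hF).differentiableAt (by simp))
    ((contDiffAt_comp_mul_idParam hK).differentiableAt (by simp))]
  rfl

theorem rder_add (hF : ContMDiffAt 𝓘(ℂ, E) 𝓘(ℂ, ℂ) ω F g)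
    (hK : ContMDiffAt 𝓘(ℂ, E) 𝓘(ℂ, ℂ) ω K g) :
    rder (E := E) (fun k => F k + K k) g = rder F g + rder K g := by
  ext a
  simp only [LinearMap.add_apply, rder_apply]
  rw [fderiv_fun_add ((contDiffAt_comp_idParam_mul hF).differentiableAt (by simp))
    ((contDiffAt_comp_idParam_mul hK).differentiableAt (by simp))]
  rfl

theorem lder_const_mul (hF : ContMDiffAt 𝓘(ℂ, E) 𝓘(ℂ, ℂ) ω F g) (c : ℂ) :
    lder (E := E) (fun k => c * F k) g = c • lder F g := by
  ext a
  simp only [LinearMap.smul_apply, lder_apply]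
  rw [fderiv_const_mul ((contDiffAt_comp_mul_idParam hF).differentiableAt (by simp))]
  rfl

theorem rder_const_mul (hF : ContMDiffAt 𝓘(ℂ, E) 𝓘(ℂ, ℂ) ω F g) (c : ℂ) :
    rder (E := E) (fun k => c * F k) g = c • rder F g := by
  ext a
  simp only [LinearMap.smul_apply, rder_apply]
  rw [fderiv_const_mul ((contDiffAt_comp_idParam_mul hF).differentiableAt (by simp))]
  rfl

end InvariantOperators

/-! ### Commutators of invariant derivatives -/

section LieBracketOfOperators

variable {E : Type*} [NormedAddCommGroup E] [NormedSpace ℂ E]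
  {G : Type*} [TopologicalSpace G] [ChartedSpace E G] [Group G] [LieGroup 𝓘(ℂ, E) ω G]
  {F : G → ℂ} {g : G}

theorem rder_eq_neg_lder_inv (hF : ContMDiffAt 𝓘(ℂ, E) 𝓘(ℂ, ℂ) ω F g) (a : GroupLieAlgebra 𝓘(ℂ, E) G) :
    rder F g a = -lder (fun k => F k⁻¹) g⁻¹ a := by
  -- The function (x, y) ↦ F(x y⁻¹ g) is constant on the diagonal, so its two partial derivatives at
  -- the identity add up to zero; these are the right derivative of `F` and the left derivative of
  -- its composite with inversion.
  have hk : ContDiffAt ℂ ω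
      (fun q : E × E => F (idParam E G q.1 * ((idParam E G q.2)⁻¹ * g)))
      (idCoord E G, idCoord E G) :=
    contDiffAt_comp_of_eq hF (contMDiffAt_idParam_fst.mul
      (contMDiffAt_idParam_snd.inv.mul contMDiffAt_const)) (by simp)
  have h1 := (eventually_fderiv_right_eq hk).self_of_nhds (lieCoord a)
  have h2 := (eventually_fderiv_left_eq hk).self_of_nhds (lieCoord a)
  have h3 := HasFDerivAt.comp (f := fun x : E => (x, x)) (idCoord E G)
    (hk.differentiableAt (by simp)).hasFDerivAt
    ((hasFDerivAt_id (idCoord E G)).prodMk (hasFDerivAt_id (idCoord E G)))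
  have h4 : HasFDerivAt ((fun q : E × E => F (idParam E G q.1 * ((idParam E G q.2)⁻¹ * g))) ∘
      fun x : E => (x, x)) (0 : E →L[ℂ] ℂ) (idCoord E G) := by
    have : ((fun q : E × E => F (idParam E G q.1 * ((idParam E G q.2)⁻¹ * g))) ∘
      fun x : E => (x, x)) = fun _ => F g := by
      ext x; simp
    rw [this]
    exact hasFDerivAt_const _ _
  have h5 := congrArg (fun T : E →L[ℂ] ℂ => T (lieCoord a)) (h3.unique h4)
  have h6 : (lieCoord a, lieCoord a) = (lieCoord a, 0) + (0, lieCoord a) := by simp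
  simp only [ContinuousLinearMap.comp_apply, ContinuousLinearMap.prod_apply,
    ContinuousLinearMap.id_apply, h6, map_add, ← h1, ← h2] at h5
  simp only [idParam_idCoord, inv_one, one_mul, zero_apply] at h5
  rw [rder_apply, lder_apply]
  simp only [mul_inv_rev, inv_inv]
  exact eq_neg_of_add_eq_zero_left h5

/-- The left invariant vector field with value `b` at the identity, in the preferred chart at the
identity. -/
noncomputable def leftField (G : Type*) [TopologicalSpace G] [ChartedSpace E G] [Group G]
    (b : E) (x : E) : E :=
  fderiv ℂ (fun y => extChartAt 𝓘(ℂ, E) (1 : G) (idParam E G x * idParam E G y)) (idCoord E G) b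

theorem contDiffAt_chart_mul : ContDiffAt ℂ ω
    (fun q : E × E => extChartAt 𝓘(ℂ, E) (1 : G) (idParam E G q.1 * idParam E G q.2))
    (idCoord E G, idCoord E G) :=
  contDiffAt_comp_of_eq contMDiffAt_extChartAt
    (contMDiffAt_idParam_fst.mul contMDiffAt_idParam_snd) (by simp)

theorem contDiffAt_leftField (b : E) : ContDiffAt ℂ ω (leftField G b) (idCoord E G) :=
  contDiffAt_chart_mul.fderiv_right_apply b

omit [LieGroup 𝓘(ℂ, E) ω G] in
theorem fderiv_chart_idParam :
    fderiv ℂ (fun y => extChartAt 𝓘(ℂ, E) (1 : G) (idParam E G y)) (idCoord E G)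
      = ContinuousLinearMap.id ℂ E := by
  have : (fun y => extChartAt 𝓘(ℂ, E) (1 : G) (idParam E G y)) =ᶠ[𝓝 (idCoord E G)] id := by
    filter_upwards [eventually_mem_target (E := E) (G := G)] with y hy
    exact (extChartAt 𝓘(ℂ, E) (1 : G)).right_inv hy
  rw [this.fderiv_eq, fderiv_id]

omit [LieGroup 𝓘(ℂ, E) ω G] in
theorem leftField_idCoord (b : E) : leftField G b (idCoord E G) = b := by
  unfold leftField
  simp only [idParam_idCoord, one_mul]
  rw [fderiv_chart_idParam]
  rfl

theorem eventually_idParam_mul_mem_source :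
    ∀ᶠ x in 𝓝 (idCoord E G), ∀ᶠ y in 𝓝 (idCoord E G),
      idParam E G x * idParam E G y ∈ (extChartAt 𝓘(ℂ, E) (1 : G)).source := by
  have hc : ContinuousAt (fun q : E × E => idParam E G q.1 * idParam E G q.2)
      (idCoord E G, idCoord E G) :=
    (contMDiffAt_idParam_fst.mul contMDiffAt_idParam_snd).continuousAt
  have h := hc.eventually ((isOpen_extChartAt_source (I := 𝓘(ℂ, E)) (1 : G)).mem_nhds (by simp))
  rw [nhds_prod_eq] at h
  exact h.curry

/-- In the chart, a left invariant derivative is differentiation along `leftField`. Having this on a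
neighbourhood permits a second differentiation. -/
theorem eventually_lder_eq_leftField (hF : ContMDiffAt 𝓘(ℂ, E) 𝓘(ℂ, ℂ) ω F g) :
    ∀ᶠ x in 𝓝 (idCoord E G), ∀ b : GroupLieAlgebra 𝓘(ℂ, E) G, lder F (g * idParam E G x) b
      = fderiv ℂ (fun y => F (g * idParam E G y)) x (leftField G (lieCoord b) x) := by
  have hF' : ContDiffAt ℂ ω (fun y => F (g * idParam E G y)) (idCoord E G) :=
    contDiffAt_comp_mul_idParam hF
  have hc : ContinuousAt (fun x : E => (x, idCoord E G)) (idCoord E G) := by fun_prop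
  filter_upwards [eventually_idParam_mul_mem_source (E := E) (G := G), eventually_mem_target,
    hF'.eventually (by simp),
    hc.eventually ((contDiffAt_chart_mul (E := E) (G := G)).eventually (by simp))]
    with x hx hxt hFx hmx b
  have e : (fun y => F (g * idParam E G x * idParam E G y)) =ᶠ[𝓝 (idCoord E G)]
      (fun z => F (g * idParam E G z)) ∘
        (fun y => extChartAt 𝓘(ℂ, E) (1 : G) (idParam E G x * idParam E G y)) := by
    filter_upwards [hx] with y hy
    simp only [Function.comp_apply]
    have h := (extChartAt 𝓘(ℂ, E) (1 : G)).left_inv hy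
    rw [← idParam] at h
    rw [h, mul_assoc]
  have e2 : extChartAt 𝓘(ℂ, E) (1 : G) (idParam E G x * idParam E G (idCoord E G)) = x := by
    rw [idParam_idCoord, mul_one]
    exact (extChartAt 𝓘(ℂ, E) (1 : G)).right_inv hxt
  rw [lder_apply, e.fderiv_eq, fderiv_comp, e2]
  · rfl
  · rw [e2]
    exact hFx.differentiableAt (by simp)
  · exact DifferentiableAt.comp (f := fun y => (x, y)) (idCoord E G)
      (hmx.differentiableAt (by simp)) (by fun_prop)

omit [LieGroup 𝓘(ℂ, E) ω G] in
theorem mfderiv_one_eq_fderiv {H : Type*} [NormedAddCommGroup H] [NormedSpace ℂ H] {f : G → H}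
    (h : MDifferentiableAt 𝓘(ℂ, E) 𝓘(ℂ, H) f 1) (a : GroupLieAlgebra 𝓘(ℂ, E) G) :
    (mfderiv 𝓘(ℂ, E) 𝓘(ℂ, H) f 1 a : H)
      = fderiv ℂ (fun y => f (idParam E G y)) (idCoord E G) (lieCoord a) := by
  have : (mfderiv 𝓘(ℂ, E) 𝓘(ℂ, H) f 1 : E →L[ℂ] H)
      = fderiv ℂ (fun y => f (idParam E G y)) (idCoord E G) := by
    have key : fderivWithin ℂ (fun y => f (idParam E G y)) (Set.range 𝓘(ℂ, E)) (idCoord E G)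
        = fderiv ℂ (fun y => f (idParam E G y)) (idCoord E G) := by
      simp only [modelWithCornersSelf_coe, Set.range_id, fderivWithin_univ]
    exact h.mfderiv.trans key
  exact congrArg (fun T : E →L[ℂ] H => T a) this

theorem mfderiv_mul_left_eq {H : Type*} [NormedAddCommGroup H] [NormedSpace ℂ H] {f : G → H}
    (h : MDifferentiableAt 𝓘(ℂ, E) 𝓘(ℂ, H) f g) (a : GroupLieAlgebra 𝓘(ℂ, E) G) :
    (mfderiv 𝓘(ℂ, E) 𝓘(ℂ, H) f g (mfderiv 𝓘(ℂ, E) 𝓘(ℂ, E) (fun k => g * k) 1 a) : H)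
      = fderiv ℂ (fun y => f (g * idParam E G y)) (idCoord E G) (lieCoord a) := by
  have hg : MDifferentiableAt 𝓘(ℂ, E) 𝓘(ℂ, E) (fun k : G => g * k) 1 :=
    (contMDiff_mul_left (I := 𝓘(ℂ, E)) (n := ω)).contMDiffAt.mdifferentiableAt (by simp)
  have h' : MDifferentiableAt 𝓘(ℂ, E) 𝓘(ℂ, H) f (g * 1) := by rwa [mul_one]
  rw [← mfderiv_one_eq_fderiv (f := fun k => f (g * k)) (h'.comp 1 hg)]
  -- The chain rule is applied at the point `g * 1`; this moves the outer derivative to `g`.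
  have e := congrArg (fun z => (mfderiv 𝓘(ℂ, E) 𝓘(ℂ, H) f z : E →L[ℂ] H)
    (mfderiv 𝓘(ℂ, E) 𝓘(ℂ, E) (fun k => g * k) 1 a)) (mul_one g)
  exact e.symm.trans (mfderiv_comp_apply (I' := 𝓘(ℂ, E)) 1 h' hg a).symm

theorem mfderiv_mul_right_eq {H : Type*} [NormedAddCommGroup H] [NormedSpace ℂ H] {f : G → H}
    (h : MDifferentiableAt 𝓘(ℂ, E) 𝓘(ℂ, H) f g) (a : GroupLieAlgebra 𝓘(ℂ, E) G) :
    (mfderiv 𝓘(ℂ, E) 𝓘(ℂ, H) f g (mfderiv 𝓘(ℂ, E) 𝓘(ℂ, E) (fun k => k * g) 1 a) : H)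
      = fderiv ℂ (fun y => f (idParam E G y * g)) (idCoord E G) (lieCoord a) := by
  have hg : MDifferentiableAt 𝓘(ℂ, E) 𝓘(ℂ, E) (fun k : G => k * g) 1 :=
    (contMDiff_mul_right (I := 𝓘(ℂ, E)) (n := ω)).contMDiffAt.mdifferentiableAt (by simp)
  have h' : MDifferentiableAt 𝓘(ℂ, E) 𝓘(ℂ, H) f (1 * g) := by rwa [one_mul]
  rw [← mfderiv_one_eq_fderiv (f := fun k => f (k * g)) (h'.comp 1 hg)]
  have e := congrArg (fun z => (mfderiv 𝓘(ℂ, E) 𝓘(ℂ, H) f z : E →L[ℂ] H)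
    (mfderiv 𝓘(ℂ, E) 𝓘(ℂ, E) (fun k => k * g) 1 a)) (one_mul g)
  exact e.symm.trans (mfderiv_comp_apply (I' := 𝓘(ℂ, E)) 1 h' hg a).symm

theorem differentialAt_leftTranslation (h : MDifferentiableAt 𝓘(ℂ, E) 𝓘(ℂ, ℂ) F g) :
    differentialAt E F g ∘ₗ leftTranslation g = lder F g :=
  LinearMap.ext fun a => mfderiv_mul_left_eq h a

theorem differentialAt_rightTranslation (h : MDifferentiableAt 𝓘(ℂ, E) 𝓘(ℂ, ℂ) F g) :
    differentialAt E F g ∘ₗ rightTranslation g = rder F g :=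
  LinearMap.ext fun a => mfderiv_mul_right_eq h a

/-- The bracket of the group Lie algebra is defined by pulling invariant fields back to the chart.
This identifies the pulled back field with the one used for `lder`. -/
theorem eventually_mpullbackWithin_eq_leftField (b : GroupLieAlgebra 𝓘(ℂ, E) G) :
    ∀ᶠ x in 𝓝 (idCoord E G), (VectorField.mpullbackWithin 𝓘(ℂ, E) 𝓘(ℂ, E)
      (extChartAt 𝓘(ℂ, E) (1 : G)).symm
      (mulInvariantVectorField (I := 𝓘(ℂ, E)) (G := G) b) (Set.range 𝓘(ℂ, E)) x : E)
      = leftField G (lieCoord b) x := by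
  filter_upwards [eventually_mem_target (E := E) (G := G)] with x hx
  have hinv : (mfderivWithin 𝓘(ℂ, E) 𝓘(ℂ, E) (extChartAt 𝓘(ℂ, E) (1 : G)).symm
      (Set.range 𝓘(ℂ, E)) x).inverse = mfderiv 𝓘(ℂ, E) 𝓘(ℂ, E) (extChartAt 𝓘(ℂ, E) (1 : G))
        ((extChartAt 𝓘(ℂ, E) (1 : G)).symm x) :=
    ContinuousLinearMap.inverse_eq
      (mfderivWithin_extChartAt_symm_comp_mfderiv_extChartAt hx)
      (mfderiv_extChartAt_comp_mfderivWithin_extChartAt_symm hx)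
  rw [VectorField.mpullbackWithin_apply, hinv]
  refine mfderiv_mul_left_eq (mdifferentiableAt_extChartAt ?_) b
  have := (extChartAt 𝓘(ℂ, E) (1 : G)).map_target hx
  rwa [extChartAt_source] at this

omit [LieGroup 𝓘(ℂ, E) ω G] in
theorem mfderiv_extChartAt_one [IsManifold 𝓘(ℂ, E) 1 G] (a : GroupLieAlgebra 𝓘(ℂ, E) G) :
    (mfderiv 𝓘(ℂ, E) 𝓘(ℂ, E) (extChartAt 𝓘(ℂ, E) (1 : G)) 1 a : E) = lieCoord a := by
  rw [mfderiv_one_eq_fderiv (mdifferentiableAt_extChartAt (mem_chart_source E (1 : G))),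
    fderiv_chart_idParam]
  rfl

theorem lie_eq_lieBracket_leftField (a b : GroupLieAlgebra 𝓘(ℂ, E) G) :
    lieCoord ⁅a, b⁆ = VectorField.lieBracket ℂ (leftField G (lieCoord a))
      (leftField G (lieCoord b)) (idCoord E G) := by
  rw [GroupLieAlgebra.bracket_def, VectorField.mlieBracket, VectorField.mlieBracketWithin_apply]
  -- The preferred chart has identity derivative at `1`, so carrying the coordinate bracket back to
  -- the Lie algebra changes nothing.
  have hid : (mfderiv 𝓘(ℂ, E) 𝓘(ℂ, E) (extChartAt 𝓘(ℂ, E) (1 : G)) 1 : E →L[ℂ] E)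
      = ContinuousLinearMap.id ℂ E := by
    ext a
    exact mfderiv_extChartAt_one (G := G) a
  have hinv : ∀ A : E →L[ℂ] E, A = ContinuousLinearMap.id ℂ E → ∀ v, A.inverse v = v := by
    rintro _ rfl v
    rw [ContinuousLinearMap.inverse_id]
    rfl
  refine (hinv _ hid _).trans ?_
  have hs : (extChartAt 𝓘(ℂ, E) (1 : G)).symm ⁻¹' Set.univ ∩ Set.range 𝓘(ℂ, E) = Set.univ := by
    simp
  have huniv : ∀ V W : E → E, VectorField.lieBracketWithin ℂ V W
      ((extChartAt 𝓘(ℂ, E) (1 : G)).symm ⁻¹' Set.univ ∩ Set.range 𝓘(ℂ, E)) (idCoord E G)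
      = VectorField.lieBracket ℂ V W (idCoord E G) := fun V W => by
    rw [hs, VectorField.lieBracketWithin_univ]
  refine (huniv _ _).trans ?_
  exact Filter.EventuallyEq.lieBracket_vectorField_eq
    (eventually_mpullbackWithin_eq_leftField a) (eventually_mpullbackWithin_eq_leftField b)

/-- The commutator of two directional derivatives is the derivative along the Lie bracket of the
fields, since the second derivative of the function is symmetric. -/
theorem lder_lder_sub (hF : ContMDiffAt 𝓘(ℂ, E) 𝓘(ℂ, ℂ) ω F g)
    (a b : GroupLieAlgebra 𝓘(ℂ, E) G) :
    lder (fun k => lder F k b) g a - lder (fun k => lder F k a) g b = lder F g ⁅a, b⁆ := by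
  have hF' : ContDiffAt ℂ ω (fun y => F (g * idParam E G y)) (idCoord E G) :=
    contDiffAt_comp_mul_idParam hF
  have key := VectorField.fderiv_apply_lieBracket_of_isSymmSndFDerivAt (hF'.of_le (by simp))
    (hF'.isSymmSndFDerivAt (by simp))
    ((contDiffAt_leftField (G := G) (lieCoord b)).differentiableAt (by simp))
    ((contDiffAt_leftField (G := G) (lieCoord a)).differentiableAt (by simp))
  rw [← lie_eq_lieBracket_leftField, leftField_idCoord, leftField_idCoord] at key
  have e : ∀ c : GroupLieAlgebra 𝓘(ℂ, E) G, fderiv ℂ (fun x => lder F (g * idParam E G x) c) (idCoord E G)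
      = fderiv ℂ (fun x => fderiv ℂ (fun y => F (g * idParam E G y)) x (leftField G (lieCoord c) x))
        (idCoord E G) := fun c => by
    refine Filter.EventuallyEq.fderiv_eq ?_
    filter_upwards [eventually_lder_eq_leftField hF] with x hx using hx c
  rw [← e, ← e] at key
  exact key.symm

/-- Inversion exchanges R_a with -L_a. The signs cancel in second order terms, while one survives in
the first order term. -/
theorem rder_rder_sub (hF : ContMDiffAt 𝓘(ℂ, E) 𝓘(ℂ, ℂ) ω F g)
    (a b : GroupLieAlgebra 𝓘(ℂ, E) G) :
    rder (fun k => rder F k b) g a - rder (fun k => rder F k a) g b = -rder F g ⁅a, b⁆ := by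
  have hF' : ContMDiffAt 𝓘(ℂ, E) 𝓘(ℂ, ℂ) ω (fun k => F k⁻¹) g⁻¹ := by
    have h : ContMDiffAt 𝓘(ℂ, E) 𝓘(ℂ, ℂ) ω F (g⁻¹)⁻¹ := by simpa using hF
    exact h.comp g⁻¹ (contMDiffAt_id.inv)
  have e : ∀ a b : GroupLieAlgebra 𝓘(ℂ, E) G, rder (fun k => rder F k b) g a
      = lder (fun k => lder (fun k => F k⁻¹) k b) g⁻¹ a := fun a b => by
    rw [rder_eq_neg_lder_inv (contMDiffAt_rder hF b)]
    have : (fun k : G => rder F k⁻¹ b) =ᶠ[𝓝 g⁻¹]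
        fun k => (-1) * lder (fun k => F k⁻¹) k b := by
      have hc : ContinuousAt (fun k : G => k⁻¹) g⁻¹ :=
        (contMDiffAt_id.inv : ContMDiffAt 𝓘(ℂ, E) 𝓘(ℂ, E) ω (fun k : G => k⁻¹) g⁻¹).continuousAt
      have h := (contMDiffAt_iff_contMDiffAt_nhds (by simp)).1 hF
      rw [← inv_inv g] at h
      filter_upwards [hc.eventually h] with k hk
      rw [rder_eq_neg_lder_inv hk, inv_inv, neg_one_mul]
    rw [lder_congr this, lder_const_mul (contMDiffAt_lder hF' b)]
    simp
  rw [e, e, lder_lder_sub hF', rder_eq_neg_lder_inv hF, neg_neg]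

end LieBracketOfOperators

/-! ### The adjoint representation and invariant tensors -/

section Adjoint

variable {E : Type*} [NormedAddCommGroup E] [NormedSpace ℂ E]
  {G : Type*} [TopologicalSpace G] [ChartedSpace E G] [Group G]

/-- The adjoint action of `g` on the Lie algebra: the derivative of `h ↦ g h g⁻¹`. -/
noncomputable def Ad (g : G) : GroupLieAlgebra 𝓘(ℂ, E) G →ₗ[ℂ] GroupLieAlgebra 𝓘(ℂ, E) G :=
  lieCoord.symm.toLinearMap ∘ₗ
    (fderiv ℂ (fun y => extChartAt 𝓘(ℂ, E) (1 : G) (g * idParam E G y * g⁻¹))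
      (idCoord E G)).toLinearMap ∘ₗ lieCoord.toLinearMap

theorem Ad_apply (g : G) (a : GroupLieAlgebra 𝓘(ℂ, E) G) :
    Ad g a = lieCoord.symm (fderiv ℂ (fun y => extChartAt 𝓘(ℂ, E) (1 : G)
      (g * idParam E G y * g⁻¹)) (idCoord E G) (lieCoord a)) := rfl

theorem Ad_one : Ad (E := E) (1 : G) = LinearMap.id := by
  ext a
  simp only [Ad_apply, one_mul, inv_one, mul_one, fderiv_chart_idParam]
  simp

variable [LieGroup 𝓘(ℂ, E) ω G]

theorem fderiv_comp_conj {H : G → ℂ} (hH : ContMDiffAt 𝓘(ℂ, E) 𝓘(ℂ, ℂ) ω H 1) (g : G)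
    (a : GroupLieAlgebra 𝓘(ℂ, E) G) :
    fderiv ℂ (fun y => H (g * idParam E G y * g⁻¹)) (idCoord E G) (lieCoord a) = lder H 1 (Ad g a) := by
  have hc : ContMDiffAt 𝓘(ℂ, E) 𝓘(ℂ, E) ω (fun y => g * idParam E G y * g⁻¹) (idCoord E G) :=
    (contMDiffAt_const.mul contMDiffAt_idParam).mul contMDiffAt_const
  have h1 : g * idParam E G (idCoord E G) * g⁻¹ = 1 := by simp
  have hs : ∀ᶠ y in 𝓝 (idCoord E G),
      g * idParam E G y * g⁻¹ ∈ (extChartAt 𝓘(ℂ, E) (1 : G)).source :=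
    hc.continuousAt.eventually ((isOpen_extChartAt_source (I := 𝓘(ℂ, E)) (1 : G)).mem_nhds
      (by simp))
  have e : (fun y => H (g * idParam E G y * g⁻¹)) =ᶠ[𝓝 (idCoord E G)]
      (fun z => H (1 * idParam E G z)) ∘
        (fun y => extChartAt 𝓘(ℂ, E) (1 : G) (g * idParam E G y * g⁻¹)) := by
    filter_upwards [hs] with y hy
    have h := (extChartAt 𝓘(ℂ, E) (1 : G)).left_inv hy
    rw [← idParam] at h
    simp only [Function.comp_apply, h, one_mul]
  have e2 : extChartAt 𝓘(ℂ, E) (1 : G) (g * idParam E G (idCoord E G) * g⁻¹) = idCoord E G := by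
    rw [h1]
    rfl
  rw [e.fderiv_eq, fderiv_comp, e2, lder_apply]
  · rfl
  · rw [e2]
    exact (contDiffAt_comp_mul_idParam hH).differentiableAt (by simp)
  · have hx : ContMDiffAt 𝓘(ℂ, E) 𝓘(ℂ, E) ω (extChartAt 𝓘(ℂ, E) (1 : G))
        (g * idParam E G (idCoord E G) * g⁻¹) := by
      rw [h1]
      exact contMDiffAt_extChartAt
    exact (ContMDiffAt.comp (f := fun y => g * idParam E G y * g⁻¹) _ hx
      hc).contDiffAt.differentiableAt (by simp)

variable {F : G → ℂ} {g : G}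

/-- This is the identity gy = (gyg⁻¹)g, differentiated in y. -/
theorem lder_eq_rder_Ad (hF : ContMDiffAt 𝓘(ℂ, E) 𝓘(ℂ, ℂ) ω F g)
    (a : GroupLieAlgebra 𝓘(ℂ, E) G) : lder F g a = rder F g (Ad g a) := by
  have h : ContMDiffAt 𝓘(ℂ, E) 𝓘(ℂ, ℂ) ω (fun k => F (k * g)) 1 := by
    have h' : ContMDiffAt 𝓘(ℂ, E) 𝓘(ℂ, ℂ) ω F (1 * g) := by rwa [one_mul]
    exact ContMDiffAt.comp (f := fun k => k * g) 1 h' (contMDiffAt_id.mul contMDiffAt_const)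
  have := fderiv_comp_conj h g a
  simpa only [inv_mul_cancel_right, lder_apply, rder_apply, one_mul] using this

/-- Here gky = g(kyk⁻¹)k, and `F` does not see the final factor k. -/
theorem lder_mul_right (hF : ContMDiffAt 𝓘(ℂ, E) 𝓘(ℂ, ℂ) ω F g) {k : G}
    (hk : ∀ x, F (x * k) = F x) (a : GroupLieAlgebra 𝓘(ℂ, E) G) :
    lder F (g * k) a = lder F g (Ad k a) := by
  have h : ContMDiffAt 𝓘(ℂ, E) 𝓘(ℂ, ℂ) ω (fun x => F (g * x)) 1 := by
    have h' : ContMDiffAt 𝓘(ℂ, E) 𝓘(ℂ, ℂ) ω F (g * 1) := by rwa [mul_one]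
    exact ContMDiffAt.comp (f := fun x => g * x) 1 h' (contMDiffAt_const.mul contMDiffAt_id)
  have := fderiv_comp_conj h k a
  have e : ∀ y, F (g * (k * idParam E G y * k⁻¹)) = F (g * k * idParam E G y) := fun y => by
    rw [← hk]
    congr 1
    group
  simpa only [e, lder_apply, one_mul] using this

omit [LieGroup 𝓘(ℂ, E) ω G] in
theorem rder_mul_right {k : G} (hk : ∀ x, F (x * k) = F x) :
    rder (E := E) F (g * k) = rder F g := by
  ext a
  simp only [rder_apply, ← mul_assoc, hk]

theorem lder_sum {ι : Type*} (s : Finset ι) {f : ι → G → ℂ}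
    (hf : ∀ i, ContMDiffAt 𝓘(ℂ, E) 𝓘(ℂ, ℂ) ω (f i) g) :
    lder (E := E) (fun k => ∑ i ∈ s, f i k) g = ∑ i ∈ s, lder (f i) g := by
  classical
  induction s using Finset.induction_on with
  | empty =>
    ext a
    simp [lder_apply]
  | insert i s hi ih =>
    simp only [Finset.sum_insert hi]
    rw [lder_add (hf i) (contMDiffAt_finsetSum fun i _ => hf i), ih]

variable [FiniteDimensional ℂ E]

instance finiteDimensional_groupLieAlgebra :
    FiniteDimensional ℂ (GroupLieAlgebra 𝓘(ℂ, E) G) :=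
  Module.Finite.equiv (lieCoord (E := E) (G := G)).symm

/-- A linear functional on the Lie algebra as a function near the identity of the group. -/
noncomputable def coordFun (ℓ : GroupLieAlgebra 𝓘(ℂ, E) G →ₗ[ℂ] ℂ) (g : G) : ℂ :=
  LinearMap.toContinuousLinearMap (ℓ ∘ₗ lieCoord.symm.toLinearMap) (extChartAt 𝓘(ℂ, E) (1 : G) g)

omit [LieGroup 𝓘(ℂ, E) ω G] in
theorem contMDiffAt_coordFun (ℓ : GroupLieAlgebra 𝓘(ℂ, E) G →ₗ[ℂ] ℂ) :
    ContMDiffAt 𝓘(ℂ, E) 𝓘(ℂ, ℂ) ω (coordFun ℓ) (1 : G) :=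
  ContMDiffAt.comp (I' := 𝓘(ℂ, E)) 1
    (ContinuousLinearMap.contMDiff (n := ω) _).contMDiffAt contMDiffAt_extChartAt

omit [LieGroup 𝓘(ℂ, E) ω G] in
theorem lder_coordFun_one (ℓ : GroupLieAlgebra 𝓘(ℂ, E) G →ₗ[ℂ] ℂ) : lder (coordFun ℓ) 1 = ℓ := by
  ext a
  have e : (fun y => coordFun ℓ (1 * idParam E G y)) =ᶠ[𝓝 (idCoord E G)]
      LinearMap.toContinuousLinearMap (ℓ ∘ₗ lieCoord.symm.toLinearMap) := by
    filter_upwards [eventually_mem_target (E := E) (G := G)] with y hy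
    rw [one_mul, coordFun, idParam, (extChartAt 𝓘(ℂ, E) (1 : G)).right_inv hy]
  rw [lder_apply, e.fderiv_eq, ContinuousLinearMap.fderiv]
  simp

/-- This writes matrix entries of Ad as derivatives of an explicit function on the group, which
makes their analyticity in `g` accessible. -/
theorem apply_Ad_eq (ℓ : GroupLieAlgebra 𝓘(ℂ, E) G →ₗ[ℂ] ℂ) (a : GroupLieAlgebra 𝓘(ℂ, E) G)
    (g : G) : ℓ (Ad g a) = fderiv ℂ (fun y => coordFun ℓ (g * idParam E G y * g⁻¹))
      (idCoord E G) (lieCoord a) := by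
  rw [fderiv_comp_conj (contMDiffAt_coordFun ℓ), lder_coordFun_one]

variable (E) in
/-- An action of `G` on `N` by linear maps which is analytic and whose derivative is induced by
the action of the Lie algebra. -/
def IntegratesLieAction {N : Type*} [AddCommGroup N] [Module ℂ N]
    [LieRingModule (GroupLieAlgebra 𝓘(ℂ, E) G) N] (P : G → N →ₗ[ℂ] N) : Prop :=
  ∀ (ℓ : N →ₗ[ℂ] ℂ) (n : N), ContMDiff 𝓘(ℂ, E) 𝓘(ℂ, ℂ) ω (fun k => ℓ (P k n)) ∧
    ∀ g (a : GroupLieAlgebra 𝓘(ℂ, E) G), lder (fun k => ℓ (P k n)) g a = ℓ (P g ⁅a, n⁆)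

theorem contMDiff_apply_Ad (ℓ : GroupLieAlgebra 𝓘(ℂ, E) G →ₗ[ℂ] ℂ)
    (b : GroupLieAlgebra 𝓘(ℂ, E) G) :
    ContMDiff 𝓘(ℂ, E) 𝓘(ℂ, ℂ) ω (fun k : G => ℓ (Ad k b)) := by
  intro g
  rw [contMDiffAt_iff_comp_mul_idParam]
  simp only [apply_Ad_eq]
  refine ContDiffAt.contMDiffAt (ContDiffAt.fderiv_right_apply (Ψ := fun q : E × E =>
    coordFun ℓ (g * idParam E G q.1 * idParam E G q.2 * (g * idParam E G q.1)⁻¹)) ?_ (lieCoord b))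
  refine contDiffAt_comp_of_eq (contMDiffAt_coordFun ℓ) ?_ (by simp)
  exact ((contMDiffAt_const.mul contMDiffAt_idParam_fst).mul contMDiffAt_idParam_snd).mul
    (contMDiffAt_const.mul contMDiffAt_idParam_fst).inv

/-- The differential of Ad is read off from the commutator relation. Take `F` whose right derivative
at `g` is `ℓ` and expand L_b F = Σ (Ad k b)_i R_i F in a basis. Applying L_a produces derivatives of
the coefficients and terms R_i L_a F; the latter sum to L_b L_a F, as left and right derivatives
commute. What remains of L_a L_b F - L_b L_a F = L_[a,b] F is the derivative of `ℓ (Ad k b)` on one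
side and `ℓ (Ad g ⁅a, b⁆)` on the other. -/
theorem integratesLieAction_Ad : IntegratesLieAction E (Ad (E := E) (G := G)) := by
  intro ℓ b
  refine ⟨contMDiff_apply_Ad ℓ b, fun g a => ?_⟩
  let B := Module.finBasis ℂ (GroupLieAlgebra 𝓘(ℂ, E) G)
  have hexp : ∀ (μ : GroupLieAlgebra 𝓘(ℂ, E) G →ₗ[ℂ] ℂ) x, μ x = ∑ i, B.coord i x * μ (B i) :=
    fun μ x => by
      conv_lhs => rw [← B.sum_repr x]
      simp only [map_sum, map_smul, smul_eq_mul, Module.Basis.coord_apply]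
  have hA : ∀ i, ContMDiffAt 𝓘(ℂ, E) 𝓘(ℂ, ℂ) ω (fun k : G => B.coord i (Ad k b)) g :=
    fun i => (contMDiff_apply_Ad (B.coord i) b).contMDiffAt
  -- a function whose right invariant derivative at `g` is `ℓ`
  let F : G → ℂ := fun k => coordFun ℓ (k * g⁻¹)
  have hF : ContMDiffAt 𝓘(ℂ, E) 𝓘(ℂ, ℂ) ω F g := by
    have h' : ContMDiffAt 𝓘(ℂ, E) 𝓘(ℂ, ℂ) ω (coordFun ℓ) (g * g⁻¹) := by
      rw [mul_inv_cancel]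
      exact contMDiffAt_coordFun ℓ
    exact ContMDiffAt.comp (f := fun k => k * g⁻¹) g h' (contMDiffAt_id.mul contMDiffAt_const)
  have hFr : rder F g = ℓ := by
    rw [← lder_coordFun_one ℓ]
    ext x
    simp [F, rder_apply, lder_apply]
  have e1 : (fun k => lder F k b) =ᶠ[𝓝 g] fun k => ∑ i, B.coord i (Ad k b) * rder F k (B i) := by
    filter_upwards [(contMDiffAt_iff_contMDiffAt_nhds (by simp)).1 hF] with k hk
    rw [lder_eq_rder_Ad hk, ← hexp]
  have e2 : lder (fun k => lder F k b) g a = ∑ i, (lder (fun k => B.coord i (Ad k b)) g a * ℓ (B i)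
      + B.coord i (Ad g b) * rder (fun k => lder F k a) g (B i)) := by
    have hs : ∀ i, ContMDiffAt 𝓘(ℂ, E) 𝓘(ℂ, ℂ) ω
        (fun k => B.coord i (Ad k b) * rder F k (B i)) g := fun i =>
      (hA i).mul (contMDiffAt_rder hF (B i))
    rw [lder_congr e1, lder_sum _ hs, LinearMap.sum_apply]
    refine Finset.sum_congr rfl fun i _ => ?_
    rw [lder_mul (hA i) (contMDiffAt_rder hF (B i)), hFr, lder_rder_comm hF]
  have e3 : lder (fun k => lder F k a) g b = ∑ i, B.coord i (Ad g b)
      * rder (fun k => lder F k a) g (B i) := by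
    rw [lder_eq_rder_Ad (contMDiffAt_lder hF a), hexp]
  have e4 := lder_lder_sub hF a b
  rw [e2, e3, ← Finset.sum_sub_distrib, lder_eq_rder_Ad hF, hFr] at e4
  rw [← e4]
  have e5 : (fun k => ℓ (Ad k b)) = fun k : G => ∑ i, ℓ (B i) * B.coord i (Ad k b) := by
    ext k
    rw [hexp ℓ]
    exact Finset.sum_congr rfl fun i _ => mul_comm _ _
  have hs : ∀ i, ContMDiffAt 𝓘(ℂ, E) 𝓘(ℂ, ℂ) ω
      (fun k : G => ℓ (B i) * B.coord i (Ad k b)) g := fun i => contMDiffAt_const.mul (hA i)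
  rw [e5, lder_sum _ hs, LinearMap.sum_apply]
  refine Finset.sum_congr rfl fun i _ => ?_
  rw [lder_const_mul (hA i)]
  simp only [LinearMap.smul_apply, smul_eq_mul]
  ring

/-- In product bases the matrix entries of the tensor action are sums of products of matrix entries,
so the product rule gives the Leibniz action. -/
theorem IntegratesLieAction.tensor {N₁ N₂ : Type*} [AddCommGroup N₁] [Module ℂ N₁]
    [LieRingModule (GroupLieAlgebra 𝓘(ℂ, E) G) N₁] [LieModule ℂ (GroupLieAlgebra 𝓘(ℂ, E) G) N₁]
    [FiniteDimensional ℂ N₁] [AddCommGroup N₂] [Module ℂ N₂]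
    [LieRingModule (GroupLieAlgebra 𝓘(ℂ, E) G) N₂] [LieModule ℂ (GroupLieAlgebra 𝓘(ℂ, E) G) N₂]
    [FiniteDimensional ℂ N₂] {P₁ : G → N₁ →ₗ[ℂ] N₁} {P₂ : G → N₂ →ₗ[ℂ] N₂}
    (h₁ : IntegratesLieAction E P₁) (h₂ : IntegratesLieAction E P₂) :
    IntegratesLieAction E (fun g => TensorProduct.map (P₁ g) (P₂ g)) := by
  intro ℓ n
  induction n with
  | zero =>
    refine ⟨by simpa using contMDiff_const, fun g a => ?_⟩
    simp [lder_apply]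
  | add m n hm hn =>
    simp only [map_add, lie_add]
    refine ⟨hm.1.add hn.1, fun g a => ?_⟩
    rw [lder_add hm.1.contMDiffAt hn.1.contMDiffAt, LinearMap.add_apply, hm.2, hn.2]
  | tmul x y =>
    have s₁ : ∀ (i) (g : G), ContMDiffAt 𝓘(ℂ, E) 𝓘(ℂ, ℂ) ω
        (fun k : G => (Module.finBasis ℂ N₁).coord i (P₁ k x)) g := fun i g =>
      (h₁ ((Module.finBasis ℂ N₁).coord i) x).1.contMDiffAt
    have s₂ : ∀ (j) (g : G), ContMDiffAt 𝓘(ℂ, E) 𝓘(ℂ, ℂ) ω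
        (fun k : G => (Module.finBasis ℂ N₂).coord j (P₂ k y)) g := fun j g =>
      (h₂ ((Module.finBasis ℂ N₂).coord j) y).1.contMDiffAt
    have s₁₂ : ∀ (i j) (g : G), ContMDiffAt 𝓘(ℂ, E) 𝓘(ℂ, ℂ) ω
        (fun k : G => (Module.finBasis ℂ N₁).coord i (P₁ k x)
          * (Module.finBasis ℂ N₂).coord j (P₂ k y)) g := fun i j g => (s₁ i g).mul (s₂ j g)
    have s₃ : ∀ (i j) (g : G), ContMDiffAt 𝓘(ℂ, E) 𝓘(ℂ, ℂ) ω
        (fun k : G => ℓ (Module.finBasis ℂ N₁ i ⊗ₜ Module.finBasis ℂ N₂ j) *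
          ((Module.finBasis ℂ N₁).coord i (P₁ k x) * (Module.finBasis ℂ N₂).coord j (P₂ k y))) g :=
      fun i j g => contMDiffAt_const.mul (s₁₂ i j g)
    have e : (fun k : G => ℓ (TensorProduct.map (P₁ k) (P₂ k) (x ⊗ₜ y)))
        = fun k => ∑ i, ∑ j, ℓ (Module.finBasis ℂ N₁ i ⊗ₜ Module.finBasis ℂ N₂ j) *
          ((Module.finBasis ℂ N₁).coord i (P₁ k x) * (Module.finBasis ℂ N₂).coord j (P₂ k y)) := by
      ext k
      rw [TensorProduct.map_tmul, tensor_functional_eq_sum]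
    rw [e]
    refine ⟨fun g => contMDiffAt_finsetSum fun i _ => contMDiffAt_finsetSum fun j _ => s₃ i j g,
      fun g a => ?_⟩
    rw [lder_sum _ fun i => contMDiffAt_finsetSum fun j _ => s₃ i j g, LinearMap.sum_apply,
      TensorProduct.LieModule.lie_tmul_right, map_add, map_add, TensorProduct.map_tmul,
      TensorProduct.map_tmul, tensor_functional_eq_sum, tensor_functional_eq_sum,
      ← Finset.sum_add_distrib]
    refine Finset.sum_congr rfl fun i _ => ?_
    rw [lder_sum _ fun j => s₃ i j g, LinearMap.sum_apply, ← Finset.sum_add_distrib]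
    refine Finset.sum_congr rfl fun j _ => ?_
    rw [lder_const_mul (s₁₂ i j g), LinearMap.smul_apply, lder_mul (s₁ i g) (s₂ j g),
      (h₁ _ x).2, (h₂ _ y).2, smul_eq_mul]
    ring

omit [FiniteDimensional ℂ E] in
theorem leftTranslation_surjective (g : G) :
    Function.Surjective (leftTranslation (E := E) g) := by
  intro v
  have h1 : MDifferentiableAt 𝓘(ℂ, E) 𝓘(ℂ, E) (fun k : G => g⁻¹ * k) g :=
    (contMDiff_mul_left (I := 𝓘(ℂ, E)) (n := ω)).contMDiffAt.mdifferentiableAt (by simp)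
  have h2 : ∀ x : G, MDifferentiableAt 𝓘(ℂ, E) 𝓘(ℂ, E) (fun k : G => g * k) x := fun x =>
    (contMDiff_mul_left (I := 𝓘(ℂ, E)) (n := ω)).contMDiffAt.mdifferentiableAt (by simp)
  have h3 := mfderiv_comp_apply (I' := 𝓘(ℂ, E)) g (h2 (g⁻¹ * g)) h1 v
  have h4 : (fun k : G => g * k) ∘ (fun k : G => g⁻¹ * k) = id := by ext; simp
  rw [h4, mfderiv_id] at h3
  refine ⟨mfderiv 𝓘(ℂ, E) 𝓘(ℂ, E) (fun k : G => g⁻¹ * k) g v, ?_⟩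
  have e := congrArg (fun z => (mfderiv 𝓘(ℂ, E) 𝓘(ℂ, E) (fun k => g * k) z : E →L[ℂ] E)
    (mfderiv 𝓘(ℂ, E) 𝓘(ℂ, E) (fun k : G => g⁻¹ * k) g v)) (inv_mul_cancel g)
  exact e.symm.trans h3.symm

omit [LieGroup 𝓘(ℂ, E) ω G] [FiniteDimensional ℂ E] [Group G] in
-- The composite `F ∘ ι` has zero derivative on a ball. The map `ι` is left general so as to serve
-- both for charts of the group and for parametrizations of the fibres of G → G/U.
theorem eventually_comp_eq_of_mfderiv {W : Type*} [NormedAddCommGroup W] [NormedSpace ℂ W]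
    {ι : W → G} {y₀ : W} (hι : ∀ᶠ y in 𝓝 y₀, MDifferentiableAt 𝓘(ℂ, W) 𝓘(ℂ, E) ι y)
    (hF : MDifferentiable 𝓘(ℂ, E) 𝓘(ℂ, ℂ) F)
    (h : ∀ᶠ y in 𝓝 y₀, ∀ w : W, differentialAt E F (ι y) (mfderiv 𝓘(ℂ, W) 𝓘(ℂ, E) ι y w) = 0) :
    ∀ᶠ y in 𝓝 y₀, F (ι y) = F (ι y₀) := by
  obtain ⟨r, hr, hball⟩ := Metric.eventually_nhds_iff_ball.1 (hι.and h)
  filter_upwards [Metric.ball_mem_nhds y₀ hr] with y hy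
  have hd : ∀ z ∈ Metric.ball y₀ r, MDifferentiableAt 𝓘(ℂ, W) 𝓘(ℂ, ℂ) (F ∘ ι) z := fun z hz =>
    (hF (ι z)).comp z (hball z hz).1
  refine Metric.isOpen_ball.is_const_of_fderiv_eq_zero (𝕜 := ℂ) (f := F ∘ ι)
    ?_ (fun z hz => (hd z hz).differentiableAt.differentiableWithinAt) (fun z hz => ?_) hy
    (Metric.mem_ball_self hr)
  · let A : NormedSpace ℝ W := NormedSpace.complexToReal
    exact (convex_ball y₀ r).isPreconnected
  · ext w
    have h1 := mfderiv_comp_apply (I' := 𝓘(ℂ, E)) z (hF (ι z)) (hball z hz).1 w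
    rw [mfderiv_eq_fderiv] at h1
    exact h1.trans ((hball z hz).2 w)

omit [FiniteDimensional ℂ E] in
theorem eq_apply_one_of_lder_eq_zero [ConnectedSpace G]
    (hF : ContMDiff 𝓘(ℂ, E) 𝓘(ℂ, ℂ) ω F) (h : ∀ g a, lder (E := E) F g a = 0) (g : G) :
    F g = F 1 := by
  have hd : MDifferentiable 𝓘(ℂ, E) 𝓘(ℂ, ℂ) F := hF.mdifferentiable (by simp)
  have hz : ∀ k v, differentialAt E F k v = 0 := fun k v => by
    obtain ⟨a, rfl⟩ := leftTranslation_surjective k v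
    rw [← LinearMap.comp_apply, differentialAt_leftTranslation (hd k), h]
  have hl : IsLocallyConstant F := by
    rw [IsLocallyConstant.iff_eventually_eq]
    intro k
    have h1 := eventually_comp_eq_of_mfderiv (F := F) (E := E)
      (ι := (extChartAt 𝓘(ℂ, E) k).symm) (y₀ := extChartAt 𝓘(ℂ, E) k k)
      (by
        filter_upwards [(isOpen_extChartAt_target (I := 𝓘(ℂ, E)) k).mem_nhds
          (mem_extChartAt_target k)] with y hy
        exact ((contMDiffOn_extChartAt_symm (n := ω) k).contMDiffAt
          ((isOpen_extChartAt_target (I := 𝓘(ℂ, E)) k).mem_nhds hy)).mdifferentiableAt (by simp))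
      hd (.of_forall fun y w => hz _ _)
    have h2 := (continuousAt_extChartAt (I := 𝓘(ℂ, E)) k).eventually h1
    filter_upwards [h2, extChartAt_source_mem_nhds (I := 𝓘(ℂ, E)) k] with x hx hxs
    rwa [(extChartAt 𝓘(ℂ, E) k).left_inv hxs, extChartAt_to_inv] at hx
  exact hl.apply_eq_of_isPreconnected isPreconnected_univ trivial trivial

/-- Each matrix entry `ℓ (P g n)` has left derivatives `ℓ (P g ⁅a, n⁆)`, which vanish, so it is
constant on the connected group. -/
theorem IntegratesLieAction.apply_eq_of_invariant [ConnectedSpace G] {N : Type*} [AddCommGroup N]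
    [Module ℂ N] [LieRingModule (GroupLieAlgebra 𝓘(ℂ, E) G) N] {P : G → N →ₗ[ℂ] N}
    (hP : IntegratesLieAction E P) (h1 : P 1 = LinearMap.id) {n : N}
    (hn : ∀ a : GroupLieAlgebra 𝓘(ℂ, E) G, ⁅a, n⁆ = 0) (g : G) : P g n = n := by
  rw [← sub_eq_zero, ← Module.forall_dual_apply_eq_zero_iff ℂ]
  intro ℓ
  have := eq_apply_one_of_lder_eq_zero (hP ℓ n).1
    (fun g a => by rw [(hP ℓ n).2, hn, map_zero, map_zero]) g
  rw [map_sub, this, h1, LinearMap.id_apply, sub_self]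

end Adjoint

/-! ### Local trivializations of submersions -/

section Submersion

variable {E E' : Type*} [NormedAddCommGroup E] [NormedSpace ℂ E] [NormedAddCommGroup E']
  [NormedSpace ℂ E'] {M N : Type*} [TopologicalSpace M] [ChartedSpace E M] [TopologicalSpace N]
  [ChartedSpace E' N] {f : M → N} {x : M}

/-- `Θ` and `r` exhibit `f` near `x` as the projection of a product with fiber `W`. -/
structure IsLocalTrivialization {W : Type*} [NormedAddCommGroup W] [NormedSpace ℂ W] (f : M → N)
    (x : M) (Θ : N → W → M) (r : M → W) : Prop where
  contMDiffAt_fiber : ContMDiffAt 𝓘(ℂ, E) 𝓘(ℂ, W) ω r x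
  contMDiffAt_total : ContMDiffAt (𝓘(ℂ, E').prod 𝓘(ℂ, W)) 𝓘(ℂ, E) ω
    (fun z : N × W => Θ z.1 z.2) (f x, r x)
  total_fiber : ∀ᶠ m in 𝓝 x, Θ (f m) (r m) = m
  map_total : ∀ᶠ z in 𝓝 (f x, r x), f (Θ z.1 z.2) = z.1

/-- In adapted charts a submersion is a linear projection from a product; `r` is the fibre
coordinate and `Θ` rebuilds a point from its image and its fibre coordinate. -/
theorem Manifold.IsSubmersionAt.exists_isLocalTrivialization
    [IsManifold 𝓘(ℂ, E) ω M] [IsManifold 𝓘(ℂ, E') ω N]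
    (h : Manifold.IsSubmersionAt 𝓘(ℂ, E) 𝓘(ℂ, E') ω f x) :
    ∃ (Θ : N → h.complement → M) (r : M → h.complement),
      IsLocalTrivialization (E := E) (E' := E') f x Θ r := by
  have hdom : ContMDiffAt 𝓘(ℂ, E) 𝓘(ℂ, E) ω h.domChart x :=
    contMDiffAt_of_mem_maximalAtlas h.domChart_mem_maximalAtlas h.mem_domChart_source
  have hcod : ContMDiffAt 𝓘(ℂ, E') 𝓘(ℂ, E') ω h.codChart (f x) :=
    contMDiffAt_of_mem_maximalAtlas h.codChart_mem_maximalAtlas h.mem_codChart_source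
  have hxt : h.domChart x ∈ h.domChart.target := h.domChart.map_source h.mem_domChart_source
  have hsymm : ContMDiffAt 𝓘(ℂ, E) 𝓘(ℂ, E) ω h.domChart.symm (h.domChart x) :=
    contMDiffAt_symm_of_mem_maximalAtlas h.domChart_mem_maximalAtlas hxt
  have hw : ∀ y ∈ h.domChart.target, h.codChart (f (h.domChart.symm y)) = (h.equiv y).1 := by
    intro y hy
    have hy' : y ∈ (h.domChart.extend 𝓘(ℂ, E)).target := by simpa using hy
    have := h.writtenInCharts hy'
    simpa using this
  have hfst : ∀ m ∈ h.domChart.source, h.codChart (f m) = (h.equiv (h.domChart m)).1 := by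
    intro m hm
    rw [← hw _ (h.domChart.map_source hm), h.domChart.left_inv hm]
  have hΘ : h.equiv.symm (h.codChart (f x), (h.equiv (h.domChart x)).2) = h.domChart x := by
    rw [hfst x h.mem_domChart_source]
    simp
  have harg : ContMDiffAt (𝓘(ℂ, E').prod 𝓘(ℂ, h.complement)) 𝓘(ℂ, E) ω
      (fun z : N × h.complement => h.equiv.symm (h.codChart z.1, z.2))
      (f x, (h.equiv (h.domChart x)).2) := by
    have h1 : ContMDiffAt (𝓘(ℂ, E').prod 𝓘(ℂ, h.complement)) 𝓘(ℂ, E') ω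
        (fun z : N × h.complement => h.codChart z.1) (f x, (h.equiv (h.domChart x)).2) :=
      ContMDiffAt.comp (f := Prod.fst) _ hcod contMDiffAt_fst
    have h2 := h1.prodMk_space (contMDiffAt_snd (I := 𝓘(ℂ, E')) (J := 𝓘(ℂ, h.complement)))
    have h3 := h.equiv.symm.toContinuousLinearMap.contMDiff (n := ω)
    exact ContMDiffAt.comp (f := fun z : N × h.complement => (h.codChart z.1, z.2)) _
      h3.contMDiffAt h2
  refine ⟨fun q y => h.domChart.symm (h.equiv.symm (h.codChart q, y)),
    fun m => (h.equiv (h.domChart m)).2, ?_, ?_, ?_, ?_⟩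
  · have h1 := ((ContinuousLinearMap.snd ℂ E' h.complement).comp
      h.equiv.toContinuousLinearMap).contMDiff (n := ω)
    exact ContMDiffAt.comp (f := h.domChart) x h1.contMDiffAt hdom
  · refine ContMDiffAt.comp (f := fun z : N × h.complement =>
      h.equiv.symm (h.codChart z.1, z.2)) _ ?_ harg
    rwa [hΘ]
  · filter_upwards [h.domChart.open_source.mem_nhds h.mem_domChart_source] with m hm
    rw [hfst m hm]
    simp [h.domChart.left_inv hm]
  · have hc : ∀ᶠ z in 𝓝 (f x, (h.equiv (h.domChart x)).2),
        h.equiv.symm (h.codChart z.1, z.2) ∈ h.domChart.target := by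
      refine harg.continuousAt.eventually (h.domChart.open_target.mem_nhds ?_)
      simpa only [hΘ] using hxt
    have hs : ∀ᶠ z in 𝓝 (f x, (h.equiv (h.domChart x)).2), z.1 ∈ h.codChart.source :=
      continuousAt_fst.eventually (h.codChart.open_source.mem_nhds h.mem_codChart_source)
    filter_upwards [hc, hs] with z hz hz'
    have h1 := hw _ hz
    rw [ContinuousLinearEquiv.apply_symm_apply] at h1
    exact h.codChart.injOn (h.source_subset_preimage_source (h.domChart.map_target hz)) hz' h1

namespace IsLocalTrivialization

variable {W : Type*} [NormedAddCommGroup W] [NormedSpace ℂ W] {Θ : N → W → M} {r : M → W}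

theorem total_fiber_self (h : IsLocalTrivialization (E := E) (E' := E') f x Θ r) :
    Θ (f x) (r x) = x := h.total_fiber.self_of_nhds

theorem contMDiffAt_section (h : IsLocalTrivialization (E := E) (E' := E') f x Θ r) :
    ContMDiffAt 𝓘(ℂ, E') 𝓘(ℂ, E) ω (fun q => Θ q (r x)) (f x) :=
  ContMDiffAt.comp (f := fun q => (q, r x)) (f x) h.contMDiffAt_total
    (contMDiffAt_id.prodMk contMDiffAt_const)

theorem map_section (h : IsLocalTrivialization (E := E) (E' := E') f x Θ r) :
    ∀ᶠ q in 𝓝 (f x), f (Θ q (r x)) = q := by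
  have hc : ContinuousAt (fun q : N => (q, r x)) (f x) := by fun_prop
  exact hc.eventually h.map_total

theorem contMDiffAt_fiberInclusion (h : IsLocalTrivialization (E := E) (E' := E') f x Θ r) :
    ContMDiffAt 𝓘(ℂ, W) 𝓘(ℂ, E) ω (fun y => Θ (f x) y) (r x) :=
  ContMDiffAt.comp (f := fun y => (f x, y)) (r x) h.contMDiffAt_total
    (contMDiffAt_const.prodMk contMDiffAt_id)

theorem map_fiberInclusion (h : IsLocalTrivialization (E := E) (E' := E') f x Θ r) :
    ∀ᶠ y in 𝓝 (r x), f (Θ (f x) y) = f x := by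
  have hc : ContinuousAt (fun y : W => (f x, y)) (r x) := by fun_prop
  exact hc.eventually h.map_total

/-- Near `f x` the map `k` is the composite of `k ∘ f` with a local section. -/
theorem contMDiffAt_of_comp (h : IsLocalTrivialization (E := E) (E' := E') f x Θ r)
    {E₁ : Type*} [NormedAddCommGroup E₁] [NormedSpace ℂ E₁] {N₁ : Type*} [TopologicalSpace N₁]
    [ChartedSpace E₁ N₁] {k : N → N₁} (hk : ContMDiffAt 𝓘(ℂ, E) 𝓘(ℂ, E₁) ω (fun m => k (f m)) x) :
    ContMDiffAt 𝓘(ℂ, E') 𝓘(ℂ, E₁) ω k (f x) := by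
  have h1 : ContMDiffAt 𝓘(ℂ, E) 𝓘(ℂ, E₁) ω (fun m => k (f m)) (Θ (f x) (r x)) := by
    rwa [h.total_fiber_self]
  refine (ContMDiffAt.comp (f := fun q => Θ q (r x)) (f x) h1
    h.contMDiffAt_section).congr_of_eventuallyEq ?_
  filter_upwards [h.map_section] with q hq
  rw [Function.comp_apply, hq]

theorem mfderiv_surjective (h : IsLocalTrivialization (E := E) (E' := E') f x Θ r)
    (hf : MDifferentiableAt 𝓘(ℂ, E) 𝓘(ℂ, E') f x) :
    Function.Surjective (mfderiv 𝓘(ℂ, E) 𝓘(ℂ, E') f x) := by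
  intro v
  have e : f ∘ (fun q => Θ q (r x)) =ᶠ[𝓝 (f x)] id := h.map_section
  have h1 := mfderiv_comp_apply_of_eq (I' := 𝓘(ℂ, E)) (x := f x) (f := fun q => Θ q (r x))
    (y := x) hf (h.contMDiffAt_section.mdifferentiableAt (by simp)) h.total_fiber_self v
  refine ⟨mfderiv 𝓘(ℂ, E') 𝓘(ℂ, E) (fun q => Θ q (r x)) (f x) v, ?_⟩
  have h2 : (mfderiv 𝓘(ℂ, E') 𝓘(ℂ, E') (f ∘ fun q => Θ q (r x)) (f x) : E' →L[ℂ] E')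
      = ContinuousLinearMap.id ℂ E' := by
    exact e.mfderiv_eq.trans mfderiv_id
  exact h1.symm.trans (congrArg (fun T : E' →L[ℂ] E' => T v) h2)

/-- Differentiate `Θ (f m) (r m) = m` along `v`: the contribution of the first argument vanishes
because `v` lies in the kernel of the differential of `f`. -/
theorem mfderiv_fiberInclusion_of_mem_ker
    (h : IsLocalTrivialization (E := E) (E' := E') f x Θ r)
    (hf : MDifferentiableAt 𝓘(ℂ, E) 𝓘(ℂ, E') f x) {v : E}
    (hv : (mfderiv 𝓘(ℂ, E) 𝓘(ℂ, E') f x : E →L[ℂ] E') v = 0) :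
    (mfderiv 𝓘(ℂ, W) 𝓘(ℂ, E) (fun y => Θ (f x) y) (r x) : W →L[ℂ] E)
      ((mfderiv 𝓘(ℂ, E) 𝓘(ℂ, W) r x : E →L[ℂ] W) v) = v := by
  have ht := h.contMDiffAt_total.mdifferentiableAt (by simp)
  have hr := h.contMDiffAt_fiber.mdifferentiableAt (by simp)
  have e : (fun z : N × W => Θ z.1 z.2) ∘ (fun m => (f m, r m)) =ᶠ[𝓝 x] id := h.total_fiber
  have h1 := mfderiv_comp_apply (I' := 𝓘(ℂ, E').prod 𝓘(ℂ, W)) x ht (hf.prodMk hr) v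
  have h2 : (mfderiv 𝓘(ℂ, E) 𝓘(ℂ, E) ((fun z : N × W => Θ z.1 z.2) ∘ (fun m => (f m, r m))) x
      : E →L[ℂ] E) = ContinuousLinearMap.id ℂ E := e.mfderiv_eq.trans mfderiv_id
  have h3 := mfderiv_comp_apply (I' := 𝓘(ℂ, E').prod 𝓘(ℂ, W)) (r x) (f := fun y => (f x, y)) ht
    (mdifferentiableAt_const.prodMk mdifferentiableAt_id)
    ((mfderiv 𝓘(ℂ, E) 𝓘(ℂ, W) r x : E →L[ℂ] W) v)
  rw [mfderiv_prodMk hf hr] at h1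
  have h5 : (mfderiv 𝓘(ℂ, W) (𝓘(ℂ, E').prod 𝓘(ℂ, W)) (fun y => (f x, y)) (r x)
      : W →L[ℂ] E' × W) = ContinuousLinearMap.inr ℂ E' W := mfderiv_prod_right
  have h6 := congrArg (fun T : W →L[ℂ] E' × W => (mfderiv (𝓘(ℂ, E').prod 𝓘(ℂ, W)) 𝓘(ℂ, E)
    (fun z : N × W => Θ z.1 z.2) (f x, r x) : E' × W →L[ℂ] E)
      (T ((mfderiv 𝓘(ℂ, E) 𝓘(ℂ, W) r x : E →L[ℂ] W) v))) h5
  have h4 := congrArg (fun w : E' => (mfderiv (𝓘(ℂ, E').prod 𝓘(ℂ, W)) 𝓘(ℂ, E)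
    (fun z : N × W => Θ z.1 z.2) (f x, r x) : E' × W →L[ℂ] E)
      (w, (mfderiv 𝓘(ℂ, E) 𝓘(ℂ, W) r x : E →L[ℂ] W) v)) hv
  exact (h3.trans h6).trans (h4.symm.trans (h1.symm.trans (congrArg (fun T : E →L[ℂ] E => T v) h2)))

end IsLocalTrivialization

end Submersion

/-! ### Homogeneous spaces -/

section HomogeneousSpace

variable {E : Type*} [NormedAddCommGroup E] [NormedSpace ℂ E]
  {G : Type*} [TopologicalSpace G] [ChartedSpace E G] [Group G] [LieGroup 𝓘(ℂ, E) ω G]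
  {U : Subgroup G} {E' : Type*} [NormedAddCommGroup E'] [NormedSpace ℂ E']
  [ChartedSpace E' (G ⧸ U)]

theorem Manifold.IsSubmersion.mdifferentiable_mk
    (hp : Manifold.IsSubmersion 𝓘(ℂ, E) 𝓘(ℂ, E') ω (fun g : G => (g : G ⧸ U))) :
    MDifferentiable 𝓘(ℂ, E) 𝓘(ℂ, E') (fun g : G => (g : G ⧸ U)) := by
  have := (inferInstance : LieGroup 𝓘(ℂ, E) ω G).toIsManifold
  exact hp.contMDiff.mdifferentiable (by simp)

omit [LieGroup 𝓘(ℂ, E) ω G] in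
theorem projDeriv_one_apply
    (h : MDifferentiableAt 𝓘(ℂ, E) 𝓘(ℂ, E') (fun g : G => (g : G ⧸ U)) 1)
    (a : GroupLieAlgebra 𝓘(ℂ, E) G) :
    (projDeriv E' U 1 a : E') = fderiv ℂ (fun y => extChartAt 𝓘(ℂ, E') ((1 : G) : G ⧸ U)
      (idParam E G y : G ⧸ U)) (idCoord E G) (lieCoord a) := by
  have : (mfderiv 𝓘(ℂ, E) 𝓘(ℂ, E') (fun g : G => (g : G ⧸ U)) 1 : E →L[ℂ] E')
      = fderiv ℂ (fun y => extChartAt 𝓘(ℂ, E') ((1 : G) : G ⧸ U)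
      (idParam E G y : G ⧸ U)) (idCoord E G) := by
    have key : fderivWithin ℂ (fun y => extChartAt 𝓘(ℂ, E') ((1 : G) : G ⧸ U)
          (idParam E G y : G ⧸ U)) (Set.range 𝓘(ℂ, E)) (idCoord E G)
        = fderiv ℂ (fun y => extChartAt 𝓘(ℂ, E') ((1 : G) : G ⧸ U)
          (idParam E G y : G ⧸ U)) (idCoord E G) := by
      simp only [modelWithCornersSelf_coe, Set.range_id, fderivWithin_univ]
    exact h.mfderiv.trans key
  exact congrArg (fun T : E →L[ℂ] E' => T (lieCoord a)) this

variable [IsManifold 𝓘(ℂ, E') ω (G ⧸ U)]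

theorem Manifold.IsSubmersion.contMDiffAt_quotient_iff
    (hp : Manifold.IsSubmersion 𝓘(ℂ, E) 𝓘(ℂ, E') ω (fun g : G => (g : G ⧸ U)))
    {E₁ : Type*} [NormedAddCommGroup E₁] [NormedSpace ℂ E₁] {N₁ : Type*} [TopologicalSpace N₁]
    [ChartedSpace E₁ N₁] {f : G ⧸ U → N₁} {g : G} :
    ContMDiffAt 𝓘(ℂ, E) 𝓘(ℂ, E₁) ω (fun k : G => f (k : G ⧸ U)) g ↔
      ContMDiffAt 𝓘(ℂ, E') 𝓘(ℂ, E₁) ω f (g : G ⧸ U) := by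
  have := (inferInstance : LieGroup 𝓘(ℂ, E) ω G).toIsManifold
  constructor
  · intro h
    obtain ⟨Θ, r, hΘ⟩ := (hp.isSubmersionAt g).exists_isLocalTrivialization
    exact hΘ.contMDiffAt_of_comp h
  · intro h
    exact ContMDiffAt.comp (f := fun g : G => (g : G ⧸ U)) g h hp.contMDiff.contMDiffAt

theorem Manifold.IsSubmersion.contMDiff_smul
    (hp : Manifold.IsSubmersion 𝓘(ℂ, E) 𝓘(ℂ, E') ω (fun g : G => (g : G ⧸ U))) (g : G) :
    ContMDiff 𝓘(ℂ, E') 𝓘(ℂ, E') ω (fun q : G ⧸ U => g • q) := by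
  have := (inferInstance : LieGroup 𝓘(ℂ, E) ω G).toIsManifold
  intro q
  obtain ⟨h, rfl⟩ := QuotientGroup.mk_surjective q
  refine hp.contMDiffAt_quotient_iff.1 ?_
  exact ContMDiffAt.comp (f := fun k : G => g * k) h hp.contMDiff.contMDiffAt
    contMDiff_mul_left.contMDiffAt

/-- The projection is equivariant. The lemma reduces questions about its differential at `g` to the
identity. -/
theorem Manifold.IsSubmersion.projDeriv_leftTranslation
    (hp : Manifold.IsSubmersion 𝓘(ℂ, E) 𝓘(ℂ, E') ω (fun g : G => (g : G ⧸ U))) (g : G) :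
    projDeriv E' U g ∘ₗ leftTranslation g = actionDeriv E' U g ∘ₗ projDeriv (E := E) E' U 1 := by
  ext a
  have h1 := mfderiv_comp_apply_of_eq (I' := 𝓘(ℂ, E)) (x := (1 : G)) (f := fun h : G => g * h)
    (y := g) (hp.mdifferentiable_mk g)
    ((contMDiff_mul_left (I := 𝓘(ℂ, E)) (n := ω)).contMDiffAt.mdifferentiableAt (by simp))
    (mul_one g) a
  have h2 := mfderiv_comp_apply (I' := 𝓘(ℂ, E')) (1 : G) (f := fun h : G => (h : G ⧸ U))
    ((hp.contMDiff_smul g).mdifferentiableAt (by simp)) (hp.mdifferentiable_mk 1) a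
  exact h1.symm.trans h2

theorem Manifold.IsSubmersion.actionDeriv_injective
    (hp : Manifold.IsSubmersion 𝓘(ℂ, E) 𝓘(ℂ, E') ω (fun g : G => (g : G ⧸ U))) (g : G) :
    Function.Injective (actionDeriv E' U g) := by
  rw [injective_iff_map_eq_zero]
  intro v hv
  have h1 := mfderiv_comp_apply (I' := 𝓘(ℂ, E')) ((1 : G) : G ⧸ U) (f := fun q : G ⧸ U => g • q)
    (g := fun q : G ⧸ U => g⁻¹ • q) ((hp.contMDiff_smul g⁻¹).mdifferentiableAt (by simp))
    ((hp.contMDiff_smul g).mdifferentiableAt (by simp)) v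
  have h2 : (fun q : G ⧸ U => g⁻¹ • q) ∘ (fun q : G ⧸ U => g • q) = id := by ext; simp
  rw [h2, mfderiv_id] at h1
  have h3 := congrArg (fun w : E' => (mfderiv 𝓘(ℂ, E') 𝓘(ℂ, E') (fun q : G ⧸ U => g⁻¹ • q)
    (g • ((1 : G) : G ⧸ U)) : E' →L[ℂ] E') w) hv
  exact h1.trans (h3.trans (map_zero _))

theorem Manifold.IsSubmersion.projDeriv_leftTranslation_eq_zero_iff
    (hp : Manifold.IsSubmersion 𝓘(ℂ, E) 𝓘(ℂ, E') ω (fun g : G => (g : G ⧸ U))) (g : G)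
    (a : GroupLieAlgebra 𝓘(ℂ, E) G) :
    projDeriv E' U g (leftTranslation g a) = 0 ↔ projDeriv E' U 1 a = 0 := by
  have h := LinearMap.congr_fun (hp.projDeriv_leftTranslation g) a
  rw [LinearMap.comp_apply, LinearMap.comp_apply] at h
  rw [h]
  exact map_eq_zero_iff _ (hp.actionDeriv_injective g)

theorem Manifold.IsSubmersion.projDeriv_surjective
    (hp : Manifold.IsSubmersion 𝓘(ℂ, E) 𝓘(ℂ, E') ω (fun g : G => (g : G ⧸ U))) (g : G) :
    Function.Surjective (projDeriv (E := E) E' U g) := by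
  have := (inferInstance : LieGroup 𝓘(ℂ, E) ω G).toIsManifold
  obtain ⟨Θ, r, hΘ⟩ := (hp.isSubmersionAt g).exists_isLocalTrivialization
  exact hΘ.mfderiv_surjective (hp.mdifferentiable_mk g)

/-- The fibre of the projection through the identity is `U`. A kernel vector is the velocity of a
straight line in the fibre coordinate; conversely a curve in `U` projects to a constant. -/
theorem Manifold.IsSubmersion.projDeriv_one_eq_zero_iff
    (hp : Manifold.IsSubmersion 𝓘(ℂ, E) 𝓘(ℂ, E') ω (fun g : G => (g : G ⧸ U)))
    (a : GroupLieAlgebra 𝓘(ℂ, E) G) :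
    projDeriv E' U 1 a = 0 ↔ a ∈ subgroupTangent (E := E) U := by
  have := (inferInstance : LieGroup 𝓘(ℂ, E) ω G).toIsManifold
  have hsource := isOpen_extChartAt_source (I := 𝓘(ℂ, E)) (1 : G)
  constructor
  · intro ha
    obtain ⟨Θ, r, hΘ⟩ := (hp.isSubmersionAt 1).exists_isLocalTrivialization
    let w : (hp.isSubmersionAt (1 : G)).complement := (mfderiv 𝓘(ℂ, E) 𝓘(ℂ, (hp.isSubmersionAt (1 : G)).complement) r 1 :
      E →L[ℂ] (hp.isSubmersionAt (1 : G)).complement) (lieCoord (E := E) (G := G) a)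
    have hι := hΘ.contMDiffAt_fiberInclusion
    have hline : ContinuousAt (fun t : ℝ => r 1 + (t : ℂ) • w) 0 := by fun_prop
    have h0 : r 1 + ((0 : ℝ) : ℂ) • w = r 1 := by simp
    have hmem : ∀ᶠ t : ℝ in 𝓝 0, Θ ((1 : G) : G ⧸ U) (r 1 + (t : ℂ) • w) ∈ U := by
      have := hline.eventually (p := fun y => ((Θ ((1 : G) : G ⧸ U) y : G) : G ⧸ U)
        = ((1 : G) : G ⧸ U)) (by simpa only [h0] using hΘ.map_fiberInclusion)
      filter_upwards [this] with t ht
      rw [eq_comm, QuotientGroup.eq] at ht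
      simpa using ht
    classical
    -- The trivialization is only local, whereas the curve must stay in `U` for all times; the value
    -- `1` is a harmless default away from `t = 0`.
    let γ : ℝ → G := fun t => if Θ ((1 : G) : G ⧸ U) (r 1 + (t : ℂ) • w) ∈ U then
      Θ ((1 : G) : G ⧸ U) (r 1 + (t : ℂ) • w) else 1
    have hγ : γ =ᶠ[𝓝 0] fun t : ℝ => Θ ((1 : G) : G ⧸ U) (r 1 + (t : ℂ) • w) := by
      filter_upwards [hmem] with t ht
      simp only [γ, if_pos ht]
    have hγ0 : γ 0 = 1 := by
      rw [hγ.self_of_nhds]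
      simpa only [h0] using hΘ.total_fiber_self
    have hcomp : ContDiffAt ℂ ω (fun y => extChartAt 𝓘(ℂ, E) (1 : G) (Θ ((1 : G) : G ⧸ U) y))
        (r 1) := by
      have h1 : ContMDiffAt 𝓘(ℂ, E) 𝓘(ℂ, E) ω (extChartAt 𝓘(ℂ, E) (1 : G))
          (Θ ((1 : G) : G ⧸ U) (r 1)) := by
        rw [hΘ.total_fiber_self]
        exact contMDiffAt_extChartAt
      exact (ContMDiffAt.comp (f := fun y => Θ ((1 : G) : G ⧸ U) y) (r 1) h1 hι).contDiffAt
    refine ⟨γ, hγ0, fun t => ?_, ?_, ?_⟩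
    · by_cases ht : Θ ((1 : G) : G ⧸ U) (r 1 + (t : ℂ) • w) ∈ U
      · simpa only [γ, if_pos ht] using ht
      · simpa only [γ, if_neg ht] using one_mem U
    · refine ContinuousAt.congr ?_ hγ.symm
      refine ContinuousAt.comp (f := fun t : ℝ => r 1 + (t : ℂ) • w) ?_ hline
      rw [h0]
      exact hι.continuousAt
    · have h1 : (fun t => extChartAt 𝓘(ℂ, E) (1 : G) (γ t)) =ᶠ[𝓝 0]
          fun t : ℝ => extChartAt 𝓘(ℂ, E) (1 : G) (Θ ((1 : G) : G ⧸ U) (r 1 + (t : ℂ) • w)) := by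
        filter_upwards [hγ] with t ht
        rw [ht]
      refine HasDerivAt.congr_of_eventuallyEq ?_ h1
      have h2 : HasDerivAt (fun t : ℝ => r 1 + (t : ℂ) • w) w 0 := by
        simpa using (((hasDerivAt_id (0 : ℝ)).ofReal_comp).smul_const w).const_add (r 1)
      have h3 := (hcomp.differentiableAt (by simp)).hasFDerivAt
      rw [← h0] at h3
      have h4 := (h3.restrictScalars ℝ).comp_hasDerivAt (0 : ℝ) h2
      rw [h0] at h4
      have h5 := mfderiv_comp_apply_of_eq (I' := 𝓘(ℂ, E)) (x := r 1)
        (f := fun y => Θ ((1 : G) : G ⧸ U) y) (y := (1 : G)) (g := extChartAt 𝓘(ℂ, E) (1 : G))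
        ((contMDiffAt_extChartAt (n := ω)).mdifferentiableAt (by simp))
        (hι.mdifferentiableAt (by simp)) hΘ.total_fiber_self w
      rw [mfderiv_eq_fderiv] at h5
      have h6 := hΘ.mfderiv_fiberInclusion_of_mem_ker (hp.mdifferentiable_mk 1) ha
      have h7 := mfderiv_extChartAt_one (E := E) (G := G) a
      have h8 := congrArg (fun x : E => (mfderiv 𝓘(ℂ, E) 𝓘(ℂ, E) (extChartAt 𝓘(ℂ, E) (1 : G)) 1 :
        E →L[ℂ] E) x) h6
      exact h4.congr_deriv (h5.trans (h8.trans h7))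
  · rintro ⟨γ, h0, hU, hc, hd⟩
    have h1 : ContMDiffAt 𝓘(ℂ, E') 𝓘(ℂ, E') ω (extChartAt 𝓘(ℂ, E') ((1 : G) : G ⧸ U))
        ((idParam E G (idCoord E G) : G) : G ⧸ U) := by
      rw [idParam_idCoord]
      exact contMDiffAt_extChartAt
    have h2 : ContMDiffAt 𝓘(ℂ, E) 𝓘(ℂ, E') ω (fun y => ((idParam E G y : G) : G ⧸ U))
        (idCoord E G) :=
      ContMDiffAt.comp (f := idParam E G) _ hp.contMDiff.contMDiffAt contMDiffAt_idParam
    have hk := ((ContMDiffAt.comp (f := fun y => ((idParam E G y : G) : G ⧸ U)) _ h1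
      h2).contDiffAt.differentiableAt (by simp)).hasFDerivAt
    have h3 : idCoord E G = extChartAt 𝓘(ℂ, E) (1 : G) (γ 0) := by
      rw [h0]
      rfl
    rw [h3] at hk
    have h4 := (hk.restrictScalars ℝ).comp_hasDerivAt (0 : ℝ) hd
    have h5 : (extChartAt 𝓘(ℂ, E') ((1 : G) : G ⧸ U) ∘ (fun y => ((idParam E G y : G) : G ⧸ U))) ∘
        (fun t => extChartAt 𝓘(ℂ, E) (1 : G) (γ t)) =ᶠ[𝓝 0]
        fun _ => extChartAt 𝓘(ℂ, E') ((1 : G) : G ⧸ U) ((1 : G) : G ⧸ U) := by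
      filter_upwards [hc.eventually (hsource.mem_nhds (by simp [h0]))] with t ht
      have h6 : ((γ t : G) : G ⧸ U) = ((1 : G) : G ⧸ U) := by
        rw [eq_comm, QuotientGroup.eq]
        simpa using hU t
      simp only [Function.comp_apply, idParam]
      rw [(extChartAt 𝓘(ℂ, E) (1 : G)).left_inv ht, h6]
    have h7 := h4.unique ((hasDerivAt_const (0 : ℝ) _).congr_of_eventuallyEq h5)
    rw [← h3] at h7
    exact (projDeriv_one_apply (hp.mdifferentiable_mk 1) a).trans h7

end HomogeneousSpace

/-! ### Brackets defined by invariant tensors -/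

section InvariantBrackets

variable {E : Type*} [NormedAddCommGroup E] [NormedSpace ℂ E]
  {G : Type*} [TopologicalSpace G] [ChartedSpace E G] [Group G]

/-- The bracket of functions defined by a tensor `t` and a family of derivations. -/
noncomputable def derBracket (A : (G → ℂ) → G → GroupLieAlgebra 𝓘(ℂ, E) G →ₗ[ℂ] ℂ)
    (t : GroupLieAlgebra 𝓘(ℂ, E) G ⊗[ℂ] GroupLieAlgebra 𝓘(ℂ, E) G) (F H : G → ℂ) (g : G) : ℂ :=
  pair (A F g) (A H g) t

/-- The derivative along the infinitesimal generators of a left action. -/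
noncomputable def nrder (F : G → ℂ) (g : G) : GroupLieAlgebra 𝓘(ℂ, E) G →ₗ[ℂ] ℂ := -rder F g

theorem pair_nrder (F H : G → ℂ) (g : G)
    (t : GroupLieAlgebra 𝓘(ℂ, E) G ⊗[ℂ] GroupLieAlgebra 𝓘(ℂ, E) G) :
    pair (nrder F g) (nrder H g) t = pair (rder F g) (rder H g) t := by
  rw [nrder, nrder, ← neg_one_smul ℂ (rder F g), ← neg_one_smul ℂ (rder H g), pair_smul_left,
    pair_smul_right, smul_smul]
  simp

variable [LieGroup 𝓘(ℂ, E) ω G]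

/-- `A F g a` is the derivative at `g` of `F` along a vector field depending linearly on `a`. -/
structure IsDerivationFamily (A : (G → ℂ) → G → GroupLieAlgebra 𝓘(ℂ, E) G →ₗ[ℂ] ℂ) : Prop where
  contMDiffAt : ∀ {F g}, ContMDiffAt 𝓘(ℂ, E) 𝓘(ℂ, ℂ) ω F g →
    ∀ a, ContMDiffAt 𝓘(ℂ, E) 𝓘(ℂ, ℂ) ω (fun k => A F k a) g
  mul : ∀ {F H g}, ContMDiffAt 𝓘(ℂ, E) 𝓘(ℂ, ℂ) ω F g → ContMDiffAt 𝓘(ℂ, E) 𝓘(ℂ, ℂ) ω H g →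
    ∀ a, A (fun k => F k * H k) g a = A F g a * H g + F g * A H g a
  add : ∀ {F H g}, ContMDiffAt 𝓘(ℂ, E) 𝓘(ℂ, ℂ) ω F g → ContMDiffAt 𝓘(ℂ, E) 𝓘(ℂ, ℂ) ω H g →
    A (fun k => F k + H k) g = A F g + A H g
  const_mul : ∀ {F g}, ContMDiffAt 𝓘(ℂ, E) 𝓘(ℂ, ℂ) ω F g → ∀ c : ℂ,
    A (fun k => c * F k) g = c • A F g

theorem isDerivationFamily_lder : IsDerivationFamily (lder (E := E) (G := G)) :=
  ⟨contMDiffAt_lder, lder_mul, lder_add, lder_const_mul⟩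

theorem isDerivationFamily_nrder : IsDerivationFamily (nrder (E := E) (G := G)) where
  contMDiffAt hF a := (contMDiffAt_rder hF a).neg
  mul hF hH a := by
    simp only [nrder, LinearMap.neg_apply, rder_mul hF hH]
    ring
  add hF hH := by
    simp only [nrder, rder_add hF hH, neg_add]
  const_mul hF c := by
    simp only [nrder, rder_const_mul hF, smul_neg]

/-- The sign in `nrder` gives the same commutator relation as for `lder`, so one multilinear Jacobi
computation covers both families. -/
theorem nrder_nrder_sub {F : G → ℂ} {g : G} (hF : ContMDiffAt 𝓘(ℂ, E) 𝓘(ℂ, ℂ) ω F g)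
    (a b : GroupLieAlgebra 𝓘(ℂ, E) G) :
    nrder (fun k => nrder F k b) g a - nrder (fun k => nrder F k a) g b = nrder F g ⁅a, b⁆ := by
  have h : ∀ x y : GroupLieAlgebra 𝓘(ℂ, E) G,
      nrder (fun k => nrder F k x) g y = rder (fun k => rder F k x) g y := fun x y => by
    have e : (fun k => nrder F k x) = fun k => -1 * rder F k x := by
      ext k
      simp [nrder]
    rw [e, nrder, rder_const_mul (contMDiffAt_rder hF x)]
    simp
  rw [h, h, rder_rder_sub hF]
  rfl

theorem nrder_lder_comm {F : G → ℂ} {g : G} (hF : ContMDiffAt 𝓘(ℂ, E) 𝓘(ℂ, ℂ) ω F g)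
    (a b : GroupLieAlgebra 𝓘(ℂ, E) G) :
    nrder (fun k => lder F k b) g a = lder (fun k => nrder F k a) g b := by
  have e : (fun k => nrder F k a) = fun k => -1 * rder F k a := by
    ext k
    simp [nrder]
  rw [e, lder_const_mul (contMDiffAt_rder hF a), nrder, LinearMap.neg_apply, LinearMap.smul_apply,
    lder_rder_comm hF]
  simp

namespace IsDerivationFamily

variable {A A' : (G → ℂ) → G → GroupLieAlgebra 𝓘(ℂ, E) G →ₗ[ℂ] ℂ} {F H K : G → ℂ} {g : G}

/-- The second derivatives of a function at a point. -/
noncomputable def hess (hA : IsDerivationFamily A) (hA' : IsDerivationFamily A')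
    (hF : ContMDiffAt 𝓘(ℂ, E) 𝓘(ℂ, ℂ) ω F g) :
    GroupLieAlgebra 𝓘(ℂ, E) G →ₗ[ℂ] GroupLieAlgebra 𝓘(ℂ, E) G →ₗ[ℂ] ℂ :=
  LinearMap.flip
    { toFun := fun b => A (fun k => A' F k b) g
      map_add' := fun b c => by
        simp only [map_add]
        exact hA.add (hA'.contMDiffAt hF b) (hA'.contMDiffAt hF c)
      map_smul' := fun c b => by
        simp only [map_smul, smul_eq_mul, RingHom.id_apply]
        exact hA.const_mul (hA'.contMDiffAt hF b) c }

omit [LieGroup 𝓘(ℂ, E) ω G] in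
theorem hess_apply (hA : IsDerivationFamily A) (hA' : IsDerivationFamily A')
    (hF : ContMDiffAt 𝓘(ℂ, E) 𝓘(ℂ, ℂ) ω F g) (a b : GroupLieAlgebra 𝓘(ℂ, E) G) :
    hA.hess hA' hF a b = A (fun k => A' F k b) g a := rfl

omit [LieGroup 𝓘(ℂ, E) ω G] in
theorem contMDiffAt_derBracket (hA : IsDerivationFamily A)
    (hF : ContMDiffAt 𝓘(ℂ, E) 𝓘(ℂ, ℂ) ω F g) (hH : ContMDiffAt 𝓘(ℂ, E) 𝓘(ℂ, ℂ) ω H g)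
    (t : GroupLieAlgebra 𝓘(ℂ, E) G ⊗[ℂ] GroupLieAlgebra 𝓘(ℂ, E) G) :
    ContMDiffAt 𝓘(ℂ, E) 𝓘(ℂ, ℂ) ω (derBracket A t F H) g := by
  unfold derBracket
  induction t with
  | zero => simpa using contMDiffAt_const
  | add s t hs ht =>
    simp only [map_add]
    exact hs.add ht
  | tmul x y =>
    simp only [pair_tmul]
    exact (hA.contMDiffAt hF x).mul (hA.contMDiffAt hH y)

omit [LieGroup 𝓘(ℂ, E) ω G] in
theorem apply_derBracket (hA : IsDerivationFamily A) (hA' : IsDerivationFamily A')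
    (hF : ContMDiffAt 𝓘(ℂ, E) 𝓘(ℂ, ℂ) ω F g) (hH : ContMDiffAt 𝓘(ℂ, E) 𝓘(ℂ, ℂ) ω H g)
    (t : GroupLieAlgebra 𝓘(ℂ, E) G ⊗[ℂ] GroupLieAlgebra 𝓘(ℂ, E) G) :
    A (derBracket A' t F H) g
      = pairDeriv (hA.hess hA' hF) (A' H g) (A' F g) (hA.hess hA' hH) t := by
  induction t with
  | zero =>
    have h := hA.const_mul (F := fun _ => (0 : ℂ)) (g := g) contMDiffAt_const 0
    -- An abstract family has no prescribed value on the zero function; writing it as a multiple by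
    -- `0` lets `const_mul` supply it.
    have e : derBracket A' 0 F H = fun k => 0 * (fun _ => (0 : ℂ)) k := by
      ext k
      simp [derBracket]
    rw [pairDeriv_zero, e, h, zero_smul]
  | add s t hs ht =>
    have e : derBracket A' (s + t) F H
        = fun k => derBracket A' s F H k + derBracket A' t F H k := by
      ext k
      simp only [derBracket, map_add]
    rw [pairDeriv_add, e, hA.add (hA'.contMDiffAt_derBracket hF hH s)
      (hA'.contMDiffAt_derBracket hF hH t), hs, ht]
  | tmul x y =>
    have e : derBracket A' (x ⊗ₜ y) F H = fun k => A' F k x * A' H k y := by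
      ext k
      simp only [derBracket, pair_tmul]
    ext a
    rw [e, hA.mul (hA'.contMDiffAt hF x) (hA'.contMDiffAt hH y), pairDeriv_apply, pair_tmul,
      pair_tmul, hess_apply, hess_apply]

omit [LieGroup 𝓘(ℂ, E) ω G] in
theorem sum_derBracket_derBracket (hA : IsDerivationFamily A) (hA' : IsDerivationFamily A')
    (hF : ContMDiffAt 𝓘(ℂ, E) 𝓘(ℂ, ℂ) ω F g) (hH : ContMDiffAt 𝓘(ℂ, E) 𝓘(ℂ, ℂ) ω H g)
    (hK : ContMDiffAt 𝓘(ℂ, E) 𝓘(ℂ, ℂ) ω K g)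
    (s t : GroupLieAlgebra 𝓘(ℂ, E) G ⊗[ℂ] GroupLieAlgebra 𝓘(ℂ, E) G) :
    derBracket A s F (derBracket A' t H K) g + derBracket A s H (derBracket A' t K F) g
        + derBracket A s K (derBracket A' t F H) g
      = cyclicPair (A F g) (A H g) (A K g) (A' F g) (A' H g) (A' K g) (hA.hess hA' hF)
        (hA.hess hA' hH) (hA.hess hA' hK) s t := by
  simp only [cyclicPair, iterPair, derBracket]
  rw [← hA.apply_derBracket hA' hF hH, ← hA.apply_derBracket hA' hH hK,
    ← hA.apply_derBracket hA' hK hF]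

omit [LieGroup 𝓘(ℂ, E) ω G] in
theorem derBracket_sub_right (hA : IsDerivationFamily A)
    (hF : ContMDiffAt 𝓘(ℂ, E) 𝓘(ℂ, ℂ) ω F g) (hH : ContMDiffAt 𝓘(ℂ, E) 𝓘(ℂ, ℂ) ω H g)
    (s : GroupLieAlgebra 𝓘(ℂ, E) G ⊗[ℂ] GroupLieAlgebra 𝓘(ℂ, E) G) :
    derBracket A s K (fun k => F k - H k) g = derBracket A s K F g - derBracket A s K H g := by
  have e : (fun k => F k - H k) = fun k => F k + (fun k => -1 * H k) k := by
    ext k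
    ring
  have h : ContMDiffAt 𝓘(ℂ, E) 𝓘(ℂ, ℂ) ω (fun k => -1 * H k) g := contMDiffAt_const.mul hH
  rw [derBracket, e, hA.add hF h, hA.const_mul hH, pair_add_right, pair_smul_right]
  simp [derBracket, sub_eq_add_neg]

end IsDerivationFamily

/-- The Jacobi sum of the difference of a left and a right invariant bracket. -/
theorem sum_bracket_bracket_eq [FiniteDimensional ℂ E] {F H K : G → ℂ} {g : G} (hF : ContMDiffAt 𝓘(ℂ, E) 𝓘(ℂ, ℂ) ω F g)
    (hH : ContMDiffAt 𝓘(ℂ, E) 𝓘(ℂ, ℂ) ω H g) (hK : ContMDiffAt 𝓘(ℂ, E) 𝓘(ℂ, ℂ) ω K g)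
    {s t : GroupLieAlgebra 𝓘(ℂ, E) G ⊗[ℂ] GroupLieAlgebra 𝓘(ℂ, E) G} (hs : IsSkew s)
    (ht : IsSkew t) {B : (G → ℂ) → (G → ℂ) → G → ℂ}
    (hB : B = fun F H k => derBracket lder s F H k - derBracket nrder t F H k) :
    B F (B H K) g + B H (B K F) g + B K (B F H) g
      = pair3 (lder (E := E) F g) (lder H g) (lder K g) (CYB s)
        + pair3 (nrder (E := E) F g) (nrder H g) (nrder K g) (CYB t) := by
  have hl := isDerivationFamily_lder (E := E) (G := G)
  have hr := isDerivationFamily_nrder (E := E) (G := G)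
  have expand : ∀ {X Y Z : G → ℂ}, ContMDiffAt 𝓘(ℂ, E) 𝓘(ℂ, ℂ) ω Y g →
      ContMDiffAt 𝓘(ℂ, E) 𝓘(ℂ, ℂ) ω Z g → B X (B Y Z) g =
        (derBracket lder s X (derBracket lder s Y Z) g
          - derBracket lder s X (derBracket nrder t Y Z) g)
        - (derBracket nrder t X (derBracket lder s Y Z) g
          - derBracket nrder t X (derBracket nrder t Y Z) g) := by
    intro X Y Z hY hZ
    rw [hB]
    beta_reduce
    rw [hl.derBracket_sub_right (hl.contMDiffAt_derBracket hY hZ s)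
        (hr.contMDiffAt_derBracket hY hZ t),
      hr.derBracket_sub_right (hl.contMDiffAt_derBracket hY hZ s)
        (hr.contMDiffAt_derBracket hY hZ t)]
  rw [expand hH hK, expand hK hF, expand hF hH]
  have h1 := hl.sum_derBracket_derBracket hl hF hH hK s s
  have h2 := hr.sum_derBracket_derBracket hr hF hH hK t t
  have h3 := hl.sum_derBracket_derBracket hr hF hH hK s t
  have h4 := hr.sum_derBracket_derBracket hl hF hH hK t s
  have h1' := h1.trans (cyclicPair_eq_CYB (L := GroupLieAlgebra 𝓘(ℂ, E) G) (d₁ := lder F g)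
    (d₂ := lder H g) (d₃ := lder K g) (Q₁ := hl.hess hl hF) (Q₂ := hl.hess hl hH)
    (Q₃ := hl.hess hl hK) (lder_lder_sub hF) (lder_lder_sub hH) (lder_lder_sub hK) hs)
  have h2' := h2.trans (cyclicPair_eq_CYB (L := GroupLieAlgebra 𝓘(ℂ, E) G) (d₁ := nrder F g)
    (d₂ := nrder H g) (d₃ := nrder K g) (Q₁ := hr.hess hr hF) (Q₂ := hr.hess hr hH)
    (Q₃ := hr.hess hr hK) (nrder_nrder_sub hF) (nrder_nrder_sub hH) (nrder_nrder_sub hK) ht)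
  -- Commutation of left and right derivatives says that the two mixed second derivatives are
  -- transposes of each other, as `cyclicPair_mixed` requires.
  have hflip : ∀ {X : G → ℂ} (hX : ContMDiffAt 𝓘(ℂ, E) 𝓘(ℂ, ℂ) ω X g),
      hr.hess hl hX = (hl.hess hr hX).flip := fun hX => by
    ext a b
    exact nrder_lder_comm hX a b
  rw [hflip hF, hflip hH, hflip hK] at h4
  have h5 := cyclicPair_mixed (d₁ := lder F g) (d₂ := lder H g) (d₃ := lder K g)
    (e₁ := nrder F g) (e₂ := nrder H g) (e₃ := nrder K g) (M₁ := hl.hess hr hF)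
    (M₂ := hl.hess hr hH) (M₃ := hl.hess hr hK) hs ht
  rw [← h3, ← h4] at h5
  linear_combination h1' + h2' - h5

end InvariantBrackets

/-! ### Invariance under a subgroup and descent to the homogeneous space -/

section Descent

variable {E : Type*} [NormedAddCommGroup E] [NormedSpace ℂ E]
  {G : Type*} [TopologicalSpace G] [ChartedSpace E G] [Group G] [LieGroup 𝓘(ℂ, E) ω G]
  {U : Subgroup G} {E' : Type*} [NormedAddCommGroup E'] [NormedSpace ℂ E']
  [ChartedSpace E' (G ⧸ U)]

theorem Manifold.IsSubmersion.differentialAt_comp_projDeriv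
    (hp : Manifold.IsSubmersion 𝓘(ℂ, E) 𝓘(ℂ, E') ω (fun g : G => (g : G ⧸ U)))
    {f : G ⧸ U → ℂ} {g : G} (hf : MDifferentiableAt 𝓘(ℂ, E') 𝓘(ℂ, ℂ) f (g : G ⧸ U)) :
    differentialAt E' f (g : G ⧸ U) ∘ₗ projDeriv E' U g
      = differentialAt E (fun k : G => f (k : G ⧸ U)) g := by
  ext v
  exact (mfderiv_comp_apply (I' := 𝓘(ℂ, E')) g (f := fun k : G => (k : G ⧸ U)) hf
    (hp.mdifferentiable_mk g) v).symm

theorem Manifold.IsSubmersion.lder_comp_mk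
    (hp : Manifold.IsSubmersion 𝓘(ℂ, E) 𝓘(ℂ, E') ω (fun g : G => (g : G ⧸ U)))
    {f : G ⧸ U → ℂ} {g : G} (hf : MDifferentiableAt 𝓘(ℂ, E') 𝓘(ℂ, ℂ) f (g : G ⧸ U)) :
    lder (E := E) (fun k : G => f (k : G ⧸ U)) g
      = differentialAt E' f (g : G ⧸ U) ∘ₗ projDeriv E' U g ∘ₗ leftTranslation g := by
  rw [← LinearMap.comp_assoc, hp.differentialAt_comp_projDeriv hf,
    differentialAt_leftTranslation]
  exact MDifferentiableAt.comp (I' := 𝓘(ℂ, E')) g (f := fun k : G => (k : G ⧸ U)) hf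
    (hp.mdifferentiable_mk g)

theorem Manifold.IsSubmersion.rder_comp_mk
    (hp : Manifold.IsSubmersion 𝓘(ℂ, E) 𝓘(ℂ, E') ω (fun g : G => (g : G ⧸ U)))
    {f : G ⧸ U → ℂ} {g : G} (hf : MDifferentiableAt 𝓘(ℂ, E') 𝓘(ℂ, ℂ) f (g : G ⧸ U)) :
    rder (E := E) (fun k : G => f (k : G ⧸ U)) g
      = differentialAt E' f (g : G ⧸ U) ∘ₗ projDeriv E' U g ∘ₗ rightTranslation g := by
  rw [← LinearMap.comp_assoc, hp.differentialAt_comp_projDeriv hf,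
    differentialAt_rightTranslation]
  exact MDifferentiableAt.comp (I' := 𝓘(ℂ, E')) g (f := fun k : G => (k : G ⧸ U)) hf
    (hp.mdifferentiable_mk g)

variable [IsManifold 𝓘(ℂ, E') ω (G ⧸ U)]

/-- By equivariance of the projection, translating the projected value of `β` is the same as
projecting its left invariant field, so `β` joins `ρ` in the left invariant part. -/
theorem Manifold.IsSubmersion.pair_push
    (hp : Manifold.IsSubmersion 𝓘(ℂ, E) 𝓘(ℂ, E') ω (fun g : G => (g : G ⧸ U)))
    {f h : G ⧸ U → ℂ} {g : G} (hf : MDifferentiableAt 𝓘(ℂ, E') 𝓘(ℂ, ℂ) f (g : G ⧸ U))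
    (hh : MDifferentiableAt 𝓘(ℂ, E') 𝓘(ℂ, ℂ) h (g : G ⧸ U))
    (ρ β : GroupLieAlgebra 𝓘(ℂ, E) G ⊗[ℂ] GroupLieAlgebra 𝓘(ℂ, E) G) :
    pair (differentialAt E' f (g : G ⧸ U)) (differentialAt E' h (g : G ⧸ U))
        (actionPush E' U g (projPush E' U 1 β) + projPush E' U g (groupBivector ρ g))
      = pair (lder (E := E) (fun k : G => f (k : G ⧸ U)) g) (lder (fun k : G => h (k : G ⧸ U)) g) (ρ + β)
        - pair (rder (E := E) (fun k : G => f (k : G ⧸ U)) g) (rder (fun k : G => h (k : G ⧸ U)) g) ρ := by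
  have h1 : actionPush E' U g (projPush E' U 1 β)
      = TensorProduct.map (projDeriv E' U g ∘ₗ leftTranslation g)
        (projDeriv E' U g ∘ₗ leftTranslation g) β := by
    rw [hp.projDeriv_leftTranslation, TensorProduct.map_comp]
    rfl
  have h2 : projPush E' U g (groupBivector ρ g)
      = TensorProduct.map (projDeriv E' U g ∘ₗ leftTranslation g)
          (projDeriv E' U g ∘ₗ leftTranslation g) ρ
        - TensorProduct.map (projDeriv E' U g ∘ₗ rightTranslation g)
          (projDeriv E' U g ∘ₗ rightTranslation g) ρ := by
    rw [TensorProduct.map_comp, TensorProduct.map_comp, projPush, groupBivector, map_sub]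
    rfl
  rw [hp.lder_comp_mk hf, hp.lder_comp_mk hh, hp.rder_comp_mk hf, hp.rder_comp_mk hh, h1, h2,
    pair_comp, pair_comp]
  simp only [map_add, map_sub]
  ring

variable [FiniteDimensional ℂ E]

/-- The subgroup needs no manifold structure of its own: near each of its points it is a fibre of
the projection, parametrized by a local trivialization. Matrix entries have zero derivative along
the fibre, hence are locally constant on the connected `U`. -/
theorem Manifold.IsSubmersion.apply_eq_of_invariant
    (hp : Manifold.IsSubmersion 𝓘(ℂ, E) 𝓘(ℂ, E') ω (fun g : G => (g : G ⧸ U)))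
    (hU : IsPreconnected (U : Set G)) {N : Type*} [AddCommGroup N]
    [Module ℂ N] [LieRingModule (GroupLieAlgebra 𝓘(ℂ, E) G) N] {P : G → N →ₗ[ℂ] N}
    (hP : IntegratesLieAction E P) (h1 : P 1 = LinearMap.id) {n : N}
    (hn : ∀ a ∈ subgroupTangent (E := E) U, ⁅a, n⁆ = 0) {k : G} (hk : k ∈ U) : P k n = n := by
  have := (inferInstance : LieGroup 𝓘(ℂ, E) ω G).toIsManifold
  rw [← sub_eq_zero, ← Module.forall_dual_apply_eq_zero_iff ℂ]
  intro ℓ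
  set F : G → ℂ := fun k => ℓ (P k n) with hF
  have hFd : MDifferentiable 𝓘(ℂ, E) 𝓘(ℂ, ℂ) F := (hP ℓ n).1.mdifferentiable (by simp)
  have hpre : PreconnectedSpace U := Subtype.preconnectedSpace hU
  have hl : IsLocallyConstant (fun x : U => F x) := by
    rw [IsLocallyConstant.iff_eventually_eq]
    rintro ⟨x, hx⟩
    obtain ⟨Θ, r, hΘ⟩ := (hp.isSubmersionAt x).exists_isLocalTrivialization
    have hι : ∀ᶠ y in 𝓝 (r x), MDifferentiableAt 𝓘(ℂ, (hp.isSubmersionAt x).complement) 𝓘(ℂ, E)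
        (fun y => Θ (x : G ⧸ U) y) y := by
      filter_upwards [(contMDiffAt_iff_contMDiffAt_nhds (by simp)).1
        hΘ.contMDiffAt_fiberInclusion] with y hy using hy.mdifferentiableAt (by simp)
    have hz : ∀ᶠ y in 𝓝 (r x), ∀ w : (hp.isSubmersionAt x).complement,
        differentialAt E F (Θ (x : G ⧸ U) y) (mfderiv 𝓘(ℂ, (hp.isSubmersionAt x).complement)
          𝓘(ℂ, E) (fun y => Θ (x : G ⧸ U) y) y w) = 0 := by
      filter_upwards [hΘ.map_fiberInclusion.eventually_nhds, hι] with y hy hιy w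
      -- The projection is constant along the fibre, so a fibre velocity is the left translate of a
      -- vector `a` tangent to `U` at the identity.
      obtain ⟨a, ha⟩ := leftTranslation_surjective (E := E) (Θ (x : G ⧸ U) y)
        (mfderiv 𝓘(ℂ, (hp.isSubmersionAt x).complement) 𝓘(ℂ, E) (fun y => Θ (x : G ⧸ U) y) y w)
      have e1 := mfderiv_comp_apply (I' := 𝓘(ℂ, E)) y (g := fun g : G => (g : G ⧸ U))
        (hp.mdifferentiable_mk _) hιy w
      have e2 : (mfderiv 𝓘(ℂ, (hp.isSubmersionAt x).complement) 𝓘(ℂ, E')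
          ((fun g : G => (g : G ⧸ U)) ∘ fun y => Θ (x : G ⧸ U) y) y :
          (hp.isSubmersionAt x).complement →L[ℂ] E') = 0 :=
        (Filter.EventuallyEq.mfderiv_eq (f := fun _ => (x : G ⧸ U)) hy).trans mfderiv_const
      have e3 : projDeriv E' U (Θ (x : G ⧸ U) y) (leftTranslation (Θ (x : G ⧸ U) y) a) = 0 := by
        rw [ha]
        exact e1.symm.trans (congrArg
          (fun T : (hp.isSubmersionAt x).complement →L[ℂ] E' => T w) e2)
      rw [hp.projDeriv_leftTranslation_eq_zero_iff, hp.projDeriv_one_eq_zero_iff] at e3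
      rw [← ha, ← LinearMap.comp_apply, differentialAt_leftTranslation (hFd _), hF, (hP ℓ n).2,
        hn a e3, map_zero, map_zero]
    have hev := eventually_comp_eq_of_mfderiv (F := F) hι hFd hz
    have hev' := hΘ.contMDiffAt_fiber.continuousAt.eventually hev
    have hev2 := (continuousAt_subtype_val (x := (⟨x, hx⟩ : U))).eventually
      (hev'.and hΘ.total_fiber)
    filter_upwards [hev2] with z hz
    have hzx : ((z : G) : G ⧸ U) = (x : G ⧸ U) := by
      rw [QuotientGroup.eq]
      exact mul_mem (inv_mem z.2) hx
    have h2 := hz.2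
    have h3 := hz.1
    rw [hzx] at h2
    rw [h2, hΘ.total_fiber_self] at h3
    exact h3
  have h2 := hl.apply_eq_of_isPreconnected isPreconnected_univ (x := (⟨k, hk⟩ : U))
    (y := (⟨1, one_mem U⟩ : U)) trivial trivial
  have h3 : ℓ (P k n) = ℓ (P 1 n) := h2
  rw [map_sub, h3, h1, LinearMap.id_apply, sub_self]

variable {F H K : G → ℂ} {g : G}

omit [ChartedSpace E' (G ⧸ U)] [IsManifold 𝓘(ℂ, E') ω (G ⧸ U)] in
-- On a connected group an invariant tensor is fixed by Ad, which relates left derivatives to right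
-- ones.
theorem pair_lder_eq_pair_rder [ConnectedSpace G] (hF : ContMDiffAt 𝓘(ℂ, E) 𝓘(ℂ, ℂ) ω F g)
    (hH : ContMDiffAt 𝓘(ℂ, E) 𝓘(ℂ, ℂ) ω H g)
    {t : GroupLieAlgebra 𝓘(ℂ, E) G ⊗[ℂ] GroupLieAlgebra 𝓘(ℂ, E) G}
    (ht : ∀ x : GroupLieAlgebra 𝓘(ℂ, E) G, ⁅x, t⁆ = 0) :
    pair (lder F g) (lder H g) t = pair (rder F g) (rder H g) t := by
  have h := ((integratesLieAction_Ad (E := E) (G := G)).tensor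
    integratesLieAction_Ad).apply_eq_of_invariant
    (by rw [Ad_one, TensorProduct.map_id]) ht g
  have e : ∀ {X : G → ℂ}, ContMDiffAt 𝓘(ℂ, E) 𝓘(ℂ, ℂ) ω X g →
      lder (E := E) X g = rder X g ∘ₗ Ad g := fun hX => by
    ext a
    exact lder_eq_rder_Ad hX a
  rw [e hF, e hH, pair_comp, h]

omit [ChartedSpace E' (G ⧸ U)] [IsManifold 𝓘(ℂ, E') ω (G ⧸ U)] in
theorem pair3_lder_eq_pair3_rder [ConnectedSpace G] (hF : ContMDiffAt 𝓘(ℂ, E) 𝓘(ℂ, ℂ) ω F g)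
    (hH : ContMDiffAt 𝓘(ℂ, E) 𝓘(ℂ, ℂ) ω H g) (hK : ContMDiffAt 𝓘(ℂ, E) 𝓘(ℂ, ℂ) ω K g)
    {t : GroupLieAlgebra 𝓘(ℂ, E) G ⊗[ℂ] (GroupLieAlgebra 𝓘(ℂ, E) G ⊗[ℂ]
      GroupLieAlgebra 𝓘(ℂ, E) G)}
    (ht : ∀ x : GroupLieAlgebra 𝓘(ℂ, E) G, ⁅x, t⁆ = 0) :
    pair3 (lder F g) (lder H g) (lder K g) t = pair3 (rder F g) (rder H g) (rder K g) t := by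
  have h := ((integratesLieAction_Ad (E := E) (G := G)).tensor
    (integratesLieAction_Ad.tensor integratesLieAction_Ad)).apply_eq_of_invariant
    (by rw [Ad_one, TensorProduct.map_id, TensorProduct.map_id]) ht g
  have e : ∀ {X : G → ℂ}, ContMDiffAt 𝓘(ℂ, E) 𝓘(ℂ, ℂ) ω X g →
      lder (E := E) X g = rder X g ∘ₗ Ad g := fun hX => by
    ext a
    exact lder_eq_rder_Ad hX a
  rw [e hF, e hH, e hK, pair3_comp, h]

end Descent

/-! ### Tensors over the quotient by a reductive subalgebra -/

section QuotientTensors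

variable {L : Type*} [LieRing L] [LieAlgebra ℂ L] {u : LieSubalgebra ℂ L}
  {m : LieSubmodule ℂ u L} {hm : IsCompl u.toSubmodule m.toSubmodule}

theorem IsSkew.map {V W : Type*} [AddCommGroup V] [Module ℂ V] [AddCommGroup W] [Module ℂ W]
    {t : V ⊗[ℂ] V} (ht : IsSkew t) (f : V →ₗ[ℂ] W) : IsSkew (TensorProduct.map f f t) := by
  have h : ∀ t : V ⊗[ℂ] V,
      flip21 (TensorProduct.map f f t) = TensorProduct.map f f (flip21 t) := fun t => by
    induction t with
    | zero => simp [flip21]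
    | add x y hx hy => simpa [flip21] using congrArg₂ (· + ·) hx hy
    | tmul x y => simp [flip21]
  rw [IsSkew, h, ht, map_neg]

variable (u) in
/-- The projection `𝔤 → 𝔤/𝔲`, as a linear map into the quotient module. -/
noncomputable def quotProj : L →ₗ[ℂ] LieQuot u := u.toSubmodule.mkQ

theorem quotProj_surjective : Function.Surjective (quotProj u) := u.toSubmodule.mkQ_surjective

theorem quotProj_eq_zero {x : L} (hx : x ∈ u) : quotProj u x = 0 :=
  (Submodule.Quotient.mk_eq_zero u.toSubmodule).2 hx

theorem lie_quotProj (x : u) (z : L) : ⁅x, quotProj u z⁆ = quotProj u ⁅(x : L), z⁆ := rfl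

theorem complSection_mk {z : L} (hz : z ∈ m) :
    complSection u m hm (quotProj u z) = z := by
  have h : Submodule.quotientEquivOfIsCompl u.toSubmodule m.toSubmodule hm
      (Submodule.Quotient.mk ((⟨z, hz⟩ : m.toSubmodule) : L)) = ⟨z, hz⟩ :=
    Submodule.quotientEquivOfIsCompl_apply_mk_right _ _
  exact congrArg Subtype.val h

/-- Invariance of the complement enters here: every class has a representative in `m`, and
bracketing with `u` keeps it there. -/
theorem lie_complSection (x : u) (q : LieQuot u) :
    ⁅(x : L), complSection u m hm q⁆ = complSection u m hm ⁅x, q⁆ := by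
  obtain ⟨z, hz, rfl⟩ : ∃ z ∈ m, quotProj u z = q := by
    obtain ⟨y, rfl⟩ := quotProj_surjective q
    obtain ⟨a, b, h⟩ := (Submodule.codisjoint_iff_exists_add_eq.1 hm.codisjoint) y
    refine ⟨b, h.2.1, ?_⟩
    rw [← h.2.2, map_add, quotProj_eq_zero h.1, zero_add]
  rw [lie_quotProj, complSection_mk hz, complSection_mk]
  exact m.lie_mem hz

theorem lie_complLift (x : u) (b : LieQuot u ⊗[ℂ] LieQuot u) :
    ⁅(x : L), complLift u m hm b⁆ = complLift u m hm ⁅x, b⁆ := by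
  unfold complLift
  induction b with
  | zero => simp
  | add b c hb hc => rw [map_add, lie_add, hb, hc, lie_add, map_add]
  | tmul p q =>
    rw [TensorProduct.map_tmul, TensorProduct.LieModule.lie_tmul_right,
      TensorProduct.LieModule.lie_tmul_right, map_add, TensorProduct.map_tmul,
      TensorProduct.map_tmul, lie_complSection, lie_complSection]

/-- Functionals on the quotient are the functionals vanishing on `u`, and their products separate
tensors. -/
theorem toQuot3_eq_zero_iff [FiniteDimensional ℂ L] (T : L ⊗[ℂ] (L ⊗[ℂ] L)) :
    toQuot3 u T = 0 ↔ ∀ α β γ : L →ₗ[ℂ] ℂ, (∀ x ∈ u, α x = 0) → (∀ x ∈ u, β x = 0) →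
      (∀ x ∈ u, γ x = 0) → pair3 α β γ T = 0 := by
  have : FiniteDimensional ℂ (LieQuot u) := 
    Module.Finite.of_surjective (quotProj u) quotProj_surjective
  have hq : ∀ α β γ : LieQuot u →ₗ[ℂ] ℂ, pair3 (α ∘ₗ quotProj u)
      (β ∘ₗ quotProj u)
      (γ ∘ₗ quotProj u) T = pair3 α β γ (toQuot3 u T) :=
    fun α β γ => pair3_comp _ _ _ _ _ _ _
  constructor
  · intro h α β γ hα hβ hγ
    have hl : ∀ δ : L →ₗ[ℂ] ℂ, (∀ x ∈ u, δ x = 0) → ∃ δ' : LieQuot u →ₗ[ℂ] ℂ,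
        δ = δ' ∘ₗ quotProj u := fun δ hδ =>
      ⟨u.toSubmodule.liftQ δ hδ, (u.toSubmodule.liftQ_mkQ δ hδ).symm⟩
    obtain ⟨α', rfl⟩ := hl α hα
    obtain ⟨β', rfl⟩ := hl β hβ
    obtain ⟨γ', rfl⟩ := hl γ hγ
    rw [hq, h, map_zero]
  · intro h
    refine eq_zero_of_forall_pair3 fun α β γ => ?_
    have h0 : ∀ (δ : LieQuot u →ₗ[ℂ] ℂ), ∀ x ∈ u,
        (δ ∘ₗ quotProj u) x = 0 := fun δ x hx => by
      rw [LinearMap.comp_apply, quotProj_eq_zero hx, map_zero]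
    rw [← hq]
    exact h _ _ _ (h0 α) (h0 β) (h0 γ)

/-- Splitting off the symmetric part of a tensor. -/
theorem isSkew_sub_half {V : Type*} [AddCommGroup V] [Module ℂ V] (t : V ⊗[ℂ] V) :
    IsSkew (t - (2⁻¹ : ℂ) • (t + flip21 t)) := by
  have h : flip21 (t - (2⁻¹ : ℂ) • (t + flip21 t))
      = flip21 t - (2⁻¹ : ℂ) • (flip21 t + t) := by
    conv_rhs => rw [← flip21_flip21 t]
    simp only [flip21, map_sub, map_smul, map_add]
    simp
  rw [IsSkew, h]
  module

theorem IsSkew.add {V : Type*} [AddCommGroup V] [Module ℂ V] {s t : V ⊗[ℂ] V} (hs : IsSkew s)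
    (ht : IsSkew t) : IsSkew (s + t) := by
  rw [IsSkew, flip21, map_add, neg_add]
  exact congrArg₂ (· + ·) hs ht

end QuotientTensors

/-! ### Sign rules for pairings, and functions with prescribed differential -/

section Functionals

theorem pair_swap_of_isSkew {V : Type*} [AddCommGroup V] [Module ℂ V] {t : V ⊗[ℂ] V}
    (ht : IsSkew t) (α β : V →ₗ[ℂ] ℂ) : pair β α t = -pair α β t := by
  rw [← pair_flip21, ht, map_neg]

theorem pair3_neg {V : Type*} [AddCommGroup V] [Module ℂ V] (α β γ : V →ₗ[ℂ] ℂ) :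
    pair3 (-α) (-β) (-γ) = -pair3 α β γ := by
  ext x y z
  simp

variable {E : Type*} [NormedAddCommGroup E] [NormedSpace ℂ E] [FiniteDimensional ℂ E]
  {M : Type*} [TopologicalSpace M] [ChartedSpace E M]

/-- A function near `x` with a prescribed differential at `x`. -/
noncomputable def chartFun (x : M) (α : E →ₗ[ℂ] ℂ) (y : M) : ℂ :=
  LinearMap.toContinuousLinearMap α (extChartAt 𝓘(ℂ, E) x y)

theorem contMDiffOn_chartFun [IsManifold 𝓘(ℂ, E) ω M] (x : M) (α : E →ₗ[ℂ] ℂ) :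
    ContMDiffOn 𝓘(ℂ, E) 𝓘(ℂ, ℂ) ω (chartFun x α) (chartAt E x).source :=
  ContMDiff.comp_contMDiffOn (I' := 𝓘(ℂ, E))
    (ContinuousLinearMap.contMDiff (n := ω) (LinearMap.toContinuousLinearMap α))
    contMDiffOn_extChartAt

theorem contMDiffAt_chartFun [IsManifold 𝓘(ℂ, E) ω M] (x : M) (α : E →ₗ[ℂ] ℂ) :
    ContMDiffAt 𝓘(ℂ, E) 𝓘(ℂ, ℂ) ω (chartFun x α) x :=
  (contMDiffOn_chartFun x α).contMDiffAt ((chartAt E x).open_source.mem_nhds (by simp))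

theorem differentialAt_chartFun [IsManifold 𝓘(ℂ, E) ω M] (x : M) (α : E →ₗ[ℂ] ℂ) :
    (differentialAt E (chartFun x α) x : E →ₗ[ℂ] ℂ) = α := by
  have h1 := ((contMDiffAt_chartFun x α).mdifferentiableAt (by simp)).mfderiv
  have h2 : (fun y => chartFun x α ((extChartAt 𝓘(ℂ, E) x).symm y))
      =ᶠ[𝓝 (extChartAt 𝓘(ℂ, E) x x)] LinearMap.toContinuousLinearMap α := by
    filter_upwards [(isOpen_extChartAt_target (I := 𝓘(ℂ, E)) x).mem_nhds
      (mem_extChartAt_target x)] with y hy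
    rw [chartFun, (extChartAt 𝓘(ℂ, E) x).right_inv hy]
  have h3 : fderivWithin ℂ (fun y => chartFun x α ((extChartAt 𝓘(ℂ, E) x).symm y))
      (Set.range 𝓘(ℂ, E)) (extChartAt 𝓘(ℂ, E) x x) = LinearMap.toContinuousLinearMap α := by
    rw [modelWithCornersSelf_coe, Set.range_id, fderivWithin_univ, h2.fderiv_eq,
      ContinuousLinearMap.fderiv]
  have h4 : (mfderiv 𝓘(ℂ, E) 𝓘(ℂ, ℂ) (chartFun x α) x : E →L[ℂ] ℂ)
      = LinearMap.toContinuousLinearMap α := h1.trans h3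
  have h5 := congrArg ContinuousLinearMap.toLinearMap h4
  exact h5.trans (LinearMap.coe_toContinuousLinearMap α)

end Functionals

/-! ### The bracket on the homogeneous space -/

section SkewPart

/-- The symmetric part of a tensor. -/
noncomputable def symmPart {V : Type*} [AddCommGroup V] [Module ℂ V] (t : V ⊗[ℂ] V) : V ⊗[ℂ] V :=
  (2⁻¹ : ℂ) • (t + flip21 t)

/-- The skew-symmetric part of a tensor. -/
noncomputable def skewPart {V : Type*} [AddCommGroup V] [Module ℂ V] (t : V ⊗[ℂ] V) : V ⊗[ℂ] V :=
  t - symmPart t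

theorem skewPart_add_symmPart {V : Type*} [AddCommGroup V] [Module ℂ V] (t : V ⊗[ℂ] V) :
    skewPart t + symmPart t = t := sub_add_cancel _ _

theorem isSkew_skewPart {V : Type*} [AddCommGroup V] [Module ℂ V] (t : V ⊗[ℂ] V) :
    IsSkew (skewPart t) := isSkew_sub_half t

variable {L : Type*} [LieRing L] [LieAlgebra ℂ L] {ρ β : L ⊗[ℂ] L}

theorem lie_symmPart (hΩ : ∀ x : L, ⁅x, ρ + flip21 ρ⁆ = 0) (x : L) : ⁅x, symmPart ρ⁆ = 0 := by
  rw [symmPart, lie_smul, hΩ, smul_zero]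

theorem CYB_add_eq (hΩ : ∀ x : L, ⁅x, ρ + flip21 ρ⁆ = 0) (hβ : IsSkew β) :
    CYB (ρ + β) = CYB (skewPart ρ + β) + CYB (symmPart ρ) := by
  rw [← CYB_add_of_invariant ((isSkew_skewPart ρ).add hβ) (lie_symmPart hΩ), add_right_comm,
    skewPart_add_symmPart]

/-- The Yang–Baxter equation for `ρ` splits additively over its skew and symmetric parts, because
the symmetric part is invariant. -/
theorem CYB_skewPart (hΩ : ∀ x : L, ⁅x, ρ + flip21 ρ⁆ = 0) (hρ : CYB ρ = 0) :
    CYB (skewPart ρ) = -CYB (symmPart ρ) := by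
  rw [eq_neg_iff_add_eq_zero, ← CYB_add_of_invariant (isSkew_skewPart ρ) (lie_symmPart hΩ),
    skewPart_add_symmPart, hρ]

end SkewPart

/-! ### The bracket lifted to the group and its Jacobi sum -/

section HomogeneousBracket

variable {E : Type*} [NormedAddCommGroup E] [NormedSpace ℂ E] [FiniteDimensional ℂ E]
  {G : Type*} [TopologicalSpace G] [ChartedSpace E G] [Group G] [LieGroup 𝓘(ℂ, E) ω G]
  {ρ β : GroupLieAlgebra 𝓘(ℂ, E) G ⊗[ℂ] GroupLieAlgebra 𝓘(ℂ, E) G}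

/-- The bracket on `G` of the left invariant tensor field of the skew part of `ρ + β` minus the right
invariant one of the skew part of `ρ`. -/
noncomputable def liftedBracket
    (ρ β : GroupLieAlgebra 𝓘(ℂ, E) G ⊗[ℂ] GroupLieAlgebra 𝓘(ℂ, E) G) (F H : G → ℂ) (k : G) : ℂ :=
  derBracket lder (skewPart ρ + β) F H k - derBracket nrder (skewPart ρ) F H k

variable {F H K : G → ℂ} {g : G}

omit [FiniteDimensional ℂ E] in
theorem liftedBracket_congr {F' H' : G → ℂ} (hF : F =ᶠ[𝓝 g] F') (hH : H =ᶠ[𝓝 g] H') :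
    liftedBracket ρ β F H g = liftedBracket ρ β F' H' g := by
  simp only [liftedBracket, derBracket, nrder, lder_congr hF, lder_congr hH, rder_congr hF,
    rder_congr hH]

omit [FiniteDimensional ℂ E] in
theorem contMDiffAt_liftedBracket (hF : ContMDiffAt 𝓘(ℂ, E) 𝓘(ℂ, ℂ) ω F g)
    (hH : ContMDiffAt 𝓘(ℂ, E) 𝓘(ℂ, ℂ) ω H g) :
    ContMDiffAt 𝓘(ℂ, E) 𝓘(ℂ, ℂ) ω (liftedBracket ρ β F H) g :=
  (isDerivationFamily_lder.contMDiffAt_derBracket hF hH _).sub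
    (isDerivationFamily_nrder.contMDiffAt_derBracket hF hH _)

omit [FiniteDimensional ℂ E] [LieGroup 𝓘(ℂ, E) ω G] in
theorem liftedBracket_swap (hβ : IsSkew β) :
    liftedBracket ρ β H F g = -liftedBracket ρ β F H g := by
  simp only [liftedBracket, derBracket]
  rw [pair_swap_of_isSkew ((isSkew_skewPart ρ).add hβ), pair_swap_of_isSkew (isSkew_skewPart ρ)]
  ring

variable [ConnectedSpace G]

/-- The symmetric part of `ρ` gives the same left and right invariant field and drops out of the
difference. -/
theorem liftedBracket_eq (hΩ : ∀ x : GroupLieAlgebra 𝓘(ℂ, E) G, ⁅x, ρ + flip21 ρ⁆ = 0)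
    (hF : ContMDiffAt 𝓘(ℂ, E) 𝓘(ℂ, ℂ) ω F g) (hH : ContMDiffAt 𝓘(ℂ, E) 𝓘(ℂ, ℂ) ω H g) :
    liftedBracket ρ β F H g
      = pair (lder F g) (lder H g) (ρ + β) - pair (rder F g) (rder H g) ρ := by
  have h := pair_lder_eq_pair_rder hF hH (lie_symmPart hΩ)
  rw [liftedBracket, derBracket, derBracket, pair_nrder]
  simp only [skewPart, map_add, map_sub, h]
  ring

/-- The right invariant contribution is moved to the left: it equals minus `CYB (symmPart ρ)` on
three negated right derivatives. The signs cancel, and invariance replaces right derivatives by left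
ones. -/
theorem sum_liftedBracket (hρ : CYB ρ = 0)
    (hΩ : ∀ x : GroupLieAlgebra 𝓘(ℂ, E) G, ⁅x, ρ + flip21 ρ⁆ = 0) (hβ : IsSkew β)
    (hF : ContMDiffAt 𝓘(ℂ, E) 𝓘(ℂ, ℂ) ω F g) (hH : ContMDiffAt 𝓘(ℂ, E) 𝓘(ℂ, ℂ) ω H g)
    (hK : ContMDiffAt 𝓘(ℂ, E) 𝓘(ℂ, ℂ) ω K g) :
    liftedBracket ρ β F (liftedBracket ρ β H K) g + liftedBracket ρ β H (liftedBracket ρ β K F) g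
        + liftedBracket ρ β K (liftedBracket ρ β F H) g
      = pair3 (lder (E := E) F g) (lder H g) (lder K g) (CYB (ρ + β)) := by
  have h1 := sum_bracket_bracket_eq hF hH hK ((isSkew_skewPart ρ).add hβ) (isSkew_skewPart ρ)
    (B := liftedBracket ρ β) rfl
  have h2 := pair3_lder_eq_pair3_rder hF hH hK
    (fun x => lie_CYB_eq_zero (lie_symmPart hΩ x))
  have h3 : pair3 (nrder (E := E) F g) (nrder H g) (nrder K g) (CYB (skewPart ρ))
      = pair3 (lder (E := E) F g) (lder H g) (lder K g) (CYB (symmPart ρ)) := by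
    rw [CYB_skewPart hΩ hρ, map_neg, nrder, nrder, nrder, pair3_neg, LinearMap.neg_apply, neg_neg]
    exact h2.symm
  rw [h1, h3, CYB_add_eq hΩ hβ, map_add]

end HomogeneousBracket

/-! ### The bivector on the homogeneous space -/

section HomogeneousBivector

variable {E : Type*} [NormedAddCommGroup E] [NormedSpace ℂ E] [FiniteDimensional ℂ E]
  {G : Type*} [TopologicalSpace G] [ChartedSpace E G] [Group G] [LieGroup 𝓘(ℂ, E) ω G]
  [ConnectedSpace G] {U : Subgroup G} {E' : Type*} [NormedAddCommGroup E'] [NormedSpace ℂ E']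
  [ChartedSpace E' (G ⧸ U)] [IsManifold 𝓘(ℂ, E') ω (G ⧸ U)]
  {ρ β : GroupLieAlgebra 𝓘(ℂ, E) G ⊗[ℂ] GroupLieAlgebra 𝓘(ℂ, E) G}

omit [FiniteDimensional ℂ E] [ConnectedSpace G] in
theorem Manifold.IsSubmersion.contMDiffAt_comp_mk
    (hp : Manifold.IsSubmersion 𝓘(ℂ, E) 𝓘(ℂ, E') ω (fun g : G => (g : G ⧸ U)))
    {f : G ⧸ U → ℂ} {g : G} (hf : ContMDiffAt 𝓘(ℂ, E') 𝓘(ℂ, ℂ) ω f (g : G ⧸ U)) :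
    ContMDiffAt 𝓘(ℂ, E) 𝓘(ℂ, ℂ) ω (fun k : G => f (k : G ⧸ U)) g :=
  hp.contMDiffAt_quotient_iff.2 hf

omit [ConnectedSpace G] in
theorem Manifold.IsSubmersion.finiteDimensional
    (hp : Manifold.IsSubmersion 𝓘(ℂ, E) 𝓘(ℂ, E') ω (fun g : G => (g : G ⧸ U))) :
    FiniteDimensional ℂ E' := by
  have h : Function.Surjective ((projDeriv (E := E) E' U 1 : GroupLieAlgebra 𝓘(ℂ, E) G →ₗ[ℂ] E')) :=
    hp.projDeriv_surjective 1
  exact Module.Finite.of_surjective _ h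

variable (E' U ρ β) in
/-- The bivector `(L_g)_* β + p_* π_ρ(g)`, as a tensor over the model space. -/
noncomputable def pushBivector (g : G) : E' ⊗[ℂ] E' :=
  actionPush E' U g (projPush E' U 1 β) + projPush E' U g (groupBivector ρ g)

theorem Manifold.IsSubmersion.pair_pushBivector
    (hp : Manifold.IsSubmersion 𝓘(ℂ, E) 𝓘(ℂ, E') ω (fun g : G => (g : G ⧸ U)))
    (hΩ : ∀ x : GroupLieAlgebra 𝓘(ℂ, E) G, ⁅x, ρ + flip21 ρ⁆ = 0)
    {f h : G ⧸ U → ℂ} {g : G} (hf : ContMDiffAt 𝓘(ℂ, E') 𝓘(ℂ, ℂ) ω f (g : G ⧸ U))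
    (hh : ContMDiffAt 𝓘(ℂ, E') 𝓘(ℂ, ℂ) ω h (g : G ⧸ U)) :
    pair (V := E') (differentialAt E' f (g : G ⧸ U)) (differentialAt E' h (g : G ⧸ U))
        (pushBivector U E' ρ β g)
      = liftedBracket ρ β (fun k : G => f (k : G ⧸ U)) (fun k : G => h (k : G ⧸ U)) g :=
  (hp.pair_push (hf.mdifferentiableAt (by simp)) (hh.mdifferentiableAt (by simp)) ρ β).trans
    (liftedBracket_eq hΩ (hp.contMDiffAt_comp_mk hf) (hp.contMDiffAt_comp_mk hh)).symm

/-- Chart functions realize every functional on the model space as a differential, so a bivector is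
determined by its brackets. -/
theorem Manifold.IsSubmersion.pushBivector_ext
    (hp : Manifold.IsSubmersion 𝓘(ℂ, E) 𝓘(ℂ, E') ω (fun g : G => (g : G ⧸ U)))
    (hΩ : ∀ x : GroupLieAlgebra 𝓘(ℂ, E) G, ⁅x, ρ + flip21 ρ⁆ = 0) {g₁ g₂ : G}
    (hg : (g₁ : G ⧸ U) = (g₂ : G ⧸ U))
    (h : ∀ {f h : G ⧸ U → ℂ}, ContMDiffAt 𝓘(ℂ, E') 𝓘(ℂ, ℂ) ω f (g₂ : G ⧸ U) →
      ContMDiffAt 𝓘(ℂ, E') 𝓘(ℂ, ℂ) ω h (g₂ : G ⧸ U) →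
      liftedBracket ρ β (fun k : G => f (k : G ⧸ U)) (fun k : G => h (k : G ⧸ U)) g₁
        = liftedBracket ρ β (fun k : G => f (k : G ⧸ U)) (fun k : G => h (k : G ⧸ U)) g₂) :
    pushBivector U E' ρ β g₁ = pushBivector U E' ρ β g₂ := by
  have := hp.finiteDimensional
  refine eq_of_forall_pair fun α α' => ?_
  have e₂ : ∀ α : E' →ₗ[ℂ] ℂ,
      (differentialAt E' (chartFun (g₂ : G ⧸ U) α) (g₂ : G ⧸ U) : E' →ₗ[ℂ] ℂ) = α :=
    differentialAt_chartFun _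
  have e₁ : ∀ α : E' →ₗ[ℂ] ℂ,
      (differentialAt E' (chartFun (g₂ : G ⧸ U) α) (g₁ : G ⧸ U) : E' →ₗ[ℂ] ℂ) = α := fun α => by
    have h : ∀ q : G ⧸ U, q = (g₂ : G ⧸ U) →
        (differentialAt E' (chartFun (g₂ : G ⧸ U) α) q : E' →ₗ[ℂ] ℂ) = α := by
      rintro q rfl
      exact e₂ α
    exact h _ hg
  have s₂ : ∀ α : E' →ₗ[ℂ] ℂ, ContMDiffAt 𝓘(ℂ, E') 𝓘(ℂ, ℂ) ω (chartFun (g₂ : G ⧸ U) α)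
      (g₂ : G ⧸ U) := contMDiffAt_chartFun _
  have s₁ : ∀ α : E' →ₗ[ℂ] ℂ, ContMDiffAt 𝓘(ℂ, E') 𝓘(ℂ, ℂ) ω (chartFun (g₂ : G ⧸ U) α)
      (g₁ : G ⧸ U) := fun α => by
    rw [hg]
    exact s₂ α
  have h₁ := hp.pair_pushBivector (β := β) hΩ (s₁ α) (s₁ α')
  have h₂ := hp.pair_pushBivector (β := β) hΩ (s₂ α) (s₂ α')
  have k₁ := congrArg₂ (fun a b : E' →ₗ[ℂ] ℂ => pair a b (pushBivector U E' ρ β g₁)) (e₁ α) (e₁ α')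
  have k₂ := congrArg₂ (fun a b : E' →ₗ[ℂ] ℂ => pair a b (pushBivector U E' ρ β g₂)) (e₂ α) (e₂ α')
  exact k₁.symm.trans ((h₁.trans ((h (s₂ α) (s₂ α')).trans h₂.symm)).trans k₂)

theorem Manifold.IsSubmersion.pushBivector_mul_right
    (hp : Manifold.IsSubmersion 𝓘(ℂ, E) 𝓘(ℂ, E') ω (fun g : G => (g : G ⧸ U)))
    (hU : IsPreconnected (U : Set G))
    (hΩ : ∀ x : GroupLieAlgebra 𝓘(ℂ, E) G, ⁅x, ρ + flip21 ρ⁆ = 0)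
    (hu : ∀ a ∈ subgroupTangent (E := E) U, ⁅a, ρ + β⁆ = 0) (g : G) {k : G} (hk : k ∈ U) :
    pushBivector U E' ρ β (g * k) = pushBivector U E' ρ β g := by
  have hg : ((g * k : G) : G ⧸ U) = (g : G ⧸ U) := by
    rw [QuotientGroup.mk_mul_of_mem g hk]
  refine hp.pushBivector_ext hΩ hg fun {f h} hf hh => ?_
  have hAd := hp.apply_eq_of_invariant hU
    ((integratesLieAction_Ad (E := E) (G := G)).tensor integratesLieAction_Ad)
    (by rw [Ad_one, TensorProduct.map_id]) hu hk
  have inv : ∀ (f : G ⧸ U → ℂ) (x : G), f ((x * k : G) : G ⧸ U) = f (x : G ⧸ U) := fun f x => by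
    rw [QuotientGroup.mk_mul_of_mem x hk]
  have hl : ∀ {f : G ⧸ U → ℂ}, ContMDiffAt 𝓘(ℂ, E') 𝓘(ℂ, ℂ) ω f (g : G ⧸ U) →
      lder (E := E) (fun x : G => f (x : G ⧸ U)) (g * k)
        = lder (fun x : G => f (x : G ⧸ U)) g ∘ₗ Ad k := fun {f} hf => by
    ext a
    exact lder_mul_right (hp.contMDiffAt_comp_mk hf) (inv f) a
  have hr : ∀ f : G ⧸ U → ℂ, rder (E := E) (fun x : G => f (x : G ⧸ U)) (g * k)
      = rder (fun x : G => f (x : G ⧸ U)) g := fun f => rder_mul_right (inv f)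
  have tr : ∀ {f : G ⧸ U → ℂ}, ContMDiffAt 𝓘(ℂ, E') 𝓘(ℂ, ℂ) ω f (g : G ⧸ U) →
      ContMDiffAt 𝓘(ℂ, E') 𝓘(ℂ, ℂ) ω f ((g * k : G) : G ⧸ U) := fun hf => by rwa [hg]
  rw [liftedBracket_eq hΩ (hp.contMDiffAt_comp_mk (tr hf)) (hp.contMDiffAt_comp_mk (tr hh)),
    liftedBracket_eq hΩ (hp.contMDiffAt_comp_mk hf) (hp.contMDiffAt_comp_mk hh), hl hf, hl hh,
    hr, hr, pair_comp, hAd]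

/-- Skewness is not visible in the definition, as `ρ` need not be skew; it is inherited from the
lifted bracket. -/
theorem Manifold.IsSubmersion.isSkew_pushBivector
    (hp : Manifold.IsSubmersion 𝓘(ℂ, E) 𝓘(ℂ, E') ω (fun g : G => (g : G ⧸ U)))
    (hΩ : ∀ x : GroupLieAlgebra 𝓘(ℂ, E) G, ⁅x, ρ + flip21 ρ⁆ = 0) (hβ : IsSkew β) (g : G) :
    IsSkew (pushBivector U E' ρ β g) := by
  have := hp.finiteDimensional
  refine eq_of_forall_pair fun α α' => ?_
  have e : ∀ α : E' →ₗ[ℂ] ℂ,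
      (differentialAt E' (chartFun (g : G ⧸ U) α) (g : G ⧸ U) : E' →ₗ[ℂ] ℂ) = α :=
    differentialAt_chartFun _
  have s : ∀ α : E' →ₗ[ℂ] ℂ, ContMDiffAt 𝓘(ℂ, E') 𝓘(ℂ, ℂ) ω (chartFun (g : G ⧸ U) α)
      (g : G ⧸ U) := contMDiffAt_chartFun _
  have k : ∀ α α' : E' →ₗ[ℂ] ℂ, pair α α' (pushBivector U E' ρ β g)
      = liftedBracket ρ β (fun x : G => chartFun (g : G ⧸ U) α x)
        (fun x : G => chartFun (g : G ⧸ U) α' x) g := fun α α' =>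
    (congrArg₂ (fun a b : E' →ₗ[ℂ] ℂ => pair a b (pushBivector U E' ρ β g)) (e α) (e α')).symm.trans
      (hp.pair_pushBivector hΩ (s α) (s α'))
  rw [pair_flip21, map_neg, k, k, liftedBracket_swap hβ]

omit [ConnectedSpace G] in
-- A functional vanishing on the kernel of the differential of the projection factors through it;
-- the factor is the differential of a chart function.
theorem Manifold.IsSubmersion.exists_lder_one_eq
    (hp : Manifold.IsSubmersion 𝓘(ℂ, E) 𝓘(ℂ, E') ω (fun g : G => (g : G ⧸ U)))
    {α : GroupLieAlgebra 𝓘(ℂ, E) G →ₗ[ℂ] ℂ} (hα : ∀ a ∈ subgroupTangent (E := E) U, α a = 0) :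
    ∃ f : G ⧸ U → ℂ,
      ContMDiffOn 𝓘(ℂ, E') 𝓘(ℂ, ℂ) ω f (chartAt E' ((1 : G) : G ⧸ U)).source ∧
      lder (fun k : G => f (k : G ⧸ U)) 1 = α := by
  have := hp.finiteDimensional
  let P : GroupLieAlgebra 𝓘(ℂ, E) G →ₗ[ℂ] E' := projDeriv E' U 1
  have hmem : α ∈ (LinearMap.ker P).dualAnnihilator := by
    rw [Submodule.mem_dualAnnihilator]
    intro a ha
    exact hα a ((hp.projDeriv_one_eq_zero_iff a).1 ha)
  rw [← LinearMap.range_dualMap_eq_dualAnnihilator_ker] at hmem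
  obtain ⟨α', hα'⟩ := hmem
  refine ⟨chartFun ((1 : G) : G ⧸ U) α', contMDiffOn_chartFun _ _, ?_⟩
  rw [hp.lder_comp_mk ((contMDiffAt_chartFun _ _).mdifferentiableAt (by simp))]
  have h1 : leftTranslation (E := E) (1 : G) = LinearMap.id := by
    ext a
    have : (fun h : G => 1 * h) = id := by ext; simp
    rw [leftTranslation, this]
    exact congrArg (fun T : E →L[ℂ] E => T a) mfderiv_id
  have h2 := congrArg (fun T : E' →ₗ[ℂ] ℂ => T ∘ₗ P)
    (differentialAt_chartFun ((1 : G) : G ⧸ U) α')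
  rw [h1]
  exact h2.trans hα'

end HomogeneousBivector

theorem proposition6
    {E : Type*} [NormedAddCommGroup E] [NormedSpace ℂ E] [FiniteDimensional ℂ E]
    {G : Type*} [TopologicalSpace G] [ChartedSpace E G] [Group G] [LieGroup 𝓘(ℂ, E) ω G]
    [ConnectedSpace G]
    -- `U` is a closed connected subgroup with Lie algebra `u`
    (U : Subgroup G) (hUclosed : IsClosed (U : Set G)) (hUconn : IsConnected (U : Set G))
    (u : LieSubalgebra ℂ (GroupLieAlgebra 𝓘(ℂ, E) G))
    (hu : (u : Set (GroupLieAlgebra 𝓘(ℂ, E) G)) = subgroupTangent U)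
    -- the quotient manifold structure of `G/U`: the one for which `G → G/U` is a submersion
    {E' : Type*} [NormedAddCommGroup E'] [NormedSpace ℂ E']
    [ChartedSpace E' (G ⧸ U)] [IsManifold 𝓘(ℂ, E') ω (G ⧸ U)]
    (hp : Manifold.IsSubmersion 𝓘(ℂ, E) 𝓘(ℂ, E') ω (fun g : G => (g : G ⧸ U)))
    -- `m` is a `u`-invariant complement of `u`
    (m : LieSubmodule ℂ u (GroupLieAlgebra 𝓘(ℂ, E) G))
    (hm : IsCompl u.toSubmodule m.toSubmodule)
    -- `ρ` solves the CYBE, `ρ + ρ²¹` is `𝔤`-invariant and `ρ` is `u`-invariant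
    (ρ : GroupLieAlgebra 𝓘(ℂ, E) G ⊗[ℂ] GroupLieAlgebra 𝓘(ℂ, E) G)
    (hρ : CYB ρ = 0)
    (hΩ : ∀ x : GroupLieAlgebra 𝓘(ℂ, E) G, ⁅x, ρ + flip21 ρ⁆ = 0)
    (hρu : ∀ x : u, ⁅x, ρ⁆ = 0)
    -- `b ∈ (∧²(𝔤/u))^u`
    (b : LieQuot u ⊗[ℂ] LieQuot u) (hb : IsSkew b) (hbu : ∀ x : u, ⁅x, b⁆ = 0) :
    ∃ π : (q : G ⧸ U) → TangentSq E' q,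
      (∀ g : G, π (g : G ⧸ U) =
        actionPush E' U g (projPush E' U 1 (complLift u m hm b))
          + projPush E' U g (groupBivector ρ g)) ∧
      IsBivectorField π ∧
      (IsPoisson π ↔ toQuot3 u (CYB (ρ + complLift u m hm b)) = 0) := by
  have hβ : IsSkew (complLift u m hm b) := hb.map _
  have hinv : ∀ a ∈ subgroupTangent (E := E) U, ⁅a, ρ + complLift u m hm b⁆ = 0 := by
    intro a ha
    have hau : a ∈ u := by
      rw [← hu] at ha
      exact ha
    have h1 : ⁅a, ρ⁆ = 0 := hρu ⟨a, hau⟩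
    have h2 : ⁅a, complLift u m hm b⁆ = 0 := by
      rw [show a = ((⟨a, hau⟩ : u) : GroupLieAlgebra 𝓘(ℂ, E) G) from rfl, lie_complLift, hbu,
        map_zero]
    rw [lie_add, h1, h2, add_zero]
  have hker : ∀ a, projDeriv E' U 1 a = 0 ↔ a ∈ u := fun a => by
    rw [hp.projDeriv_one_eq_zero_iff, ← hu]
    rfl
  -- From here on only skewness of `β` and the invariance of `ρ + β` matter.
  generalize complLift u m hm b = β at hβ hinv ⊢
  -- An arbitrary representative of the coset is chosen; `hπ` shows that every other one gives the
  -- same bivector.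
  let π : (q : G ⧸ U) → TangentSq E' q := fun q => pushBivector U E' ρ β q.out
  have hπ : ∀ g : G, (π (g : G ⧸ U) : E' ⊗[ℂ] E') = pushBivector U E' ρ β g := fun g => by
    obtain ⟨k, hk⟩ := QuotientGroup.mk_out_eq_mul U g
    have h1 : (π (g : G ⧸ U) : E' ⊗[ℂ] E') = pushBivector U E' ρ β (g * k) :=
      congrArg (pushBivector U E' ρ β) hk
    exact h1.trans (hp.pushBivector_mul_right hUconn.isPreconnected hΩ hinv g k.2)
  have hbr : ∀ {f h : G ⧸ U → ℂ} {g : G}, ContMDiffAt 𝓘(ℂ, E') 𝓘(ℂ, ℂ) ω f (g : G ⧸ U) →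
      ContMDiffAt 𝓘(ℂ, E') 𝓘(ℂ, ℂ) ω h (g : G ⧸ U) → bivectorBracket π f h (g : G ⧸ U)
        = liftedBracket ρ β (fun k : G => f (k : G ⧸ U)) (fun k : G => h (k : G ⧸ U)) g :=
    fun {f h g} hf hh =>
      (congrArg (pair (V := E') (differentialAt E' f (g : G ⧸ U)) (differentialAt E' h (g : G ⧸ U)))
        (hπ g)).trans (hp.pair_pushBivector hΩ hf hh)
  -- Equality near `g` is needed since the inner bracket is differentiated again in the Jacobi sum.
  have hbrev : ∀ {f h : G ⧸ U → ℂ} {g : G}, ContMDiffAt 𝓘(ℂ, E') 𝓘(ℂ, ℂ) ω f (g : G ⧸ U) →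
      ContMDiffAt 𝓘(ℂ, E') 𝓘(ℂ, ℂ) ω h (g : G ⧸ U) →
      (fun k : G => bivectorBracket π f h (k : G ⧸ U)) =ᶠ[𝓝 g]
        liftedBracket ρ β (fun k : G => f (k : G ⧸ U)) (fun k : G => h (k : G ⧸ U)) := by
    intro f h g hf hh
    have hc := (hp.mdifferentiable_mk g).continuousAt
    filter_upwards [hc.eventually ((contMDiffAt_iff_contMDiffAt_nhds (by simp)).1 hf),
      hc.eventually ((contMDiffAt_iff_contMDiffAt_nhds (by simp)).1 hh)] with k h1 h2
      using hbr h1 h2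
  have hsm : ∀ {f h : G ⧸ U → ℂ} {g : G}, ContMDiffAt 𝓘(ℂ, E') 𝓘(ℂ, ℂ) ω f (g : G ⧸ U) →
      ContMDiffAt 𝓘(ℂ, E') 𝓘(ℂ, ℂ) ω h (g : G ⧸ U) →
      ContMDiffAt 𝓘(ℂ, E') 𝓘(ℂ, ℂ) ω (bivectorBracket π f h) (g : G ⧸ U) := fun hf hh =>
    hp.contMDiffAt_quotient_iff.1 ((contMDiffAt_liftedBracket (hp.contMDiffAt_comp_mk hf)
      (hp.contMDiffAt_comp_mk hh)).congr_of_eventuallyEq (hbrev hf hh))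
  have hjac : ∀ {f₁ f₂ f₃ : G ⧸ U → ℂ} {g : G}, ContMDiffAt 𝓘(ℂ, E') 𝓘(ℂ, ℂ) ω f₁ (g : G ⧸ U) →
      ContMDiffAt 𝓘(ℂ, E') 𝓘(ℂ, ℂ) ω f₂ (g : G ⧸ U) →
      ContMDiffAt 𝓘(ℂ, E') 𝓘(ℂ, ℂ) ω f₃ (g : G ⧸ U) →
      bivectorBracket π f₁ (bivectorBracket π f₂ f₃) (g : G ⧸ U)
        + bivectorBracket π f₂ (bivectorBracket π f₃ f₁) (g : G ⧸ U)
        + bivectorBracket π f₃ (bivectorBracket π f₁ f₂) (g : G ⧸ U)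
      = pair3 (lder (E := E) (fun k : G => f₁ (k : G ⧸ U)) g)
          (lder (fun k : G => f₂ (k : G ⧸ U)) g) (lder (fun k : G => f₃ (k : G ⧸ U)) g)
          (CYB (ρ + β)) := by
    intro f₁ f₂ f₃ g h₁ h₂ h₃
    rw [hbr h₁ (hsm h₂ h₃), hbr h₂ (hsm h₃ h₁), hbr h₃ (hsm h₁ h₂),
      liftedBracket_congr (Filter.EventuallyEq.refl _ _) (hbrev h₂ h₃),
      liftedBracket_congr (Filter.EventuallyEq.refl _ _) (hbrev h₃ h₁),
      liftedBracket_congr (Filter.EventuallyEq.refl _ _) (hbrev h₁ h₂)]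
    exact sum_liftedBracket hρ hΩ hβ (hp.contMDiffAt_comp_mk h₁) (hp.contMDiffAt_comp_mk h₂)
      (hp.contMDiffAt_comp_mk h₃)
  refine ⟨π, hπ, ⟨fun q => ?_, fun V hV f h hf hh q hq => ?_⟩, ?_⟩
  · exact hp.isSkew_pushBivector hΩ hβ q.out
  · obtain ⟨g, rfl⟩ := QuotientGroup.mk_surjective q
    exact (hsm (hf.contMDiffAt (hV.mem_nhds hq)) (hh.contMDiffAt (hV.mem_nhds hq))).contMDiffWithinAt
  · rw [toQuot3_eq_zero_iff]
    constructor
    -- The Jacobi identity at the base point alone already forces the vanishing.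
    · intro hP α₁ α₂ α₃ h₁ h₂ h₃
      have hex : ∀ {α : GroupLieAlgebra 𝓘(ℂ, E) G →ₗ[ℂ] ℂ}, (∀ a ∈ u, α a = 0) →
          ∃ f : G ⧸ U → ℂ,
            ContMDiffOn 𝓘(ℂ, E') 𝓘(ℂ, ℂ) ω f (chartAt E' ((1 : G) : G ⧸ U)).source ∧
            lder (fun k : G => f (k : G ⧸ U)) 1 = α := fun hα =>
        hp.exists_lder_one_eq fun a ha => hα a (by rw [← hu] at ha; exact ha)
      obtain ⟨f₁, s₁, rfl⟩ := hex h₁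
      obtain ⟨f₂, s₂, rfl⟩ := hex h₂
      obtain ⟨f₃, s₃, rfl⟩ := hex h₃
      have hV := (chartAt E' ((1 : G) : G ⧸ U)).open_source
      have h1 : ((1 : G) : G ⧸ U) ∈ (chartAt E' ((1 : G) : G ⧸ U)).source := mem_chart_source _ _
      rw [← hjac (s₁.contMDiffAt (hV.mem_nhds h1)) (s₂.contMDiffAt (hV.mem_nhds h1))
        (s₃.contMDiffAt (hV.mem_nhds h1))]
      exact hP _ hV f₁ f₂ f₃ s₁ s₂ s₃ _ h1
    · intro hC V hV f₁ f₂ f₃ s₁ s₂ s₃ q hq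
      obtain ⟨g, rfl⟩ := QuotientGroup.mk_surjective q
      -- Left translates of `u` are tangent to the cosets, along which pulled back functions are
      -- constant.
      have hz : ∀ {f : G ⧸ U → ℂ}, ContMDiffAt 𝓘(ℂ, E') 𝓘(ℂ, ℂ) ω f (g : G ⧸ U) →
          ∀ a ∈ u, lder (fun k : G => f (k : G ⧸ U)) g a = 0 := fun hf a ha => by
        rw [hp.lder_comp_mk (hf.mdifferentiableAt (by simp)), LinearMap.comp_apply,
          LinearMap.comp_apply, (hp.projDeriv_leftTranslation_eq_zero_iff g a).2 ((hker a).2 ha),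
          map_zero]
      have t₁ := s₁.contMDiffAt (hV.mem_nhds hq)
      have t₂ := s₂.contMDiffAt (hV.mem_nhds hq)
      have t₃ := s₃.contMDiffAt (hV.mem_nhds hq)
      rw [hjac t₁ t₂ t₃]
      exact hC _ _ _ (hz t₁) (hz t₂) (hz t₃)
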